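/- Consider a metric graph with finitely many vertices, $K\ge 1$ infinite leads $e_1,\dots,e_K$ (half-lines $[0,\infty)$, each attached at $x=0$ to one vertex) and $M\ge 0$ finite edges $e_{K+1},\dots,e_{K+M}$, where $e_m$ is identified with $[0,\ell_m]$, $\ell_m>0$, and joins two distinct vertices. Put $\ell_k=\infty$ for $k\le K$ and $L^2=\bigoplus_{m=1}^{K+M}L^2([0,\ell_m])$. Let $t_0>0$ and let $a_m\in C^\infty((-t_0,t_0);\mathbb R)$ with $a_m(0)=0$ for $K+1\le m\le K+M$; put $a_m\equiv 0$ for $m\le K$. For $|t|<t_0$ let $P(t)$ be the unbounded operator on $L^2$ given by $[P(t)u]_m=-e^{2a_m(t)}\partial_x^2u_m$, whose domain consists of all $u\in\bigoplus_m H^2([0,\ell_m])$ such that at each vertex $v$ the numbers $e^{a_m(t)/2}u_m(v)$ agree for all edges $e_m\ni v$ and $\sum_{e_m\ni v}e^{3a_m(t)/2}\partial_\nu u_m(v)=0$, where $\partial_\nu u_m(0)=-u_m'(0)$ and $\partial_\nu u_m(\ell_m)=u_m'(\ell_m)$. ($P(t)$ is unitarily equivalent to the Neumann Laplacian of the graph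 with edge lengths $e^{-a_m(t)}\ell_m$.) Let $\mathcal D_{\rm loc}(P(t))$ be the space of functions in $H^2_{\rm loc}$ that satisfy these vertex conditions. Let $C_c^\infty$ denote the compactly supported functions on the graph that are smooth on each closed edge. The resolvent $R(\lambda,t)=(P(t)-\lambda^2)^{-1}$, $\operatorname{Im}\lambda>0$, continues meromorphically to $\lambda\in\mathbb C$ as a family of operators $L^2_{\rm comp}\to L^2_{\rm loc}$: for all $\chi_1,\chi_2\in C_c^\infty$, $\chi_1R(\lambda,t)\chi_2$ is a meromorphic family of bounded operators on $L^2$. Its poles are the resonances of $P(t)$; a resonance is called simple if it is a pole of order one whose residue has rank one. A resonant state of $P(t)$ corresponding to $\lambda$ is a function $0\ne u\in\mathcal D_{\rm loc}(P(t))$ with $(P(t)-\lambda^2)u=0$ which on every lead is a multiple of $e^{i\lambda x}$. (1) Let $\gamma$ be a smooth Jordan curve in $\mathbb C$ such that $R(\lambda,t)$ has no poles on $\gamma$ for $|t|<t_0$. Then for all $\chi_1,\chi_2\in C_c^\infty$, $$\int_\gamma\chi_1R(\zeta,t)\chi_2\,d\zeta\in C^\infty\big((-t_0,t_0);\mathcal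 L(L^2,L^2)\big).$$ (2) If $\lambda_0$ is a simple resonance of $P(0)$, then there are $\varepsilon\in(0,t_0]$ and $C^\infty$ families $t\mapsto\lambda(t)\in\mathbb C$ and $t\mapsto u(t)\in H^2_{\rm loc}$, $|t|<\varepsilon$, such that $\lambda(0)=\lambda_0$ and, for all $|t|<\varepsilon$, $\lambda(t)$ is a resonance of $P(t)$ and $u(t)\in\mathcal D_{\rm loc}(P(t))$ is a resonant state of $P(t)$ corresponding to $\lambda(t)$. -/

import Mathlib

open MeasureTheory Set Filter Topology
open scoped ContDiff ENNReal

noncomputable section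

namespace QuantumGraph

/-- A metric graph with vertices `Fin J`, infinite leads `Fin K` (each a half-line starting at one
vertex) and finite edges `Fin M`, each joining two distinct vertices and carrying a length. -/
structure MetricGraph (J K M : ℕ) where
  /-- the vertex of a lead -/
  base : Fin K → Fin J
  /-- the vertex of a finite edge at `x = 0` -/
  src : Fin M → Fin J
  /-- the vertex of a finite edge at `x = len m` -/
  tgt : Fin M → Fin J
  no_loop : ∀ m, src m ≠ tgt m
  len : Fin M → ℝ
  len_pos : ∀ m, 0 < len m

/-- All edges: the leads and the finite edges. -/
abbrev Edge (K M : ℕ) : Type := Fin K ⊕ Fin M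

variable {J K M : ℕ}

/-- The parameter interval of an edge: `[0, ∞)` for a lead and `[0, len m]` for a finite edge. -/
def MetricGraph.ival (G : MetricGraph J K M) : Edge K M → Set ℝ
  | Sum.inl _ => Ici 0
  | Sum.inr m => Icc 0 (G.len m)

/-- The Hilbert space `L²`, the orthogonal direct sum of the spaces `L²` of the edges. -/
abbrev MetricGraph.L2 (G : MetricGraph J K M) : Type :=
  PiLp 2 (fun e : Edge K M => Lp ℂ 2 (volume.restrict (G.ival e)))

/-- The logarithmic scaling parameters of all edges; the leads are not deformed. -/
def scale (α : Fin M → ℝ) : Edge K M → ℝ := Sum.elim (fun _ => 0) α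

/-- `f` is in `H²_loc` of every (closed) edge, with first and second derivatives `f'`, `f''`: `f` is
continuously differentiable up to the end points with absolutely continuous derivative `f'`, and
`f''` is square integrable on bounded parts of the edge. -/
structure IsH2loc (G : MetricGraph J K M) (f f' f'' : Edge K M → ℝ → ℂ) : Prop where
  integral_deriv : ∀ e, ∀ x ∈ G.ival e, f e x = f e 0 + ∫ y in (0 : ℝ)..x, f' e y
  integral_deriv2 : ∀ e, ∀ x ∈ G.ival e, f' e x = f' e 0 + ∫ y in (0 : ℝ)..x, f'' e y
  memLp : ∀ e, ∀ R : ℝ, MemLp (f'' e) 2 (volume.restrict (G.ival e ∩ Iic R))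

/-- The vertex conditions of the deformed operator: at each vertex `v` the numbers
`e^{α_m / 2} u_m(v)` agree for all the edges meeting there, and the sum over these edges of
`e^{3 α_m / 2} ∂_ν u_m(v)` vanishes, with `∂_ν` the outward derivative
(`∂_ν u(0) = -u'(0)` and `∂_ν u(len m) = u'(len m)`). -/
structure VertexCond (G : MetricGraph J K M) (α : Fin M → ℝ) (f f' : Edge K M → ℝ → ℂ) :
    Prop where
  continuity : ∃ c : Fin J → ℂ,
    (∀ k, f (Sum.inl k) 0 = c (G.base k)) ∧
    (∀ m, (Real.exp (α m / 2) : ℂ) * f (Sum.inr m) 0 = c (G.src m)) ∧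
    (∀ m, (Real.exp (α m / 2) : ℂ) * f (Sum.inr m) (G.len m) = c (G.tgt m))
  kirchhoff : ∀ v : Fin J,
    (∑ k, if G.base k = v then -f' (Sum.inl k) 0 else 0) +
    (∑ m, ((if G.src m = v then
              (Real.exp (3 * α m / 2) : ℂ) * (-f' (Sum.inr m) 0) else 0) +
           (if G.tgt m = v then
              (Real.exp (3 * α m / 2) : ℂ) * f' (Sum.inr m) (G.len m) else 0))) = 0

/-- The graph of the unbounded operator `P` with parameters `α`, `(P u)_m = -e^{2 α_m} u_m''`, on
`L²`: `u` is in its domain and `P u = w`. (`u` and `w` are in `L²`, so that `u` and `u''` are.) -/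
def OpRel (G : MetricGraph J K M) (α : Fin M → ℝ) (u w : G.L2) : Prop :=
  ∃ f f' f'' : Edge K M → ℝ → ℂ, IsH2loc G f f' f'' ∧ VertexCond G α f f' ∧
    (∀ e, MemLp (f' e) 2 (volume.restrict (G.ival e))) ∧
    (∀ e, u e =ᵐ[volume.restrict (G.ival e)] f e) ∧
    (∀ e, w e =ᵐ[volume.restrict (G.ival e)]
      fun x => -(Real.exp (2 * scale α e) : ℂ) * f'' e x)

/-- `T` is the bounded two-sided inverse `(P - lam²)⁻¹ : L² → D(P)`. -/
def IsResolvent (G : MetricGraph J K M) (α : Fin M → ℝ) (lam : ℂ) (T : G.L2 →L[ℂ] G.L2) : Prop :=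
  (∀ f : G.L2, OpRel G α (T f) (f + lam ^ 2 • T f)) ∧
  (∀ u w : G.L2, OpRel G α u w → T (w - lam ^ 2 • u) = u)

/-- Compactly supported functions, smooth on every closed edge (up to the end points). -/
structure Cutoff (K M : ℕ) where
  toFun : Edge K M → ℝ → ℂ
  smooth : ∀ e, ContDiff ℝ ∞ (toFun e)
  compact : ∀ e, HasCompactSupport (toFun e)

lemma Cutoff.memLp_top (χ : Cutoff K M) (e : Edge K M) (s : Set ℝ) :
    MemLp (χ.toFun e) ∞ (volume.restrict s) :=
  (χ.smooth e).continuous.memLp_top_of_hasCompactSupport (χ.compact e) _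

/-- Multiplication by `χ`, as a bounded operator on `L²`. -/
def Cutoff.mul (χ : Cutoff K M) (G : MetricGraph J K M) : G.L2 →L[ℂ] G.L2 :=
  (PiLp.continuousLinearEquiv 2 ℂ _).symm.toContinuousLinearMap ∘L
    ContinuousLinearMap.piMap (fun e =>
      (ContinuousLinearMap.mul ℂ ℂ).holderL (volume.restrict (G.ival e)) ∞ 2 2
        ((χ.memLp_top e (G.ival e)).toLp (χ.toFun e))) ∘L
    (PiLp.continuousLinearEquiv 2 ℂ _).toContinuousLinearMap

lemma Cutoff.mul_apply (χ : Cutoff K M) (G : MetricGraph J K M) (u : G.L2) (e : Edge K M) :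
    χ.mul G u e =ᵐ[volume.restrict (G.ival e)] fun x => χ.toFun e x * u e x := by
  have h := ContinuousLinearMap.coeFn_holder (r := 2) (ContinuousLinearMap.mul ℂ ℂ)
    ((χ.memLp_top e (G.ival e)).toLp (χ.toFun e)) (u e)
  filter_upwards [h, (χ.memLp_top e (G.ival e)).coeFn_toLp] with x hx hx'
  refine Eq.trans hx ?_
  rw [hx']
  rfl

/-- `F` is the meromorphic continuation to `ℂ` of `lam ↦ χ₁ (P - lam²)⁻¹ χ₂`, `Im lam > 0`, as a
family of bounded operators on `L²`. (The normal form only fixes the values at the removable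
singularities, by continuity, and at the poles, as `0`; it makes `F` unique.) -/
def IsContinuedResolvent (G : MetricGraph J K M) (α : Fin M → ℝ) (χ₁ χ₂ : Cutoff K M)
    (F : ℂ → G.L2 →L[ℂ] G.L2) : Prop :=
  MeromorphicNFOn F univ ∧
  ∀ lam : ℂ, 0 < lam.im →
    ∃ T : G.L2 →L[ℂ] G.L2, IsResolvent G α lam T ∧ F lam = χ₁.mul G ∘L T ∘L χ₂.mul G

open Classical in
/-- The cut-off continued resolvent `χ₁ R(lam) χ₂`. -/
def cutoffResolvent (G : MetricGraph J K M) (α : Fin M → ℝ) (χ₁ χ₂ : Cutoff K M) :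
    ℂ → G.L2 →L[ℂ] G.L2 :=
  if h : ∃ F, IsContinuedResolvent G α χ₁ χ₂ F then h.choose else 0

/-- `lam` is a resonance: a pole of the continued resolvent `R : L²_comp → L²_loc`. -/
def IsResonance (G : MetricGraph J K M) (α : Fin M → ℝ) (lam : ℂ) : Prop :=
  ∃ χ₁ χ₂ : Cutoff K M, meromorphicOrderAt (cutoffResolvent G α χ₁ χ₂) lam < 0

/-- `lam₀` is a simple resonance: a pole of order one of the continued resolvent whose residue
`L²_comp → L²_loc` has rank one. -/
def IsSimpleResonance (G : MetricGraph J K M) (α : Fin M → ℝ) (lam₀ : ℂ) : Prop :=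
  IsResonance G α lam₀ ∧
  ∀ χ₁ χ₂ : Cutoff K M, ∃ A : G.L2 →L[ℂ] G.L2,
    Tendsto (fun lam => (lam - lam₀) • cutoffResolvent G α χ₁ χ₂ lam) (𝓝[≠] lam₀) (𝓝 A) ∧
    LinearMap.rank (A : G.L2 →ₗ[ℂ] G.L2) ≤ 1

/-- `u` is a resonant state corresponding to `lam`: a nonzero element of `D_loc(P)` with
`(P - lam²) u = 0` that is outgoing, that is, a multiple of `e^{i lam x}` on every lead. -/
def IsResonantState (G : MetricGraph J K M) (α : Fin M → ℝ) (lam : ℂ)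
    (u : Edge K M → ℝ → ℂ) : Prop :=
  (∃ e, ∃ x ∈ G.ival e, u e x ≠ 0) ∧
  (∃ u' u'' : Edge K M → ℝ → ℂ, IsH2loc G u u' u'' ∧ VertexCond G α u u' ∧
    ∀ e, ∀ᵐ x ∂(volume.restrict (G.ival e)),
      -(Real.exp (2 * scale α e) : ℂ) * u'' e x - lam ^ 2 * u e x = 0) ∧
  ∀ k : Fin K, ∃ c : ℂ, ∀ x : ℝ, 0 ≤ x → u (Sum.inl k) x = c * Complex.exp (Complex.I * lam * x)

/-- `t ↦ u t` is a `C^∞` map from `S` to `L²_loc` of the graph: its restrictions to bounded parts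
of the edges are `C^∞` maps to `L²`. -/
def SmoothL2loc (G : MetricGraph J K M) (S : Set ℝ) (u : ℝ → Edge K M → ℝ → ℂ) : Prop :=
  ∀ e, ∀ R : ℝ, ∃ c : ℝ → Lp ℂ 2 (volume.restrict (G.ival e ∩ Iic R)),
    ContDiffOn ℝ ∞ c S ∧ ∀ t ∈ S, c t =ᵐ[volume.restrict (G.ival e ∩ Iic R)] u t e

/-- `t ↦ u t` is a `C^∞` map from `S` to `H²_loc` of the graph (with the topology of
`L²_loc` convergence of the function and its first two derivatives). -/
def SmoothH2loc (G : MetricGraph J K M) (S : Set ℝ) (u : ℝ → Edge K M → ℝ → ℂ) : Prop :=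
  ∃ u' u'' : ℝ → Edge K M → ℝ → ℂ, (∀ t ∈ S, IsH2loc G (u t) (u' t) (u'' t)) ∧
    SmoothL2loc G S u ∧ SmoothL2loc G S u' ∧ SmoothL2loc G S u''

/-- A smooth Jordan curve in `ℂ`, as a regular parametrization of period `1`, injective on a
period. -/
structure IsSmoothJordanCurve (γ : ℝ → ℂ) : Prop where
  smooth : ContDiff ℝ ∞ γ
  periodic : Function.Periodic γ 1
  injOn : InjOn γ (Ico 0 1)
  regular : ∀ s, deriv γ s ≠ 0

end QuantumGraph

end

open scoped ComplexConjugate BoundedContinuousFunction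

noncomputable section

namespace QuantumGraph

variable {J K M : ℕ}

/-! ### Integration by parts for primitives of integrable functions -/

/-! On each edge the equation `-e^{2α} u'' = λ² u + f` is solved explicitly. With `κ = e^{-α} λ`, a
solution is a combination of `cos (κ x)` and `sin (κ x) / κ` plus a particular solution that
vanishes beyond the support of the source. The outgoing condition leaves one free coefficient on a
lead and two on a finite edge, hence one for each end of an edge. The vertex conditions can also be
written as one equation for each end (`vform_eq_zero_iff`), so outgoing solutions are governed by a
square matrix `D`, the `vertexMatrix`, which is entire in `λ` and in the complexified scaling
parameters. Solving for the coefficients gives `resFormula`: the cut-off resolvent is an entire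
operator family minus a finite sum of entire rank one operators weighted by the entries of `D⁻¹`.
All the poles come from `D⁻¹`.

For `Im λ > 0`, integration by parts and the vertex conditions show that the quadratic form of `P`
is nonnegative, which gives `(Im λ)² ‖u‖ ≤ ‖(P - λ²) u‖`. Hence `D` is invertible there and the
resolvent exists (`det_vertexMatrix_ne_zero`, `exists_isResolvent`). So `det D` is not identically
zero, and by the identity theorem the formula is the meromorphic continuation
(`cutoffResolvent_eq`).

Resonances are exactly the zeros of `det D`. The substantial direction is that a zero cannot be
hidden by the factors around `D⁻¹`: the cut-off homogeneous solutions are linearly independent, and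
sources together with the range of `D` fill the whole space, so a pole of order at most one of the
cut-off resolvent passes to `D⁻¹` with control of the residue (`exists_residue_inv`).

Statement (1) follows because `det D` does not vanish on the curve, so the integrand is jointly
smooth in `t` and the curve parameter. For (2), let `N` be the residue of `D⁻¹` at a simple
resonance. Then `N D = 0`, and `N D' v = v` for `v` in the kernel of `D`, where `D'` is the
derivative in `λ`. Rank one makes this kernel a line, and the implicit function theorem applies to
`D(λ, b) v = 0` with one coordinate of `v` fixed (`exists_deformation`). The families in `t` arise
by composition with `b = a(t)`. -/

lemma integral_mul_prim_add (f g : ℝ → ℂ) {x : ℝ} (hx : 0 ≤ x)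
    (hf : IntervalIntegrable f volume 0 x) (hg : IntervalIntegrable g volume 0 x) :
    ∫ y in (0 : ℝ)..x, (f y * (∫ z in (0 : ℝ)..y, g z) + (∫ z in (0 : ℝ)..y, f z) * g y) =
      (∫ y in (0 : ℝ)..x, f y) * ∫ y in (0 : ℝ)..x, g y := by
  set μ := (volume : Measure ℝ).restrict (Ioc 0 x)
  have hfμ : Integrable f μ := (intervalIntegrable_iff_integrableOn_Ioc_of_le hx).1 hf
  have hgμ : Integrable g μ := (intervalIntegrable_iff_integrableOn_Ioc_of_le hx).1 hg
  have hh : Integrable (fun p : ℝ × ℝ => f p.1 * g p.2) (μ.prod μ) := hfμ.mul_prod hgμ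
  have hs : MeasurableSet {p : ℝ × ℝ | p.2 ≤ p.1} := measurableSet_le measurable_snd measurable_fst
  -- The double integral of `f y * g z` over the square is cut along the diagonal. By Fubini the two
  -- triangles give the two terms of the product rule, so nothing beyond integrability of `f` and
  -- `g` is needed.
  have h1 : Integrable ({p : ℝ × ℝ | p.2 ≤ p.1}.indicator fun p => f p.1 * g p.2) (μ.prod μ) :=
    hh.indicator hs
  have h2 : Integrable ({p : ℝ × ℝ | p.2 ≤ p.1}ᶜ.indicator fun p => f p.1 * g p.2) (μ.prod μ) :=
    hh.indicator hs.compl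
  have e1 : ∀ y ∈ Ioc 0 x, ∫ z, ({p : ℝ × ℝ | p.2 ≤ p.1}.indicator (fun p => f p.1 * g p.2)) (y, z) ∂μ
      = f y * ∫ z in (0 : ℝ)..y, g z := by
    intro y hy
    have : (fun z => ({p : ℝ × ℝ | p.2 ≤ p.1}.indicator (fun p => f p.1 * g p.2)) (y, z))
        = (Iic y).indicator (fun z => f y * g z) := by
      ext z; simp [indicator]
    rw [this, integral_indicator measurableSet_Iic, Measure.restrict_restrict measurableSet_Iic,
      integral_const_mul, intervalIntegral.integral_of_le hy.1.le]
    congr 3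
    ext z; simp only [mem_inter_iff, mem_Iic, mem_Ioc]; constructor
    · rintro ⟨a, b, c⟩; exact ⟨b, a⟩
    · rintro ⟨a, b⟩; exact ⟨b, a, b.trans hy.2⟩
  have e2 : ∀ z ∈ Ioc 0 x, ∫ y, ({p : ℝ × ℝ | p.2 ≤ p.1}ᶜ.indicator (fun p => f p.1 * g p.2)) (y, z) ∂μ
      = (∫ y in (0 : ℝ)..z, f y) * g z := by
    intro z hz
    have : (fun y => ({p : ℝ × ℝ | p.2 ≤ p.1}ᶜ.indicator (fun p => f p.1 * g p.2)) (y, z))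
        = (Iio z).indicator (fun y => f y * g z) := by
      ext y; simp [indicator]
    rw [this, integral_indicator measurableSet_Iio, Measure.restrict_restrict measurableSet_Iio,
      integral_mul_const, intervalIntegral.integral_of_le hz.1.le, integral_Ioc_eq_integral_Ioo]
    congr 3
    ext y; simp only [mem_inter_iff, mem_Iio, mem_Ioc, mem_Ioo]; constructor
    · rintro ⟨a, b, c⟩; exact ⟨b, a⟩
    · rintro ⟨a, b⟩; exact ⟨b, a, b.le.trans hz.2⟩
  have i1 := h1.integral_prod_left
  have i2 := h2.integral_prod_right
  rw [intervalIntegral.integral_of_le hx, intervalIntegral.integral_of_le hx,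
    intervalIntegral.integral_of_le hx, ← integral_prod_mul (μ := μ) (ν := μ) f g]
  rw [← indicator_self_add_compl {p : ℝ × ℝ | p.2 ≤ p.1} (fun p : ℝ × ℝ => f p.1 * g p.2)]
  rw [integral_add' h1 h2, integral_prod _ h1, integral_prod_symm _ h2, ← integral_add i1 i2]
  refine setIntegral_congr_fun measurableSet_Ioc fun y hy => ?_
  simp only [← e1 y hy, ← e2 y hy, μ]

/-- `f` is a primitive of `f'` on `s`, starting from `0`. -/
def PrimOn (s : Set ℝ) (f f' : ℝ → ℂ) : Prop := ∀ x ∈ s, f x = f 0 + ∫ y in (0 : ℝ)..x, f' y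

lemma PrimOn.continuousOn {b : ℝ} {f f' : ℝ → ℂ} (h : PrimOn (Icc 0 b) f f')
    (hf : IntervalIntegrable f' volume 0 b) : ContinuousOn f (Icc 0 b) := by
  rcases lt_or_ge b 0 with hb | hb
  · simp [Icc_eq_empty_of_lt hb]
  have := intervalIntegral.continuousOn_primitive_interval' hf (left_mem_uIcc)
  rw [uIcc_of_le hb] at this
  exact (continuousOn_const.add this).congr h

/-- Once both functions are written as constant plus primitive, all terms are linear except the
product of the two primitives, which `integral_mul_prim_add` handles. -/
lemma PrimOn.mul {b : ℝ} (hb : 0 ≤ b) {f f' g g' : ℝ → ℂ} (hf : PrimOn (Icc 0 b) f f')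
    (hg : PrimOn (Icc 0 b) g g') (hf' : IntervalIntegrable f' volume 0 b)
    (hg' : IntervalIntegrable g' volume 0 b) :
    f b * g b = f 0 * g 0 + ∫ y in (0 : ℝ)..b, (f' y * g y + f y * g' y) := by
  have hF : ContinuousOn (fun y => ∫ z in (0 : ℝ)..y, f' z) (uIcc 0 b) :=
    intervalIntegral.continuousOn_primitive_interval' hf' left_mem_uIcc
  have hG : ContinuousOn (fun y => ∫ z in (0 : ℝ)..y, g' z) (uIcc 0 b) :=
    intervalIntegral.continuousOn_primitive_interval' hg' left_mem_uIcc
  have key := integral_mul_prim_add f' g' hb hf' hg'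
  have e : ∫ y in (0 : ℝ)..b, (f' y * g y + f y * g' y) =
      ∫ y in (0 : ℝ)..b, (f' y * g 0 + f 0 * g' y + (f' y * (∫ z in (0 : ℝ)..y, g' z)
        + (∫ z in (0 : ℝ)..y, f' z) * g' y)) := by
    refine intervalIntegral.integral_congr fun y hy => ?_
    rw [uIcc_of_le hb] at hy
    rw [hf y hy, hg y hy]; ring
  rw [e, intervalIntegral.integral_add, intervalIntegral.integral_add,
    intervalIntegral.integral_mul_const, intervalIntegral.integral_const_mul, key,
    hf b ⟨hb, le_rfl⟩, hg b ⟨hb, le_rfl⟩]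
  · ring
  · exact hf'.mul_const _
  · exact hg'.const_mul _
  · exact (hf'.mul_const _).add (hg'.const_mul _)
  · exact (hf'.mul_continuousOn hG).add (hg'.continuousOn_mul hF)

lemma PrimOn.conj {s : Set ℝ} {f f' : ℝ → ℂ} (h : PrimOn s f f') :
    PrimOn s (fun x => conj (f x)) (fun x => conj (f' x)) := by
  intro x hx
  change conj (f x) = conj (f 0) + _
  rw [h x hx, map_add, intervalIntegral.intervalIntegral_conj]

lemma IntervalIntegrable.conj {f : ℝ → ℂ} {a b : ℝ} (h : IntervalIntegrable f volume a b) :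
    IntervalIntegrable (fun x => conj (f x)) volume a b :=
  ⟨(Complex.conjCLE : ℂ →L[ℝ] ℂ).integrable_comp h.1,
    (Complex.conjCLE : ℂ →L[ℝ] ℂ).integrable_comp h.2⟩

/-! ### The parameter intervals and functions in `H²_loc` -/

variable (G : MetricGraph J K M)

lemma measurableSet_ival (e : Edge K M) : MeasurableSet (G.ival e) := by
  cases e
  · exact measurableSet_Ici
  · exact measurableSet_Icc

lemma zero_mem_ival (e : Edge K M) : (0 : ℝ) ∈ G.ival e := by
  cases e
  · exact mem_Ici.2 le_rfl
  · exact left_mem_Icc.2 (G.len_pos _).le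

lemma nonneg_of_mem_ival {e : Edge K M} {x : ℝ} (hx : x ∈ G.ival e) : 0 ≤ x := by
  cases e
  · exact hx
  · exact hx.1

lemma Icc_subset_ival {e : Edge K M} {x : ℝ} (hx : x ∈ G.ival e) : Icc 0 x ⊆ G.ival e := by
  cases e
  · exact fun y (hy : y ∈ Icc 0 x) => mem_Ici.2 hy.1
  · exact fun y (hy : y ∈ Icc 0 x) => mem_Icc.2 ⟨hy.1, hy.2.trans (mem_Icc.1 hx).2⟩

variable {G}

lemma memLp_intervalIntegrable {e : Edge K M} {f : ℝ → ℂ} {x : ℝ} (hx : x ∈ G.ival e)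
    (h : MemLp f 2 (volume.restrict (G.ival e ∩ Iic x))) : IntervalIntegrable f volume 0 x := by
  have h0 := nonneg_of_mem_ival G hx
  have h1 : MemLp f 2 (volume.restrict (Icc 0 x)) :=
    h.mono_measure (Measure.restrict_mono
      (subset_inter (Icc_subset_ival G hx) Icc_subset_Iic_self) le_rfl)
  rw [intervalIntegrable_iff_integrableOn_Icc_of_le h0]
  exact h1.integrable (by norm_num)

lemma memLp_ival_inter {e : Edge K M} {f : ℝ → ℂ} (R : ℝ)
    (h : MemLp f 2 (volume.restrict (G.ival e))) :
    MemLp f 2 (volume.restrict (G.ival e ∩ Iic R)) :=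
  h.mono_measure (Measure.restrict_mono inter_subset_left le_rfl)

lemma ContinuousOn.of_Icc_ival {e : Edge K M} {f : ℝ → ℂ}
    (h : ∀ b ∈ G.ival e, ContinuousOn f (Icc 0 b)) : ContinuousOn f (G.ival e) := by
  cases e with
  | inl k =>
    intro x hx
    have hx' : (0 : ℝ) ≤ x := hx
    refine (h (x + 1) (by change (0 : ℝ) ≤ x + 1; linarith) x ⟨hx, by linarith⟩).mono_of_mem_nhdsWithin ?_
    have : Iic (x + 1) ∈ 𝓝 x := Iic_mem_nhds (by linarith)
    filter_upwards [self_mem_nhdsWithin, mem_nhdsWithin_of_mem_nhds this] with y h1 h2 using ⟨h1, h2⟩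
  | inr m => exact h (G.len m) ⟨(G.len_pos m).le, le_rfl⟩

namespace IsH2loc
variable {f f' f'' : Edge K M → ℝ → ℂ} (h : IsH2loc G f f' f'')
include h

lemma intervalIntegrable_deriv2 {e : Edge K M} {x : ℝ} (hx : x ∈ G.ival e) :
    IntervalIntegrable (f'' e) volume 0 x := memLp_intervalIntegrable hx (h.memLp e x)

lemma continuousOn_deriv (e : Edge K M) : ContinuousOn (f' e) (G.ival e) :=
  ContinuousOn.of_Icc_ival fun _ hb => PrimOn.continuousOn
    (fun x hx => h.integral_deriv2 e x (Icc_subset_ival G hb hx)) (h.intervalIntegrable_deriv2 hb)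

lemma intervalIntegrable_deriv {e : Edge K M} {x : ℝ} (hx : x ∈ G.ival e) :
    IntervalIntegrable (f' e) volume 0 x := by
  refine ContinuousOn.intervalIntegrable ((h.continuousOn_deriv e).mono ?_)
  rw [uIcc_of_le (nonneg_of_mem_ival G hx)]
  exact Icc_subset_ival G hx

end IsH2loc

lemma IsH2loc.add_smul {f f' f'' g g' g'' : Edge K M → ℝ → ℂ} (h : IsH2loc G f f' f'')
    (k : IsH2loc G g g' g'') (c : ℂ) :
    IsH2loc G (fun e x => f e x + c * g e x) (fun e x => f' e x + c * g' e x)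
      (fun e x => f'' e x + c * g'' e x) where
  integral_deriv e x hx := by
    rw [intervalIntegral.integral_add (h.intervalIntegrable_deriv hx)
      ((k.intervalIntegrable_deriv hx).const_mul _), intervalIntegral.integral_const_mul,
      h.integral_deriv e x hx, k.integral_deriv e x hx]
    ring
  integral_deriv2 e x hx := by
    rw [intervalIntegral.integral_add (h.intervalIntegrable_deriv2 hx)
      ((k.intervalIntegrable_deriv2 hx).const_mul _), intervalIntegral.integral_const_mul,
      h.integral_deriv2 e x hx, k.integral_deriv2 e x hx]
    ring
  memLp e R := (h.memLp e R).add ((k.memLp e R).const_mul c)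

/-! ### Edge ends and the vertex conditions as a linear system -/

/-- The ends of the edges: `inl e` is the end `x = 0` of `e`, `inr m` the end `x = len m`. -/
abbrev End (K M : ℕ) : Type := Edge K M ⊕ Fin M

/-- The vertex of an end. -/
def MetricGraph.vtx (G : MetricGraph J K M) : End K M → Fin J :=
  Sum.elim (Sum.elim G.base G.src) G.tgt

/-- The edge of an end. -/
def edgeOf : End K M → Edge K M := Sum.elim id Sum.inr

/-- The position of an end on its edge. -/
def MetricGraph.pos (G : MetricGraph J K M) : End K M → ℝ := Sum.elim (fun _ => 0) G.len

/-- The sign of the outward derivative at an end. -/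
def outSign : End K M → ℂ := Sum.elim (fun _ => -1) (fun _ => 1)

/-- The ends at the vertex of `i`. -/
def MetricGraph.nbrs (G : MetricGraph J K M) (i : End K M) : Finset (End K M) :=
  Finset.univ.filter fun j => G.vtx j = G.vtx i

/-- The linear form of the vertex conditions in terms of the scaled values and fluxes at the
ends. -/
def MetricGraph.vform (G : MetricGraph J K M) (val flux : End K M → ℂ) (i : End K M) : ℂ :=
  val i - (∑ j ∈ G.nbrs i, val j) / (G.nbrs i).card + ∑ j ∈ G.nbrs i, flux j

lemma mem_nbrs_self (i : End K M) : i ∈ G.nbrs i := by simp [MetricGraph.nbrs]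

lemma card_nbrs_ne_zero (i : End K M) : ((G.nbrs i).card : ℂ) ≠ 0 := by
  exact_mod_cast (Finset.card_pos.2 ⟨i, mem_nbrs_self i⟩).ne'

lemma nbrs_congr {i j : End K M} (h : G.vtx i = G.vtx j) : G.nbrs i = G.nbrs j := by
  simp [MetricGraph.nbrs, h]

/-- In the sum of the equations over the ends at one vertex, the deviations of the values from their
mean cancel, which leaves a nonzero multiple of the flux sum. So the flux sum vanishes, and then
each value equals the mean. This packs both vertex conditions into one equation per end, matching
the number of unknowns. -/
lemma vform_eq_zero_iff (val flux : End K M → ℂ) :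
    G.vform val flux = 0 ↔
      (∃ c : Fin J → ℂ, ∀ i, val i = c (G.vtx i)) ∧
      ∀ v, ∑ i, (if G.vtx i = v then flux i else 0) = 0 := by
  have hsum : ∀ i, ∑ j, (if G.vtx j = G.vtx i then flux j else 0) = ∑ j ∈ G.nbrs i, flux j := by
    intro i; rw [MetricGraph.nbrs, Finset.sum_filter]
  constructor
  · intro h
    have hi : ∀ i, val i - (∑ j ∈ G.nbrs i, val j) / (G.nbrs i).card
        + ∑ j ∈ G.nbrs i, flux j = 0 := fun i => congrFun h i
    have hflux : ∀ i, ∑ j ∈ G.nbrs i, flux j = 0 := by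
      intro i
      have h1 : ∑ k ∈ G.nbrs i, (val k - (∑ j ∈ G.nbrs i, val j) / (G.nbrs i).card
        + ∑ j ∈ G.nbrs i, flux j) = 0 := by
        refine Finset.sum_eq_zero fun k hk => ?_
        have : G.nbrs k = G.nbrs i := nbrs_congr (by simpa [MetricGraph.nbrs] using hk)
        rw [← this]; exact hi k
      rw [Finset.sum_add_distrib, Finset.sum_sub_distrib] at h1
      simp only [Finset.sum_const, nsmul_eq_mul] at h1
      rw [mul_div_cancel₀ _ (card_nbrs_ne_zero i), sub_self, zero_add] at h1
      exact (mul_eq_zero.1 h1).resolve_left (card_nbrs_ne_zero i)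
    refine ⟨?_, ?_⟩
    · classical
      refine ⟨fun v => if h : ∃ i, G.vtx i = v then
        (∑ j ∈ G.nbrs h.choose, val j) / (G.nbrs h.choose).card else 0, fun i => ?_⟩
      have hex : ∃ j, G.vtx j = G.vtx i := ⟨i, rfl⟩
      change _ = dite _ _ _
      rw [dif_pos hex, nbrs_congr hex.choose_spec]
      have := hi i
      rw [hflux i, add_zero] at this
      exact sub_eq_zero.1 this
    · intro v
      by_cases hv : ∃ i, G.vtx i = v
      · obtain ⟨i, rfl⟩ := hv
        rw [hsum, hflux]
      · push Not at hv
        exact Finset.sum_eq_zero fun i _ => if_neg (hv i)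
  · rintro ⟨⟨c, hc⟩, hf⟩
    ext i
    simp only [MetricGraph.vform, Pi.zero_apply]
    rw [← hsum, hf, add_zero, hc i]
    have : ∑ j ∈ G.nbrs i, val j = (G.nbrs i).card * c (G.vtx i) := by
      rw [← nsmul_eq_mul, ← Finset.sum_const]
      refine Finset.sum_congr rfl fun j hj => ?_
      rw [hc j, show G.vtx j = G.vtx i by simpa [MetricGraph.nbrs] using hj]
    rw [this, mul_div_cancel_left₀ _ (card_nbrs_ne_zero i), sub_self]

/-- Scaled values at the ends. -/
def MetricGraph.endVal (G : MetricGraph J K M) (α : Fin M → ℝ) (f : Edge K M → ℝ → ℂ)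
    (i : End K M) : ℂ :=
  (Real.exp (scale α (edgeOf i) / 2) : ℂ) * f (edgeOf i) (G.pos i)

/-- Scaled outward derivatives at the ends. -/
def MetricGraph.endFlux (G : MetricGraph J K M) (α : Fin M → ℝ) (f' : Edge K M → ℝ → ℂ)
    (i : End K M) : ℂ :=
  outSign i * (Real.exp (3 * scale α (edgeOf i) / 2) : ℂ) * f' (edgeOf i) (G.pos i)

lemma sum_endFlux (α : Fin M → ℝ) (f' : Edge K M → ℝ → ℂ) (v : Fin J) :
    ∑ i, (if G.vtx i = v then G.endFlux α f' i else 0) =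
    (∑ k, if G.base k = v then -f' (Sum.inl k) 0 else 0) +
    (∑ m, ((if G.src m = v then
              (Real.exp (3 * α m / 2) : ℂ) * (-f' (Sum.inr m) 0) else 0) +
           (if G.tgt m = v then
              (Real.exp (3 * α m / 2) : ℂ) * f' (Sum.inr m) (G.len m) else 0))) := by
  simp [MetricGraph.endFlux, edgeOf, scale, MetricGraph.pos,
    MetricGraph.vtx, outSign, Finset.sum_add_distrib, add_assoc]
  rfl

lemma vertexCond_iff_exists (α : Fin M → ℝ) (f f' : Edge K M → ℝ → ℂ) :
    VertexCond G α f f' ↔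
      (∃ c : Fin J → ℂ, ∀ i, G.endVal α f i = c (G.vtx i)) ∧
      ∀ v, ∑ i, (if G.vtx i = v then G.endFlux α f' i else 0) = 0 := by
  constructor
  · rintro ⟨⟨c, h1, h2, h3⟩, h4⟩
    refine ⟨⟨c, ?_⟩, fun v => (sum_endFlux α f' v).trans (h4 v)⟩
    rintro ((k | m) | m) <;> simp [MetricGraph.endVal, edgeOf, scale, MetricGraph.pos,
        MetricGraph.vtx, ← h1, ← h2, ← h3]
  · rintro ⟨⟨c, h⟩, h4⟩
    refine ⟨⟨c, fun k => ?_, fun m => ?_, fun m => ?_⟩, fun v => ?_⟩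
    · simpa [MetricGraph.endVal, edgeOf, scale, MetricGraph.pos,
        MetricGraph.vtx] using h (Sum.inl (Sum.inl k))
    · simpa [MetricGraph.endVal, edgeOf, scale, MetricGraph.pos,
        MetricGraph.vtx] using h (Sum.inl (Sum.inr m))
    · simpa [MetricGraph.endVal, edgeOf, scale, MetricGraph.pos,
        MetricGraph.vtx] using h (Sum.inr m)
    · rw [← sum_endFlux, h4 v]

lemma vertexCond_iff (α : Fin M → ℝ) (f f' : Edge K M → ℝ → ℂ) :
    VertexCond G α f f' ↔ G.vform (G.endVal α f) (G.endFlux α f') = 0 := by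
  rw [vform_eq_zero_iff, vertexCond_iff_exists]

lemma vform_add_smul (v₁ v₂ w₁ w₂ : End K M → ℂ) (c : ℂ) :
    G.vform (fun i => v₁ i + c * v₂ i) (fun i => w₁ i + c * w₂ i) =
      fun i => G.vform v₁ w₁ i + c * G.vform v₂ w₂ i := by
  ext i
  simp only [MetricGraph.vform, Finset.sum_add_distrib, ← Finset.mul_sum]
  ring

lemma VertexCond.add_smul {α : Fin M → ℝ} {f f' g g' : Edge K M → ℝ → ℂ}
    (h : VertexCond G α f f') (k : VertexCond G α g g') (c : ℂ) :
    VertexCond G α (fun e x => f e x + c * g e x) (fun e x => f' e x + c * g' e x) := by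
  rw [vertexCond_iff] at *
  have e1 : G.endVal α (fun e x => f e x + c * g e x) =
      fun i => G.endVal α f i + c * G.endVal α g i := by
    ext i; simp only [MetricGraph.endVal]; ring
  have e2 : G.endFlux α (fun e x => f' e x + c * g' e x) =
      fun i => G.endFlux α f' i + c * G.endFlux α g' i := by
    ext i; simp only [MetricGraph.endFlux]; ring
  rw [e1, e2, vform_add_smul, h, k]
  ext i; simp

/-! ### The energy identity -/

lemma integrable_mul_conj {μ : Measure ℝ} {f g : ℝ → ℂ} (hf : MemLp f 2 μ) (hg : MemLp g 2 μ) :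
    Integrable (fun x => f x * conj (g x)) μ :=
  hf.integrable_mul hg.star

lemma prim_mul_conj {b : ℝ} (hb : 0 ≤ b) {f f' f'' : ℝ → ℂ} (hf : PrimOn (Icc 0 b) f f')
    (hf' : PrimOn (Icc 0 b) f' f'') (h2 : IntervalIntegrable f'' volume 0 b) :
    f' b * conj (f b) = f' 0 * conj (f 0) +
      ∫ y in (0 : ℝ)..b, (f'' y * conj (f y) + f' y * conj (f' y)) := by
  have h1 : IntervalIntegrable f' volume 0 b := by
    refine ContinuousOn.intervalIntegrable ?_
    rw [uIcc_of_le hb]; exact hf'.continuousOn h2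
  exact hf'.mul hb hf.conj h2 (IntervalIntegrable.conj h1)

/-- The integrand is the derivative of `f' * conj f`, so only boundary terms remain. At infinity on
a lead there is none: `f' * conj f` has a limit because its derivative is integrable, and it is
itself integrable, so the limit is zero. -/
lemma IsH2loc.edge_energy {f f' f'' : Edge K M → ℝ → ℂ} (h : IsH2loc G f f' f'')
    (e : Edge K M) (h0 : MemLp (f e) 2 (volume.restrict (G.ival e)))
    (h1 : MemLp (f' e) 2 (volume.restrict (G.ival e)))
    (h2 : MemLp (f'' e) 2 (volume.restrict (G.ival e))) :
    ∫ x in G.ival e, (f'' e x * conj (f e x) + f' e x * conj (f' e x)) =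
      ∑ i, if edgeOf i = e then outSign i * f' e (G.pos i) * conj (f e (G.pos i)) else 0 := by
  have key : ∀ b ∈ G.ival e, f' e b * conj (f e b) = f' e 0 * conj (f e 0) +
      ∫ y in (0 : ℝ)..b, (f'' e y * conj (f e y) + f' e y * conj (f' e y)) := fun b hb =>
    prim_mul_conj (nonneg_of_mem_ival G hb)
      (fun x hx => h.integral_deriv e x (Icc_subset_ival G hb hx))
      (fun x hx => h.integral_deriv2 e x (Icc_subset_ival G hb hx)) (h.intervalIntegrable_deriv2 hb)
  have hint : Integrable (fun x => f'' e x * conj (f e x) + f' e x * conj (f' e x))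
      (volume.restrict (G.ival e)) := (integrable_mul_conj h2 h0).add (integrable_mul_conj h1 h1)
  cases e with
  | inl k =>
    have hsum : (∑ i : End K M, if edgeOf i = Sum.inl k then
        outSign i * f' (Sum.inl k) (G.pos i) * conj (f (Sum.inl k) (G.pos i)) else 0) =
        - (f' (Sum.inl k) 0 * conj (f (Sum.inl k) 0)) := by
      simp [edgeOf, outSign, MetricGraph.pos]
    rw [hsum]
    change ∫ x in Ici 0, _ = _
    rw [integral_Ici_eq_integral_Ioi]
    have hint' : IntegrableOn (fun x => f'' (Sum.inl k) x * conj (f (Sum.inl k) x) +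
        f' (Sum.inl k) x * conj (f' (Sum.inl k) x)) (Ioi 0) :=
      IntegrableOn.mono_set (t := Ici 0) hint Ioi_subset_Ici_self
    have ht := intervalIntegral_tendsto_integral_Ioi 0 hint' tendsto_id
    have ht' : Tendsto (fun b => f' (Sum.inl k) b * conj (f (Sum.inl k) b)) atTop
        (𝓝 (f' (Sum.inl k) 0 * conj (f (Sum.inl k) 0) +
          ∫ x in Ioi 0, (f'' (Sum.inl k) x * conj (f (Sum.inl k) x) +
        f' (Sum.inl k) x * conj (f' (Sum.inl k) x)))) := by
      refine (tendsto_const_nhds.add ht).congr' ?_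
      filter_upwards [eventually_ge_atTop 0] with b hb
      exact (key b hb).symm
    have hi : IntegrableOn (fun b => f' (Sum.inl k) b * conj (f (Sum.inl k) b)) (Ioi 0) :=
      IntegrableOn.mono_set (t := Ici 0) (integrable_mul_conj h1 h0) Ioi_subset_Ici_self
    have hz := IntegrableAtFilter.eq_zero_of_tendsto (l := atTop)
      (f := fun b => f' (Sum.inl k) b * conj (f (Sum.inl k) b)) (μ := volume)
      ⟨Ioi 0, Ioi_mem_atTop 0, hi⟩ (by
        intro s hs
        rcases mem_atTop_sets.1 hs with ⟨b, hb⟩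
        rw [← top_le_iff, ← Real.volume_Ici (a := b)]
        exact measure_mono hb) ht'
    linear_combination hz
  | inr m =>
    have hsum : (∑ i : End K M, if edgeOf i = Sum.inr m then
        outSign i * f' (Sum.inr m) (G.pos i) * conj (f (Sum.inr m) (G.pos i)) else 0) =
        - (f' (Sum.inr m) 0 * conj (f (Sum.inr m) 0)) +
          f' (Sum.inr m) (G.len m) * conj (f (Sum.inr m) (G.len m)) := by
      simp [edgeOf, outSign, MetricGraph.pos]
    have hm := (G.len_pos m).le
    rw [hsum, key (G.len m) ⟨hm, le_rfl⟩]
    change ∫ x in Icc 0 (G.len m), _ = _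
    rw [integral_Icc_eq_integral_Ioc, intervalIntegral.integral_of_le hm]
    ring

/-- The exponents `3/2` of the fluxes and `1/2` of the values add up to the weight `2` of the
operator. The boundary terms are therefore products of a scaled flux and a conjugate scaled value;
grouped by vertices, the value is a common factor and the fluxes sum to zero. -/
lemma sum_boundary_eq_zero {α : Fin M → ℝ} {f f' : Edge K M → ℝ → ℂ} (h : VertexCond G α f f') :
    ∑ e, ((Real.exp (2 * scale α e) : ℝ) : ℂ) *
      (∑ i, if edgeOf i = e then outSign i * f' e (G.pos i) * conj (f e (G.pos i)) else 0) = 0 := by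
  obtain ⟨⟨c, hc⟩, hv⟩ := (vertexCond_iff_exists α f f').1 h
  have h1 : ∑ e, ((Real.exp (2 * scale α e) : ℝ) : ℂ) *
      (∑ i, if edgeOf i = e then outSign i * f' e (G.pos i) * conj (f e (G.pos i)) else 0) =
      ∑ i, G.endFlux α f' i * conj (G.endVal α f i) := by
    simp_rw [Finset.mul_sum]
    rw [Finset.sum_comm]
    refine Finset.sum_congr rfl fun i _ => ?_
    simp_rw [mul_ite, mul_zero]
    rw [Finset.sum_ite_eq Finset.univ (edgeOf i), if_pos (Finset.mem_univ _)]
    simp only [MetricGraph.endFlux, MetricGraph.endVal, map_mul, Complex.conj_ofReal]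
    have : Real.exp (2 * scale α (edgeOf i)) =
        Real.exp (3 * scale α (edgeOf i) / 2) * Real.exp (scale α (edgeOf i) / 2) := by
      rw [← Real.exp_add]; ring_nf
    rw [this]; push_cast; ring
  rw [h1]
  have h2 : ∑ i, G.endFlux α f' i * conj (G.endVal α f i) =
      ∑ v, (∑ i, if G.vtx i = v then G.endFlux α f' i else 0) * conj (c v) := by
    simp_rw [Finset.sum_mul]
    rw [Finset.sum_comm]
    refine Finset.sum_congr rfl fun i _ => ?_
    simp_rw [ite_mul, zero_mul]
    rw [Finset.sum_ite_eq Finset.univ (G.vtx i), if_pos (Finset.mem_univ _), hc i]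
  rw [h2]
  simp [hv]

/-- `u` is in the domain of `P`, with derivative `p`, and `P u = w`. -/
def OpRel3 (G : MetricGraph J K M) (α : Fin M → ℝ) (u p w : G.L2) : Prop :=
  ∃ f f' f'' : Edge K M → ℝ → ℂ, IsH2loc G f f' f'' ∧ VertexCond G α f f' ∧
    (∀ e, u e =ᵐ[volume.restrict (G.ival e)] f e) ∧
    (∀ e, p e =ᵐ[volume.restrict (G.ival e)] f' e) ∧
    (∀ e, w e =ᵐ[volume.restrict (G.ival e)]
      fun x => -(Real.exp (2 * scale α e) : ℂ) * f'' e x)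

lemma opRel_iff {α : Fin M → ℝ} {u w : G.L2} : OpRel G α u w ↔ ∃ p, OpRel3 G α u p w := by
  constructor
  · rintro ⟨f, f', f'', h, hv, hp, hu, hw⟩
    exact ⟨WithLp.toLp 2 fun e => (hp e).toLp (f' e), f, f', f'', h, hv, hu,
      fun e => (hp e).coeFn_toLp, hw⟩
  · rintro ⟨p, f, f', f'', h, hv, hu, hp, hw⟩
    exact ⟨f, f', f'', h, hv, fun e => (memLp_congr_ae (hp e)).1 (Lp.memLp (p e)), hu, hw⟩

lemma L2.coeFn_add_smul (u v : G.L2) (c : ℂ) (e : Edge K M) :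
    (u + c • v) e =ᵐ[volume.restrict (G.ival e)] fun x => u e x + c * v e x := by
  change ⇑(u e + c • v e) =ᵐ[_] _
  filter_upwards [Lp.coeFn_add (u e) (c • v e), Lp.coeFn_smul c (v e)] with x h1 h2
  rw [h1, Pi.add_apply, h2]; rfl

lemma OpRel3.add_smul {α : Fin M → ℝ} {u p w u₂ p₂ w₂ : G.L2} (h : OpRel3 G α u p w)
    (k : OpRel3 G α u₂ p₂ w₂) (c : ℂ) : OpRel3 G α (u + c • u₂) (p + c • p₂) (w + c • w₂) := by
  obtain ⟨f, f', f'', h1, h2, h3, h4, h5⟩ := h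
  obtain ⟨g, g', g'', k1, k2, k3, k4, k5⟩ := k
  refine ⟨_, _, _, h1.add_smul k1 c, h2.add_smul k2 c, fun e => ?_, fun e => ?_, fun e => ?_⟩
  · filter_upwards [L2.coeFn_add_smul u u₂ c e, h3 e, k3 e] with x a b d
    rw [a, b, d]
  · filter_upwards [L2.coeFn_add_smul p p₂ c e, h4 e, k4 e] with x a b d
    rw [a, b, d]
  · filter_upwards [L2.coeFn_add_smul w w₂ c e, h5 e, k5 e] with x a b d
    rw [a, b, d]; ring

lemma OpRel.add_smul {α : Fin M → ℝ} {u w u₂ w₂ : G.L2} (h : OpRel G α u w)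
    (k : OpRel G α u₂ w₂) (c : ℂ) : OpRel G α (u + c • u₂) (w + c • w₂) := by
  obtain ⟨p, h⟩ := opRel_iff.1 h
  obtain ⟨q, k⟩ := opRel_iff.1 k
  exact opRel_iff.2 ⟨_, h.add_smul k c⟩

/-- The quadratic form of `P`: `⟪u, P u⟫ = ∑ e^{2 α_m} ‖u_m'‖²`. -/
theorem OpRel3.inner_eq {α : Fin M → ℝ} {u p w : G.L2} (h : OpRel3 G α u p w) :
    inner ℂ u w = ((∑ e, Real.exp (2 * scale α e) * ‖p e‖ ^ 2 : ℝ) : ℂ) := by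
  obtain ⟨f, f', f'', h, hv, hu, hp, hw⟩ := h
  have m0 : ∀ e, MemLp (f e) 2 (volume.restrict (G.ival e)) := fun e =>
    (memLp_congr_ae (hu e)).1 (Lp.memLp (u e))
  have m1 : ∀ e, MemLp (f' e) 2 (volume.restrict (G.ival e)) := fun e =>
    (memLp_congr_ae (hp e)).1 (Lp.memLp (p e))
  have m2 : ∀ e, MemLp (f'' e) 2 (volume.restrict (G.ival e)) := fun e => by
    have := ((memLp_congr_ae (hw e)).1 (Lp.memLp (w e))).const_mul
      (-(Real.exp (2 * scale α e) : ℂ))⁻¹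
    refine (memLp_congr_ae (Eventually.of_forall fun x => ?_)).1 this
    have : (Real.exp (2 * scale α e) : ℂ) ≠ 0 := by exact_mod_cast (Real.exp_pos _).ne'
    field_simp
  have key : ∀ e, inner ℂ (u e) (w e) = (Real.exp (2 * scale α e) : ℂ) * ((‖p e‖ ^ 2 : ℝ) : ℂ) -
      (Real.exp (2 * scale α e) : ℂ) *
      (∑ i, if edgeOf i = e then outSign i * f' e (G.pos i) * conj (f e (G.pos i)) else 0) := by
    intro e
    have hp2 : ((‖p e‖ ^ 2 : ℝ) : ℂ) = ∫ x in G.ival e, f' e x * conj (f' e x) := by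
      have : ((‖p e‖ ^ 2 : ℝ) : ℂ) = inner ℂ (p e) (p e) := by
        rw [inner_self_eq_norm_sq_to_K]; norm_cast
      rw [this, L2.inner_def]
      refine integral_congr_ae ?_
      filter_upwards [hp e] with x hx
      rw [hx]; rfl
    have hu2 : inner ℂ (u e) (w e) = -(Real.exp (2 * scale α e) : ℂ) *
        ∫ x in G.ival e, f'' e x * conj (f e x) := by
      rw [L2.inner_def, ← integral_const_mul]
      refine integral_congr_ae ?_
      filter_upwards [hu e, hw e] with x hx hx'
      rw [hx, hx']
      change (-(Real.exp (2 * scale α e) : ℂ) * f'' e x) * conj (f e x) = _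
      ring
    rw [hu2, hp2, ← h.edge_energy e (m0 e) (m1 e) (m2 e),
      integral_add (integrable_mul_conj (m2 e) (m0 e)) (integrable_mul_conj (m1 e) (m1 e))]
    ring
  rw [PiLp.inner_apply, Finset.sum_congr rfl fun e _ => key e, Finset.sum_sub_distrib,
    sum_boundary_eq_zero hv, sub_zero]
  push_cast; rfl

/-! ### The resolvent estimate -/

/-- The number factors as `(√q - λ)(√q + λ)`, and the imaginary part of each factor is `∓ Im λ`. -/
lemma le_norm_sub_sq {lam : ℂ} (hlam : 0 < lam.im) {q : ℝ} (hq : 0 ≤ q) :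
    lam.im ^ 2 ≤ ‖(q : ℂ) - lam ^ 2‖ := by
  have e : (q : ℂ) - lam ^ 2 = ((Real.sqrt q : ℂ) - lam) * ((Real.sqrt q : ℂ) + lam) := by
    have : (Real.sqrt q : ℂ) ^ 2 = q := by exact_mod_cast Real.sq_sqrt hq
    rw [← this]; ring
  have h1 : lam.im ≤ ‖(Real.sqrt q : ℂ) - lam‖ := by
    refine le_trans ?_ (Complex.abs_im_le_norm _)
    simp [abs_of_pos hlam]
  have h2 : lam.im ≤ ‖(Real.sqrt q : ℂ) + lam‖ := by
    refine le_trans ?_ (Complex.abs_im_le_norm _)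
    simp [abs_of_pos hlam]
  rw [e, norm_mul, sq]
  exact mul_le_mul h1 h2 hlam.le (norm_nonneg _)

/-- Pairing the equation with `u` gives `⟪u, f⟫ = ‖u‖² (E / ‖u‖² - λ²)` with a nonnegative energy
`E`. The Rayleigh quotient plays the role of a spectral value, and Cauchy–Schwarz finishes without a
spectral theorem. -/
theorem OpRel3.norm_le {α : Fin M → ℝ} {lam : ℂ} (hlam : 0 < lam.im) {u p f : G.L2}
    (h : OpRel3 G α u p (f + lam ^ 2 • u)) : lam.im ^ 2 * ‖u‖ ≤ ‖f‖ := by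
  have h1 := h.inner_eq
  set E := ∑ e, Real.exp (2 * scale α e) * ‖p e‖ ^ 2
  have hE : 0 ≤ E := Finset.sum_nonneg fun e _ => by positivity
  rw [inner_add_right, inner_smul_right, inner_self_eq_norm_sq_to_K] at h1
  rcases eq_or_ne ‖u‖ 0 with h0 | h0
  · rw [h0, mul_zero]; exact norm_nonneg _
  have hpos : 0 < ‖u‖ := lt_of_le_of_ne (norm_nonneg _) h0.symm
  have h2 : inner ℂ u f = ((‖u‖ ^ 2 : ℝ) : ℂ) * (((E / ‖u‖ ^ 2 : ℝ) : ℂ) - lam ^ 2) := by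
    have hc : (‖u‖ : ℂ) ≠ 0 := by exact_mod_cast h0
    rw [eq_sub_of_add_eq h1]
    push_cast
    field_simp
    rfl
  have h3 : ‖u‖ ^ 2 * lam.im ^ 2 ≤ ‖u‖ * ‖f‖ := by
    refine le_trans ?_ (norm_inner_le_norm (𝕜 := ℂ) u f)
    rw [h2, norm_mul, Complex.norm_real, Real.norm_of_nonneg (by positivity)]
    exact mul_le_mul_of_nonneg_left (le_norm_sub_sq hlam (by positivity)) (by positivity)
  refine le_of_mul_le_mul_left ?_ hpos
  linarith

lemma OpRel.eq_zero {α : Fin M → ℝ} {lam : ℂ} (hlam : 0 < lam.im) {u : G.L2}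
    (h : OpRel G α u (lam ^ 2 • u)) : u = 0 := by
  obtain ⟨p, h⟩ := opRel_iff.1 h
  rw [← zero_add (lam ^ 2 • u)] at h
  have := h.norm_le hlam
  rw [norm_zero] at this
  have h2 : 0 < lam.im ^ 2 := by positivity
  exact norm_le_zero_iff.1 (by nlinarith [norm_nonneg u])

lemma OpRel.unique {α : Fin M → ℝ} {lam : ℂ} (hlam : 0 < lam.im) {u v f : G.L2}
    (h : OpRel G α u (f + lam ^ 2 • u)) (k : OpRel G α v (f + lam ^ 2 • v)) : u = v := by
  have := h.add_smul k (-1)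
  rw [show f + lam ^ 2 • u + (-1 : ℂ) • (f + lam ^ 2 • v) = lam ^ 2 • (u + (-1 : ℂ) • v) by module]
    at this
  have h0 := this.eq_zero hlam
  rwa [neg_one_smul, ← sub_eq_add_neg, sub_eq_zero] at h0

/-- The form identity bounds the weighted energy by `‖u‖ ‖P u‖`; the sum `A` of the inverse weights
removes the weights. The bound is needed because `OpRel3.of_tendsto` asks for convergence of `u'`
along with `u` and `P u`. -/
theorem OpRel3.norm_deriv_le (α : Fin M → ℝ) (lam : ℂ) (hlam : 0 < lam.im) :
    ∃ C : ℝ, ∀ u p f : G.L2, OpRel3 G α u p (f + lam ^ 2 • u) → ‖p‖ ≤ C * ‖f‖ := by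
  set A := ∑ e : Edge K M, Real.exp (-(2 * scale α e))
  set c := lam.im ^ 2
  have hc : 0 < c := by positivity
  have hA : 0 ≤ A := Finset.sum_nonneg fun e _ => by positivity
  set D := A * (c⁻¹ * (1 + ‖lam ^ 2‖ * c⁻¹))
  have hD : 0 ≤ D := by positivity
  refine ⟨Real.sqrt D, fun u p f h => ?_⟩
  have hu : ‖u‖ ≤ c⁻¹ * ‖f‖ := by
    rw [inv_mul_eq_div, le_div_iff₀ hc, mul_comm]; exact h.norm_le hlam
  have hw : ‖f + lam ^ 2 • u‖ ≤ (1 + ‖lam ^ 2‖ * c⁻¹) * ‖f‖ := by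
    refine (norm_add_le _ _).trans ?_
    rw [norm_smul]
    have := mul_le_mul_of_nonneg_left hu (norm_nonneg (lam ^ 2))
    linarith
  have h1 : ∑ e, Real.exp (2 * scale α e) * ‖p e‖ ^ 2 ≤ ‖u‖ * ‖f + lam ^ 2 • u‖ := by
    have := norm_inner_le_norm (𝕜 := ℂ) u (f + lam ^ 2 • u)
    rw [h.inner_eq, Complex.norm_real] at this
    exact (le_abs_self _).trans this
  have h2 : ‖p‖ ^ 2 ≤ A * ∑ e, Real.exp (2 * scale α e) * ‖p e‖ ^ 2 := by
    rw [PiLp.norm_sq_eq_of_L2, Finset.mul_sum]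
    refine Finset.sum_le_sum fun e _ => ?_
    rw [← mul_assoc]
    refine le_mul_of_one_le_left (by positivity) ?_
    have : Real.exp (-(2 * scale α e)) ≤ A :=
      Finset.single_le_sum (f := fun e : Edge K M => Real.exp (-(2 * scale α e)))
        (fun e _ => (Real.exp_pos _).le) (Finset.mem_univ e)
    calc (1 : ℝ) = Real.exp (-(2 * scale α e)) * Real.exp (2 * scale α e) := by
          rw [← Real.exp_add, neg_add_cancel, Real.exp_zero]
      _ ≤ _ := mul_le_mul_of_nonneg_right this (Real.exp_pos _).le
  have h3 : ‖p‖ ^ 2 ≤ D * ‖f‖ ^ 2 := by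
    refine h2.trans ((mul_le_mul_of_nonneg_left (h1.trans
      (mul_le_mul hu hw (norm_nonneg _) (by positivity))) hA).trans (le_of_eq ?_))
    simp only [D]; ring
  rw [← Real.sqrt_sq (norm_nonneg f), ← Real.sqrt_mul hD]
  exact Real.le_sqrt_of_sq_le h3

/-! ### Closedness of `P` and existence of the resolvent -/

lemma volume_ival_ne_zero (e : Edge K M) : volume.restrict (G.ival e) ≠ 0 := by
  rw [Ne, Measure.restrict_eq_zero]
  cases e with
  | inl k => simp [MetricGraph.ival]
  | inr m => simpa [MetricGraph.ival] using G.len_pos m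

lemma restrict_ival_Ioc {e : Edge K M} {x : ℝ} (hx : x ∈ G.ival e) :
    (volume.restrict (G.ival e)).restrict (Ioc 0 x) = volume.restrict (Ioc 0 x) := by
  rw [Measure.restrict_restrict measurableSet_Ioc,
    inter_eq_left.2 (Ioc_subset_Icc_self.trans (Icc_subset_ival G hx))]

/-- Integration over `(0, x]` is the inner product with an indicator function, hence continuous on
`L²`. -/
lemma tendsto_integral_of_tendsto_Lp {e : Edge K M} {h : ℕ → ℝ → ℂ} {k : ℝ → ℂ}
    {H : ℕ → Lp ℂ 2 (volume.restrict (G.ival e))} {L : Lp ℂ 2 (volume.restrict (G.ival e))}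
    (hH : ∀ n, H n =ᵐ[volume.restrict (G.ival e)] h n)
    (hL : L =ᵐ[volume.restrict (G.ival e)] k) (ht : Tendsto H atTop (𝓝 L))
    {x : ℝ} (hx : x ∈ G.ival e) :
    Tendsto (fun n => ∫ y in (0 : ℝ)..x, h n y) atTop (𝓝 (∫ y in (0 : ℝ)..x, k y)) := by
  have hfin : (volume.restrict (G.ival e)) (Ioc 0 x) ≠ ⊤ :=
    ((Measure.restrict_apply_le _ _).trans_lt measure_Ioc_lt_top).ne
  have key : ∀ (F : Lp ℂ 2 (volume.restrict (G.ival e))) (g : ℝ → ℂ),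
      F =ᵐ[volume.restrict (G.ival e)] g → ∫ y in (0 : ℝ)..x, g y =
        inner ℂ (indicatorConstLp 2 measurableSet_Ioc hfin (1 : ℂ)) F := by
    intro F g hg
    rw [L2.inner_indicatorConstLp_one, intervalIntegral.integral_of_le (nonneg_of_mem_ival G hx),
      ← restrict_ival_Ioc hx]
    exact integral_congr_ae (ae_restrict_of_ae hg.symm)
  rw [key L k hL]
  simp_rw [fun n => key (H n) (h n) (hH n)]
  exact tendsto_const_nhds.inner ht

/-- Only the initial values `h n 0 = h n x - ∫ h'` are in doubt. Every subsequence has a further one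
along which `h n x` converges for almost every `x`, so the initial values converge along it. The
limit is always the same constant `c`, because `L x - ∫ k'` equals `c` almost everywhere. Hence the
whole sequence of initial values converges, and pointwise convergence holds on all of the edge,
including its ends. -/
lemma tendsto_of_primOn {e : Edge K M} {h h' : ℕ → ℝ → ℂ} {k' : ℝ → ℂ}
    {H H' : ℕ → Lp ℂ 2 (volume.restrict (G.ival e))}
    {L L' : Lp ℂ 2 (volume.restrict (G.ival e))}
    (hp : ∀ n, PrimOn (G.ival e) (h n) (h' n))
    (hH : ∀ n, H n =ᵐ[volume.restrict (G.ival e)] h n)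
    (hH' : ∀ n, H' n =ᵐ[volume.restrict (G.ival e)] h' n)
    (hL' : L' =ᵐ[volume.restrict (G.ival e)] k')
    (ht : Tendsto H atTop (𝓝 L)) (ht' : Tendsto H' atTop (𝓝 L')) :
    ∃ k : ℝ → ℂ, PrimOn (G.ival e) k k' ∧ L =ᵐ[volume.restrict (G.ival e)] k ∧
      ∀ x ∈ G.ival e, Tendsto (fun n => h n x) atTop (𝓝 (k x)) := by
  have hI : ∀ x ∈ G.ival e, Tendsto (fun n => ∫ y in (0 : ℝ)..x, h' n y) atTop
      (𝓝 (∫ y in (0 : ℝ)..x, k' y)) := fun x hx => tendsto_integral_of_tendsto_Lp hH' hL' ht' hx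
  have hsub : ∀ ns : ℕ → ℕ, Tendsto ns atTop atTop → ∃ ms : ℕ → ℕ,
      Tendsto (ms) atTop atTop ∧ ∀ᵐ x ∂(volume.restrict (G.ival e)),
        Tendsto (fun n => h (ns (ms n)) 0) atTop (𝓝 (L x - ∫ y in (0 : ℝ)..x, k' y)) := by
    intro ns hns
    obtain ⟨ms, hms, hms'⟩ := (tendstoInMeasure_of_tendsto_Lp (ht.comp hns)).exists_seq_tendsto_ae
    refine ⟨ms, hms.tendsto_atTop, ?_⟩
    filter_upwards [hms', ae_all_iff.2 hH, ae_restrict_mem (measurableSet_ival G e)]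
      with x hx hx2 hx3
    refine (hx.sub ((hI x hx3).comp (hns.comp hms.tendsto_atTop))).congr fun n => ?_
    simp only [Function.comp_apply]
    rw [hx2, hp _ x hx3, add_sub_cancel_right]
  have : NeBot (ae (volume.restrict (G.ival e))) := ae_neBot.2 (volume_ival_ne_zero e)
  obtain ⟨ms, hms, hms'⟩ := hsub id tendsto_id
  obtain ⟨x₀, hx₀⟩ := hms'.exists
  set c := L x₀ - ∫ y in (0 : ℝ)..x₀, k' y
  have hc : ∀ᵐ x ∂(volume.restrict (G.ival e)), L x - (∫ y in (0 : ℝ)..x, k' y) = c := by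
    filter_upwards [hms'] with x hx using tendsto_nhds_unique hx hx₀
  have h0 : Tendsto (fun n => h n 0) atTop (𝓝 c) := by
    refine tendsto_of_subseq_tendsto fun ns hns => ?_
    obtain ⟨ms, hms, hms'⟩ := hsub ns hns
    obtain ⟨x, hx, hx'⟩ := (hms'.and hc).exists
    exact ⟨ms, hx' ▸ hx⟩
  refine ⟨fun x => c + ∫ y in (0 : ℝ)..x, k' y, fun x _ => by simp, ?_, fun x hx => ?_⟩
  · filter_upwards [hc] with x hx
    rw [← hx]; ring
  · exact (h0.add (hI x hx)).congr fun n => (hp n x hx).symm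

lemma tendsto_apply {u : ℕ → G.L2} {v : G.L2} (h : Tendsto u atTop (𝓝 v)) (e : Edge K M) :
    Tendsto (fun n => u n e) atTop (𝓝 (v e)) :=
  ((PiLp.continuous_apply 2 _ e).tendsto v).comp h

lemma tendsto_vform {v w : ℕ → End K M → ℂ} {v₀ w₀ : End K M → ℂ}
    (hv : ∀ i, Tendsto (fun n => v n i) atTop (𝓝 (v₀ i)))
    (hw : ∀ i, Tendsto (fun n => w n i) atTop (𝓝 (w₀ i))) (i : End K M) :
    Tendsto (fun n => G.vform (v n) (w n) i) atTop (𝓝 (G.vform v₀ w₀ i)) :=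
  ((hv i).sub ((tendsto_finsetSum _ fun j _ => hv j).div_const _)).add
    (tendsto_finsetSum _ fun j _ => hw j)

lemma pos_mem_ival (i : End K M) : G.pos i ∈ G.ival (edgeOf i) := by
  rcases i with e | m
  · exact zero_mem_ival G e
  · exact mem_Icc.2 ⟨(G.len_pos m).le, le_rfl⟩

/-- This is the closedness of `P`. The limit of primitives is found twice, from second to first
derivatives and from first derivatives to functions. Values and derivatives converge at the ends, so
the vertex conditions survive. -/
theorem OpRel3.of_tendsto {α : Fin M → ℝ} {u p w : ℕ → G.L2} {u₀ p₀ w₀ : G.L2}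
    (h : ∀ n, OpRel3 G α (u n) (p n) (w n)) (hu : Tendsto u atTop (𝓝 u₀))
    (hp : Tendsto p atTop (𝓝 p₀)) (hw : Tendsto w atTop (𝓝 w₀)) : OpRel3 G α u₀ p₀ w₀ := by
  choose f f' f'' h1 h2 h3 h4 h5 using h
  have hne : ∀ e : Edge K M, (Real.exp (2 * scale α e) : ℂ) ≠ 0 := fun e => by
    exact_mod_cast (Real.exp_pos _).ne'
  set q : Edge K M → ℂ := fun e => (-(Real.exp (2 * scale α e) : ℂ))⁻¹
  have hq : ∀ e, Tendsto (fun n => q e • w n e) atTop (𝓝 (q e • w₀ e)) := fun e =>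
    (tendsto_apply hw e).const_smul (q e)
  have hq' : ∀ e n, (q e • w n e : Lp ℂ 2 _) =ᵐ[volume.restrict (G.ival e)] f'' n e := by
    intro e n
    filter_upwards [Lp.coeFn_smul (q e) (w n e), h5 n e] with x a b
    rw [a, Pi.smul_apply, b, smul_eq_mul, inv_mul_cancel_left₀ (neg_ne_zero.2 (hne e))]
  set k'' : Edge K M → ℝ → ℂ := fun e => (q e • w₀ e : Lp ℂ 2 (volume.restrict (G.ival e)))
  have step1 := fun e => tendsto_of_primOn (fun n x hx => (h1 n).integral_deriv2 e x hx)
    (fun n => h4 n e) (hq' e) (Filter.EventuallyEq.refl _ (k'' e)) (tendsto_apply hp e) (hq e)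
  choose k' hk1 hk2 hk3 using step1
  have step2 := fun e => tendsto_of_primOn (fun n x hx => (h1 n).integral_deriv e x hx)
    (fun n => h3 n e) (fun n => h4 n e) (hk2 e) (tendsto_apply hu e) (tendsto_apply hp e)
  choose k hl1 hl2 hl3 using step2
  refine ⟨k, k', k'', ⟨hl1, hk1, fun e R => memLp_ival_inter R (Lp.memLp _)⟩, ?_, hl2, hk2, ?_⟩
  · rw [vertexCond_iff]
    ext i
    have ht := tendsto_vform (G := G) (v := fun n => G.endVal α (f n))
      (w := fun n => G.endFlux α (f' n)) (v₀ := G.endVal α k) (w₀ := G.endFlux α k')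
      (fun i => (hl3 _ _ (pos_mem_ival i)).const_mul _)
      (fun i => (hk3 _ _ (pos_mem_ival i)).const_mul _) i
    refine tendsto_nhds_unique ht ?_
    simp [fun n => (vertexCond_iff α (f n) (f' n)).1 (h2 n)]
  · intro e
    filter_upwards [Lp.coeFn_smul (q e) (w₀ e)] with x a
    change _ = _ * (q e • w₀ e : Lp ℂ 2 (volume.restrict (G.ival e))) x
    rw [a, Pi.smul_apply, smul_eq_mul, mul_inv_cancel_left₀ (neg_ne_zero.2 (hne e))]

/-- Square integrable functions that vanish outside a bounded part of the graph. -/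
def Bounded (G : MetricGraph J K M) (f : G.L2) : Prop :=
  ∃ R : ℝ, ∀ e, ∀ᵐ x ∂(volume.restrict (G.ival e)), R < x → f e x = 0

lemma exists_bounded_seq (f : G.L2) :
    ∃ g : ℕ → G.L2, (∀ n, Bounded G (g n)) ∧ Tendsto g atTop (𝓝 f) := by
  have hm : ∀ (n : ℕ) (e : Edge K M), MemLp ((Iic (n : ℝ)).indicator (f e)) 2
      (volume.restrict (G.ival e)) := fun n e => (Lp.memLp (f e)).indicator measurableSet_Iic
  refine ⟨fun n => WithLp.toLp 2 fun e => (hm n e).toLp _, fun n => ⟨n, fun e => ?_⟩, ?_⟩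
  · filter_upwards [(hm n e).coeFn_toLp] with x hx hn
    exact hx.trans (indicator_of_notMem (by simpa using hn) _)
  · refine ((PiLp.continuous_toLp 2 _).tendsto (fun e => f e)).comp
      (tendsto_pi_nhds.2 fun e => ?_)
    refine (Lp.tendsto_Lp_iff_tendsto_eLpNorm' _ _).2 ?_
    have hl : Tendsto (fun n : ℕ => ∫⁻ x in G.ival e,
        ‖(Iic (n : ℝ)).indicator (f e) x - f e x‖ₑ ^ (2 : ℝ)) atTop (𝓝 (∫⁻ x in G.ival e, 0)) := by
      refine tendsto_lintegral_of_dominated_convergence' (fun x => ‖f e x‖ₑ ^ (2 : ℝ))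
        (fun n => ?_) (fun n => Eventually.of_forall fun x => ?_) ?_
        (Eventually.of_forall fun x => ?_)
      · exact (((hm n e).1.sub (Lp.aestronglyMeasurable _)).enorm).pow_const _
      · refine ENNReal.rpow_le_rpow ?_ (by norm_num)
        by_cases hx : x ∈ Iic (n : ℝ)
        · simp [hx]
        · simp [hx]
      · have := (Lp.memLp (f e)).eLpNorm_lt_top
        rw [eLpNorm_eq_lintegral_rpow_enorm_toReal (by norm_num) (by norm_num)] at this
        simp only [ENNReal.toReal_ofNat] at this
        exact (ENNReal.rpow_lt_top_iff_of_pos (by norm_num)).1 this |>.ne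
      · refine tendsto_const_nhds.congr' ?_
        filter_upwards [eventually_ge_atTop ⌈x⌉₊] with n hn
        have hx : x ∈ Iic (n : ℝ) := (Nat.le_ceil x).trans (by exact_mod_cast hn)
        simp [hx]
    have hn : ∀ n, eLpNorm (⇑((hm n e).toLp _) - ⇑(f e)) 2 (volume.restrict (G.ival e)) =
        (∫⁻ x in G.ival e, ‖(Iic (n : ℝ)).indicator (f e) x - f e x‖ₑ ^ (2 : ℝ)) ^ (1 / 2 : ℝ) := by
      intro n
      rw [eLpNorm_congr_ae ((hm n e).coeFn_toLp.sub (EventuallyEq.refl _ _)),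
        eLpNorm_eq_lintegral_rpow_enorm_toReal (by norm_num) (by norm_num)]
      simp
    simp_rw [hn]
    have := (ENNReal.continuous_rpow_const (y := (1 / 2 : ℝ))).tendsto _ |>.comp hl
    simpa [Function.comp_def] using this

/-- If `(P - lam²) u = f` is solvable for `f` with bounded support and `Im lam > 0`, then the
resolvent of `P` exists at `lam`. -/
theorem exists_isResolvent {α : Fin M → ℝ} {lam : ℂ} (hlam : 0 < lam.im)
    (hsolv : ∀ f : G.L2, Bounded G f → ∃ u, OpRel G α u (f + lam ^ 2 • u)) :
    ∃ T : G.L2 →L[ℂ] G.L2, IsResolvent G α lam T := by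
  obtain ⟨C, hC⟩ := OpRel3.norm_deriv_le (G := G) α lam hlam
  have hc : 0 < lam.im ^ 2 := by positivity
  have hbd : ∀ u p f : G.L2, OpRel3 G α u p (f + lam ^ 2 • u) →
      ‖u‖ ≤ (lam.im ^ 2)⁻¹ * ‖f‖ := fun u p f h => by
    rw [inv_mul_eq_div, le_div_iff₀ hc, mul_comm]; exact h.norm_le hlam
  -- Sources with bounded support suffice: the estimates for `u` and `u'` are uniform in the source,
  -- so the solutions for truncations of `f` form Cauchy sequences, and `P` is closed.
  have hall : ∀ f : G.L2, ∃ u, OpRel G α u (f + lam ^ 2 • u) := by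
    intro f
    obtain ⟨g, hg, hgt⟩ := exists_bounded_seq f
    choose u hu using fun n => hsolv (g n) (hg n)
    choose p hp using fun n => opRel_iff.1 (hu n)
    have hdiff : ∀ n m, OpRel3 G α (u n - u m) (p n - p m)
        ((g n - g m) + lam ^ 2 • (u n - u m)) := by
      intro n m
      have := (hp n).add_smul (hp m) (-1)
      convert this using 1 <;> module
    have hcau : CauchySeq g := hgt.cauchySeq
    have cau : ∀ (C : ℝ) (v : ℕ → G.L2), (∀ n m, ‖v n - v m‖ ≤ C * ‖g n - g m‖) →
        CauchySeq v := by
      intro C v hv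
      rw [Metric.cauchySeq_iff] at hcau ⊢
      intro ε hε
      obtain ⟨N, hN⟩ := hcau (ε / (|C| + 1)) (by positivity)
      refine ⟨N, fun m hm n hn => ?_⟩
      have h1 := hN m hm n hn
      rw [dist_eq_norm, lt_div_iff₀ (by positivity)] at h1
      rw [dist_eq_norm]
      have h2 : C * ‖g m - g n‖ ≤ |C| * ‖g m - g n‖ :=
        mul_le_mul_of_nonneg_right (le_abs_self C) (norm_nonneg _)
      have := hv m n
      nlinarith [norm_nonneg (g m - g n)]
    obtain ⟨u₀, hu₀⟩ := cauchySeq_tendsto_of_complete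
      (cau _ u fun n m => hbd _ _ _ (hdiff n m))
    obtain ⟨p₀, hp₀⟩ := cauchySeq_tendsto_of_complete (cau _ p fun n m => hC _ _ _ (hdiff n m))
    exact ⟨u₀, opRel_iff.2 ⟨p₀, OpRel3.of_tendsto hp hu₀ hp₀ (hgt.add (hu₀.const_smul _))⟩⟩
  choose S hS using hall
  have hadd : ∀ (f g : G.L2) (c : ℂ), S (f + c • g) = S f + c • S g := by
    intro f g c
    refine OpRel.unique hlam (hS (f + c • g)) ?_
    have := (hS f).add_smul (hS g) c
    convert this using 1; module
  refine ⟨LinearMap.mkContinuous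
    { toFun := S
      map_add' := fun f g => by simpa using hadd f g 1
      map_smul' := fun c f => by
        have h0 : S 0 = 0 := by simpa using hadd 0 0 1
        simpa [h0] using hadd 0 f c } (lam.im ^ 2)⁻¹ fun f => ?_, hS, fun u w h => ?_⟩
  · obtain ⟨p, hp⟩ := opRel_iff.1 (hS f)
    exact hbd _ _ _ hp
  · refine OpRel.unique hlam (hS _) ?_
    rwa [sub_add_cancel]

/-! ### Solutions of `-u'' = κ² u + m g` on a half-line -/

/-- The entire function `κ ↦ sin (κ x) / κ`. -/
def snc (κ : ℂ) (x : ℝ) : ℂ := ∫ y in (0 : ℝ)..x, Complex.cos (κ * y)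

lemma hasDerivAt_snc (κ : ℂ) (x : ℝ) : HasDerivAt (snc κ) (Complex.cos (κ * x)) x :=
  intervalIntegral.integral_hasDerivAt_right (by
    apply Continuous.intervalIntegrable; fun_prop) (by
    apply Continuous.stronglyMeasurableAtFilter; fun_prop) (by fun_prop)

@[simp] lemma snc_zero (κ : ℂ) : snc κ 0 = 0 := by simp [snc]

lemma mul_snc (κ : ℂ) (x : ℝ) : κ * snc κ x = Complex.sin (κ * x) := by
  rw [snc, ← intervalIntegral.integral_const_mul]
  have h : ∀ y ∈ uIcc 0 x, HasDerivAt (fun y : ℝ => Complex.sin (κ * y))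
      (κ * Complex.cos (κ * y)) y := by
    intro y _
    have h1 : HasDerivAt (fun z : ℂ => κ * z) κ y := by
      simpa using (hasDerivAt_id (y : ℂ)).const_mul κ
    convert h1.csin.comp_ofReal using 1
    ring
  rw [intervalIntegral.integral_eq_sub_of_hasDerivAt h]
  · simp
  · apply Continuous.intervalIntegrable; fun_prop

lemma hasDerivAt_cos_mul (κ : ℂ) (x : ℝ) :
    HasDerivAt (fun y : ℝ => Complex.cos (κ * y)) (-κ ^ 2 * snc κ x) x := by
  have h1 : HasDerivAt (fun z : ℂ => κ * z) κ x := by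
    simpa using (hasDerivAt_id (x : ℂ)).const_mul κ
  convert h1.ccos.comp_ofReal using 1
  rw [← mul_snc]; ring

/-- This is the Wronskian of the two fundamental solutions. It being `1`, also at `κ = 0`, is what
makes variation of constants work and lets coefficients be recovered from a value and a derivative.
-/
lemma cos_sq_add_snc_sq (κ : ℂ) (x : ℝ) :
    Complex.cos (κ * x) ^ 2 + κ ^ 2 * snc κ x ^ 2 = 1 := by
  rw [← mul_pow, mul_snc, add_comm, Complex.sin_sq_add_cos_sq]

lemma exp_eq_cos_add_snc (κ : ℂ) (x : ℝ) :
    Complex.exp (Complex.I * κ * x) = Complex.cos (κ * x) + Complex.I * κ * snc κ x := by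
  rw [mul_assoc Complex.I κ (snc κ x), mul_snc,
    show Complex.I * κ * x = κ * x * Complex.I by ring, Complex.exp_mul_I]
  ring

@[fun_prop]
lemma continuous_snc (κ : ℂ) : Continuous (snc κ) :=
  continuous_iff_continuousAt.2 fun x => (hasDerivAt_snc κ x).continuousAt

lemma primOn_of_hasDerivAt {s : Set ℝ} {f f' : ℝ → ℂ} (h : ∀ x, HasDerivAt f (f' x) x)
    (hf : Continuous f') : PrimOn s f f' := by
  intro x _
  rw [intervalIntegral.integral_eq_sub_of_hasDerivAt (fun y _ => h y)
    (hf.intervalIntegrable _ _)]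
  ring

/-- The integral of `φ g` from `x` to `R`. -/
def tail (φ g : ℝ → ℂ) (R x : ℝ) : ℂ := ∫ y in x..R, φ y * g y

/-- Solution of `f'' = -κ² f - m g` which is equal to `p cos (κ x) + q sin (κ x) / κ` for `x ≥ R`,
if `g` vanishes there. -/
def sol (κ m p q : ℂ) (g : ℝ → ℂ) (R x : ℝ) : ℂ :=
  p * Complex.cos (κ * x) + q * snc κ x - m * (Complex.cos (κ * x) * tail (snc κ) g R x -
    snc κ x * tail (fun y => Complex.cos (κ * y)) g R x)

/-- The derivative of `sol`. -/
def solDeriv (κ m p q : ℂ) (g : ℝ → ℂ) (R x : ℝ) : ℂ :=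
  p * (-κ ^ 2 * snc κ x) + q * Complex.cos (κ * x) - m * (-κ ^ 2 * snc κ x * tail (snc κ) g R x -
    Complex.cos (κ * x) * tail (fun y => Complex.cos (κ * y)) g R x)

lemma primOn_tail {φ g : ℝ → ℂ} (hφ : Continuous φ) (hg : Integrable g) (R : ℝ) (s : Set ℝ) :
    PrimOn s (tail φ g R) (fun x => -(φ x * g x)) := by
  have hi : ∀ a b, IntervalIntegrable (fun y => φ y * g y) volume a b := fun a b =>
    hg.intervalIntegrable.continuousOn_mul hφ.continuousOn
  intro x _
  rw [intervalIntegral.integral_neg, tail, tail,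
    ← intervalIntegral.integral_add_adjacent_intervals (hi 0 x) (hi x R)]
  ring

lemma PrimOn.mul_tail {b : ℝ} (hb : 0 ≤ b) {f f' φ g : ℝ → ℂ} (hf : ∀ x, HasDerivAt f (f' x) x)
    (hf' : Continuous f') (hφ : Continuous φ) (hg : Integrable g) (R : ℝ) :
    f b * tail φ g R b = f 0 * tail φ g R 0 +
      ∫ y in (0 : ℝ)..b, (f' y * tail φ g R y - f y * φ y * g y) := by
  have hi : IntervalIntegrable (fun x => -(φ x * g x)) volume 0 b :=
    (hg.intervalIntegrable.continuousOn_mul hφ.continuousOn).neg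
  rw [(primOn_of_hasDerivAt (s := Icc 0 b) hf hf').mul hb (primOn_tail hφ hg R _)
    (hf'.intervalIntegrable _ _) hi]
  congr 2; ext y; ring

lemma continuousOn_tail {φ g : ℝ → ℂ} (hφ : Continuous φ) (hg : Integrable g) (R b : ℝ) :
    ContinuousOn (tail φ g R) (Icc 0 b) :=
  (primOn_tail hφ hg R _).continuousOn (hg.intervalIntegrable.continuousOn_mul hφ.continuousOn).neg

lemma continuous_cos_mul (κ : ℂ) : Continuous fun y : ℝ => Complex.cos (κ * y) := by fun_prop

/-- The terms produced by differentiating the two tails are `cos * snc * g` twice, with opposite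
signs. They cancel, so `solDeriv` contains no derivative of a tail and `g` needs no continuity. -/
lemma primOn_sol (κ m p q : ℂ) {g : ℝ → ℂ} (hg : Integrable g) (R : ℝ) :
    PrimOn (Ici 0) (sol κ m p q g R) (solDeriv κ m p q g R) := by
  intro b (hb : 0 ≤ b)
  have hS := continuousOn_tail (continuous_snc κ) hg R b
  have hC := continuousOn_tail (continuous_cos_mul κ) hg R b
  rw [← uIcc_of_le hb] at hS hC
  have e1 := PrimOn.mul_tail hb (hasDerivAt_cos_mul κ) (by fun_prop) (continuous_snc κ) hg R
  have e2 := PrimOn.mul_tail hb (hasDerivAt_snc κ) (by fun_prop) (continuous_cos_mul κ) hg R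
  have e3 := primOn_of_hasDerivAt (s := univ) (hasDerivAt_cos_mul κ) (by fun_prop) b trivial
  have e4 := primOn_of_hasDerivAt (s := univ) (hasDerivAt_snc κ) (by fun_prop) b trivial
  have i0 : IntervalIntegrable (fun y => Complex.cos (κ * y) * snc κ y * g y) volume 0 b :=
    hg.intervalIntegrable.continuousOn_mul (by fun_prop)
  have i0' : IntervalIntegrable (fun y => snc κ y * Complex.cos (κ * y) * g y) volume 0 b :=
    hg.intervalIntegrable.continuousOn_mul (by fun_prop)
  have i1 : IntervalIntegrable (fun y => -κ ^ 2 * snc κ y * tail (snc κ) g R y) volume 0 b :=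
    ContinuousOn.intervalIntegrable (by fun_prop)
  have i2 : IntervalIntegrable (fun y : ℝ => Complex.cos (κ * y) *
      tail (fun y => Complex.cos (κ * y)) g R y) volume 0 b :=
    ContinuousOn.intervalIntegrable (by fun_prop)
  have i3 : IntervalIntegrable (fun y => -κ ^ 2 * snc κ y) volume 0 b :=
    Continuous.intervalIntegrable (by fun_prop) _ _
  have i4 : IntervalIntegrable (fun y : ℝ => Complex.cos (κ * y)) volume 0 b :=
    Continuous.intervalIntegrable (by fun_prop) _ _
  have e5 : ∫ y in (0 : ℝ)..b, solDeriv κ m p q g R y =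
      p * (∫ y in (0 : ℝ)..b, -κ ^ 2 * snc κ y) + q * (∫ y in (0 : ℝ)..b, Complex.cos (κ * y)) -
      m * ((∫ y in (0 : ℝ)..b, (-κ ^ 2 * snc κ y * tail (snc κ) g R y -
        Complex.cos (κ * y) * snc κ y * g y)) -
      ∫ y in (0 : ℝ)..b, (Complex.cos (κ * y) * tail (fun y => Complex.cos (κ * y)) g R y -
        snc κ y * Complex.cos (κ * y) * g y)) := by
    rw [← intervalIntegral.integral_sub (i1.sub i0) (i2.sub i0'),
      ← intervalIntegral.integral_const_mul, ← intervalIntegral.integral_const_mul,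
      ← intervalIntegral.integral_const_mul,
      ← intervalIntegral.integral_add (i3.const_mul _) (i4.const_mul _),
      ← intervalIntegral.integral_sub ((i3.const_mul _).add (i4.const_mul _))
        (((i1.sub i0).sub (i2.sub i0')).const_mul _)]
    refine intervalIntegral.integral_congr fun y _ => ?_
    simp only [solDeriv]; ring
  rw [e5]
  simp only [sol]
  linear_combination (-m) * e1 + m * e2 + p * e3 + q * e4

/-- Here the derivatives of the tails add up to the source term, by the Wronskian identity
`cos_sq_add_snc_sq`. -/
lemma primOn_solDeriv (κ m p q : ℂ) {g : ℝ → ℂ} (hg : Integrable g) (R : ℝ) :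
    PrimOn (Ici 0) (solDeriv κ m p q g R) (fun x => -κ ^ 2 * sol κ m p q g R x - m * g x) := by
  intro b (hb : 0 ≤ b)
  have hS := continuousOn_tail (continuous_snc κ) hg R b
  have hC := continuousOn_tail (continuous_cos_mul κ) hg R b
  rw [← uIcc_of_le hb] at hS hC
  have hd : ∀ x : ℝ, HasDerivAt (fun y => -κ ^ 2 * snc κ y) (-κ ^ 2 * Complex.cos (κ * x)) x :=
    fun x => (hasDerivAt_snc κ x).const_mul _
  have e1 := PrimOn.mul_tail hb hd (by fun_prop) (continuous_snc κ) hg R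
  have e2 := PrimOn.mul_tail hb (hasDerivAt_cos_mul κ) (by fun_prop) (continuous_cos_mul κ) hg R
  have e3 := primOn_of_hasDerivAt (s := univ) (hasDerivAt_cos_mul κ) (by fun_prop) b trivial
  have e4 := primOn_of_hasDerivAt (s := univ) hd (by fun_prop) b trivial
  have i0 : IntervalIntegrable (fun y => -κ ^ 2 * snc κ y * snc κ y * g y) volume 0 b :=
    hg.intervalIntegrable.continuousOn_mul (by fun_prop)
  have i0' : IntervalIntegrable (fun y : ℝ => Complex.cos (κ * y) * Complex.cos (κ * y) * g y)
    volume 0 b := hg.intervalIntegrable.continuousOn_mul (by fun_prop)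
  have i1 : IntervalIntegrable (fun y : ℝ => -κ ^ 2 * Complex.cos (κ * y) * tail (snc κ) g R y)
    volume 0 b := ContinuousOn.intervalIntegrable (by fun_prop)
  have i2 : IntervalIntegrable (fun y : ℝ => -κ ^ 2 * snc κ y *
      tail (fun y => Complex.cos (κ * y)) g R y) volume 0 b :=
    ContinuousOn.intervalIntegrable (by fun_prop)
  have i3 : IntervalIntegrable (fun y => -κ ^ 2 * snc κ y) volume 0 b :=
    Continuous.intervalIntegrable (by fun_prop) _ _
  have i4 : IntervalIntegrable (fun y : ℝ => -κ ^ 2 * Complex.cos (κ * y)) volume 0 b :=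
    Continuous.intervalIntegrable (by fun_prop) _ _
  have e5 : ∫ y in (0 : ℝ)..b, (-κ ^ 2 * sol κ m p q g R y - m * g y) =
      p * (∫ y in (0 : ℝ)..b, -κ ^ 2 * Complex.cos (κ * y)) +
      q * (∫ y in (0 : ℝ)..b, -κ ^ 2 * snc κ y) -
      m * ((∫ y in (0 : ℝ)..b, (-κ ^ 2 * Complex.cos (κ * y) * tail (snc κ) g R y -
        -κ ^ 2 * snc κ y * snc κ y * g y)) -
      ∫ y in (0 : ℝ)..b, (-κ ^ 2 * snc κ y * tail (fun y => Complex.cos (κ * y)) g R y -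
        Complex.cos (κ * y) * Complex.cos (κ * y) * g y)) := by
    rw [← intervalIntegral.integral_sub (i1.sub i0) (i2.sub i0'),
      ← intervalIntegral.integral_const_mul, ← intervalIntegral.integral_const_mul,
      ← intervalIntegral.integral_const_mul,
      ← intervalIntegral.integral_add (i4.const_mul _) (i3.const_mul _),
      ← intervalIntegral.integral_sub ((i4.const_mul _).add (i3.const_mul _))
        (((i1.sub i0).sub (i2.sub i0')).const_mul _)]
    refine intervalIntegral.integral_congr fun y _ => ?_
    simp only [sol]
    linear_combination m * g y * cos_sq_add_snc_sq κ y
  rw [e5]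
  simp only [solDeriv]
  linear_combination (-m) * e1 + m * e2 + p * e4 + q * e3

lemma tail_eq_zero {φ g : ℝ → ℂ} {R x : ℝ} (h : ∀ y, x < y ∧ y ≤ R ∨ R < y ∧ y ≤ x → g y = 0) :
    tail φ g R x = 0 := by
  refine intervalIntegral.integral_zero_ae (Eventually.of_forall fun y hy => ?_)
  rw [h y (by simpa [mem_uIoc] using hy), mul_zero]

/-! ### The outgoing solution as a linear system at the vertices -/

/-- Spectral parameter and complexified scaling parameters. -/
abbrev Par (M : ℕ) : Type := ℂ × (Fin M → ℂ)

/-- Complexified scaling parameters of all edges. -/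
def scaleC (b : Fin M → ℂ) : Edge K M → ℂ := Sum.elim (fun _ => 0) b

/-- Real parameters as complex ones. -/
def par (lam : ℂ) (α : Fin M → ℝ) : Par M := (lam, fun m => (α m : ℂ))

/-- The wave number on an edge. -/
def kap (q : Par M) (e : Edge K M) : ℂ := Complex.exp (-scaleC q.2 e) * q.1

/-- The factor `e^{-2 α}` of an edge. -/
def mass (q : Par M) (e : Edge K M) : ℂ := Complex.exp (-(2 * scaleC q.2 e))

lemma scaleC_par (lam : ℂ) (α : Fin M → ℝ) (e : Edge K M) :
    scaleC (par lam α).2 e = (scale α e : ℂ) := by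
  cases e <;> simp [scaleC, par, scale]

lemma exp_mul_mass (lam : ℂ) (α : Fin M → ℝ) (e : Edge K M) :
    (Real.exp (2 * scale α e) : ℂ) * mass (par lam α) e = 1 := by
  rw [mass, scaleC_par]; push_cast
  rw [← Complex.exp_add, add_neg_cancel, Complex.exp_zero]

lemma exp_mul_kap_sq (lam : ℂ) (α : Fin M → ℝ) (e : Edge K M) :
    (Real.exp (2 * scale α e) : ℂ) * kap (par lam α) e ^ 2 = lam ^ 2 := by
  rw [kap, scaleC_par, mul_pow, ← Complex.exp_nat_mul]; push_cast
  rw [← mul_assoc, ← Complex.exp_add,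
    show 2 * (scale α e : ℂ) + 2 * -(scale α e : ℂ) = 0 by ring, Complex.exp_zero, one_mul]
  rfl

/-- Initial value on an edge of the homogeneous solution with coefficients `z`. -/
def coefP (z : End K M → ℂ) (e : Edge K M) : ℂ := z (Sum.inl e)

/-- Initial derivative on an edge of the outgoing homogeneous solution with coefficients `z`. -/
def coefQ (lam : ℂ) (z : End K M → ℂ) : Edge K M → ℂ :=
  Sum.elim (fun k => Complex.I * lam * z (Sum.inl (Sum.inl k))) (fun m => z (Sum.inr m))

/-- The outgoing solution of the homogeneous equation with coefficients `z`. -/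
def homSol (q : Par M) (z : End K M → ℂ) (e : Edge K M) (x : ℝ) : ℂ :=
  coefP z e * Complex.cos (kap q e * x) + coefQ q.1 z e * snc (kap q e) x

/-- The derivative of `homSol`. -/
def homDeriv (q : Par M) (z : End K M → ℂ) (e : Edge K M) (x : ℝ) : ℂ :=
  coefP z e * (-kap q e ^ 2 * snc (kap q e) x) + coefQ q.1 z e * Complex.cos (kap q e * x)

/-- Scaled values at the ends, for complex parameters. -/
def endValC (G : MetricGraph J K M) (q : Par M) (f : Edge K M → ℝ → ℂ) (i : End K M) : ℂ :=
  Complex.exp (scaleC q.2 (edgeOf i) / 2) * f (edgeOf i) (G.pos i)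

/-- Scaled outward derivatives at the ends, for complex parameters. -/
def endFluxC (G : MetricGraph J K M) (q : Par M) (f' : Edge K M → ℝ → ℂ) (i : End K M) : ℂ :=
  outSign i * Complex.exp (3 * scaleC q.2 (edgeOf i) / 2) * f' (edgeOf i) (G.pos i)

lemma endValC_par (lam : ℂ) (α : Fin M → ℝ) (f : Edge K M → ℝ → ℂ) :
    endValC G (par lam α) f = G.endVal α f := by
  ext i; simp [endValC, MetricGraph.endVal, scaleC_par]

lemma endFluxC_par (lam : ℂ) (α : Fin M → ℝ) (f : Edge K M → ℝ → ℂ) :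
    endFluxC G (par lam α) f = G.endFlux α f := by
  ext i; simp [endFluxC, MetricGraph.endFlux, scaleC_par]

lemma homSol_add_smul (q : Par M) (z w : End K M → ℂ) (c : ℂ) (e : Edge K M) (x : ℝ) :
    homSol q (z + c • w) e x = homSol q z e x + c * homSol q w e x := by
  cases e <;> simp [homSol, coefP, coefQ] <;> ring

lemma homDeriv_add_smul (q : Par M) (z w : End K M → ℂ) (c : ℂ) (e : Edge K M) (x : ℝ) :
    homDeriv q (z + c • w) e x = homDeriv q z e x + c * homDeriv q w e x := by
  cases e <;> simp [homDeriv, coefP, coefQ] <;> ring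

lemma vertexForm_add_smul (q : Par M) (z w : End K M → ℂ) (c : ℂ) :
    G.vform (endValC G q (homSol q (z + c • w))) (endFluxC G q (homDeriv q (z + c • w))) =
      G.vform (endValC G q (homSol q z)) (endFluxC G q (homDeriv q z)) +
      c • G.vform (endValC G q (homSol q w)) (endFluxC G q (homDeriv q w)) := by
  have e1 : endValC G q (homSol q (z + c • w)) =
      fun i => endValC G q (homSol q z) i + c * endValC G q (homSol q w) i := by
    ext i; simp only [endValC, homSol_add_smul]; ring
  have e2 : endFluxC G q (homDeriv q (z + c • w)) =
      fun i => endFluxC G q (homDeriv q z) i + c * endFluxC G q (homDeriv q w) i := by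
    ext i; simp only [endFluxC, homDeriv_add_smul]; ring
  rw [e1, e2, vform_add_smul]; rfl

lemma vertexForm_zero (q : Par M) :
    G.vform (endValC G q (homSol q 0)) (endFluxC G q (homDeriv q 0)) = 0 := by
  have := vertexForm_add_smul (G := G) q 0 0 (-1)
  rw [smul_zero, add_zero] at this
  rw [this]; simp

/-- The vertex conditions for outgoing homogeneous solutions. -/
def vertexMap (G : MetricGraph J K M) (q : Par M) : (End K M → ℂ) →ₗ[ℂ] (End K M → ℂ) where
  toFun z := G.vform (endValC G q (homSol q z)) (endFluxC G q (homDeriv q z))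
  map_add' z w := by simpa using vertexForm_add_smul (G := G) q z w 1
  map_smul' c z := by
    have := vertexForm_add_smul (G := G) q 0 z c
    rwa [zero_add, vertexForm_zero, zero_add] at this

/-- The matrix of the vertex conditions for outgoing homogeneous solutions. -/
def vertexMatrix (G : MetricGraph J K M) (q : Par M) : Matrix (End K M) (End K M) ℂ :=
  LinearMap.toMatrix' (vertexMap G q)

lemma vertexMatrix_mulVec (q : Par M) (z : End K M → ℂ) :
    (vertexMatrix G q).mulVec z =
      G.vform (endValC G q (homSol q z)) (endFluxC G q (homDeriv q z)) :=
  LinearMap.toMatrix'_mulVec _ _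

/-- Sources that are supported in the graph, at `x ≤ R`. -/
structure IsSource (G : MetricGraph J K M) (R : ℝ) (g : Edge K M → ℝ → ℂ) : Prop where
  nonneg : 0 ≤ R
  len_le : ∀ m, G.len m ≤ R
  memLp : ∀ e, MemLp (g e) 2 volume
  eq_zero : ∀ e, ∀ y ∉ G.ival e ∩ Iic R, g e y = 0

/-- The outgoing solution with coefficients `z` and source `g`. -/
def outSol (q : Par M) (z : End K M → ℂ) (g : Edge K M → ℝ → ℂ) (R : ℝ) (e : Edge K M) (x : ℝ) :
    ℂ := sol (kap q e) (mass q e) (coefP z e) (coefQ q.1 z e) (g e) R x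

/-- The derivative of `outSol`. -/
def outDeriv (q : Par M) (z : End K M → ℂ) (g : Edge K M → ℝ → ℂ) (R : ℝ) (e : Edge K M)
    (x : ℝ) : ℂ := solDeriv (kap q e) (mass q e) (coefP z e) (coefQ q.1 z e) (g e) R x

/-- Contribution of the source to the values at the ends. -/
def srcVal (q : Par M) (g : Edge K M → ℝ → ℂ) (R : ℝ) : End K M → ℂ :=
  Sum.elim (fun e => -(Complex.exp (scaleC q.2 e / 2) * mass q e * tail (snc (kap q e)) (g e) R 0))
    (fun _ => 0)

/-- Contribution of the source to the outward derivatives at the ends. -/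
def srcFlux (q : Par M) (g : Edge K M → ℝ → ℂ) (R : ℝ) : End K M → ℂ :=
  Sum.elim (fun e => -(Complex.exp (3 * scaleC q.2 e / 2) * mass q e *
    tail (fun y => Complex.cos (kap q e * y)) (g e) R 0)) (fun _ => 0)

lemma integrable_of_memLp_of_eq_zero {g : ℝ → ℂ} {a b : ℝ} (h : MemLp g 2 volume)
    (h0 : ∀ y ∉ Icc a b, g y = 0) : Integrable g := by
  have : IntegrableOn g (Icc a b) := (h.restrict (Icc a b)).integrable (by norm_num)
  exact (integrableOn_iff_integrable_of_support_subset
    (fun y hy => by_contra fun hy' => hy (h0 y hy'))).1 this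

namespace IsSource
variable {R : ℝ} {g : Edge K M → ℝ → ℂ} (hg : IsSource G R g)
include hg

lemma integrable (e : Edge K M) : Integrable (g e) :=
  integrable_of_memLp_of_eq_zero (a := 0) (b := R) (hg.memLp e) fun y hy =>
    hg.eq_zero e y fun h => hy ⟨nonneg_of_mem_ival G h.1, h.2⟩

lemma tail_of_le (φ : ℝ → ℂ) (e : Edge K M) {x : ℝ} (hx : R ≤ x) : tail φ (g e) R x = 0 :=
  tail_eq_zero fun y hy => hg.eq_zero e y fun h => by
    have := mem_Iic.1 h.2
    rcases hy with ⟨a, b⟩ | ⟨a, b⟩ <;> linarith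

/-- The tail integral runs up to `R`, but the source vanishes beyond the end of the edge. So the
particular solution and its derivative vanish at `x = len m`, which is why `srcVal` and `srcFlux`
are `0` at such ends. -/
lemma tail_len (φ : ℝ → ℂ) (m : Fin M) : tail φ (g (Sum.inr m)) R (G.len m) = 0 :=
  tail_eq_zero fun y hy => hg.eq_zero _ y fun h => by
    have h1 : y ∈ Icc 0 (G.len m) := h.1
    have := h1.2
    have := mem_Iic.1 h.2
    rcases hy with ⟨a, b⟩ | ⟨a, b⟩ <;> linarith

lemma endValC_outSol (q : Par M) (z : End K M → ℂ) :
    endValC G q (outSol q z g R) = fun i => endValC G q (homSol q z) i + 1 * srcVal q g R i := by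
  ext i
  rcases i with e | m
  · simp [endValC, outSol, homSol, sol, srcVal, edgeOf, MetricGraph.pos]; ring
  · simp [endValC, outSol, homSol, sol, srcVal, edgeOf, MetricGraph.pos, hg.tail_len]

lemma endFluxC_outDeriv (q : Par M) (z : End K M → ℂ) :
    endFluxC G q (outDeriv q z g R) =
      fun i => endFluxC G q (homDeriv q z) i + 1 * srcFlux q g R i := by
  ext i
  rcases i with e | m
  · simp [endFluxC, outDeriv, homDeriv, solDeriv, srcFlux, edgeOf, MetricGraph.pos, outSign]; ring
  · simp [endFluxC, outDeriv, homDeriv, solDeriv, srcFlux, edgeOf, MetricGraph.pos, hg.tail_len]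

lemma vertexCond {lam : ℂ} {α : Fin M → ℝ} {z : End K M → ℂ}
    (hz : (vertexMatrix G (par lam α)).mulVec z +
      G.vform (srcVal (par lam α) g R) (srcFlux (par lam α) g R) = 0) :
    VertexCond G α (outSol (par lam α) z g R) (outDeriv (par lam α) z g R) := by
  rw [vertexCond_iff, ← endValC_par lam, ← endFluxC_par lam, hg.endValC_outSol,
    hg.endFluxC_outDeriv, vform_add_smul]
  rw [vertexMatrix_mulVec] at hz
  rw [← hz]; ext i; simp

lemma continuousOn_outSol (q : Par M) (z : End K M → ℂ) (e : Edge K M) :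
    ContinuousOn (outSol q z g R e) (Ici 0) := by
  have h : ∀ b : ℝ, ContinuousOn (outSol q z g R e) (Icc 0 b) := by
    intro b
    have h1 := continuousOn_tail (continuous_snc (kap q e)) (hg.integrable e) R b
    have h2 := continuousOn_tail (continuous_cos_mul (kap q e)) (hg.integrable e) R b
    unfold outSol sol
    fun_prop
  intro x hx
  refine (h (x + 1) x ⟨hx, by linarith⟩).mono_of_mem_nhdsWithin ?_
  filter_upwards [self_mem_nhdsWithin, mem_nhdsWithin_of_mem_nhds
    (Iic_mem_nhds (show x < x + 1 by linarith))] with y h1 h2 using ⟨h1, h2⟩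

lemma continuousOn_outDeriv (q : Par M) (z : End K M → ℂ) (e : Edge K M) :
    ContinuousOn (outDeriv q z g R e) (Ici 0) := by
  have h : ∀ b : ℝ, ContinuousOn (outDeriv q z g R e) (Icc 0 b) := by
    intro b
    have h1 := continuousOn_tail (continuous_snc (kap q e)) (hg.integrable e) R b
    have h2 := continuousOn_tail (continuous_cos_mul (kap q e)) (hg.integrable e) R b
    unfold outDeriv solDeriv
    fun_prop
  intro x hx
  refine (h (x + 1) x ⟨hx, by linarith⟩).mono_of_mem_nhdsWithin ?_
  filter_upwards [self_mem_nhdsWithin, mem_nhdsWithin_of_mem_nhds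
    (Iic_mem_nhds (show x < x + 1 by linarith))] with y h1 h2 using ⟨h1, h2⟩

omit hg in
lemma memLp_of_continuousOn {f : ℝ → ℂ} (hf : ContinuousOn f (Ici 0)) (e : Edge K M) (R' : ℝ) :
    MemLp f 2 (volume.restrict (G.ival e ∩ Iic R')) := by
  have h : MemLp f 2 (volume.restrict (Icc 0 R')) := by
    have hc := hf.mono (Icc_subset_Ici_self : Icc 0 R' ⊆ Ici 0)
    obtain ⟨C, hC⟩ := isCompact_Icc.exists_bound_of_continuousOn hc
    refine MemLp.of_bound (hc.aestronglyMeasurable measurableSet_Icc) C ?_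
    filter_upwards [ae_restrict_mem measurableSet_Icc] with x hx using hC x hx
  exact h.mono_measure (Measure.restrict_mono
    (fun y (hy : y ∈ G.ival e ∩ Iic R') => mem_Icc.2 ⟨nonneg_of_mem_ival G hy.1, hy.2⟩) le_rfl)

lemma isH2loc (q : Par M) (z : End K M → ℂ) :
    IsH2loc G (outSol q z g R) (outDeriv q z g R)
      (fun e x => -kap q e ^ 2 * outSol q z g R e x - mass q e * g e x) where
  integral_deriv e x hx := primOn_sol _ _ _ _ (hg.integrable e) R x (nonneg_of_mem_ival G hx)
  integral_deriv2 e x hx :=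
    primOn_solDeriv _ _ _ _ (hg.integrable e) R x (nonneg_of_mem_ival G hx)
  memLp e R' := ((memLp_of_continuousOn (hg.continuousOn_outSol q z e) e R').const_mul _).sub
    (((hg.memLp e).restrict _).const_mul _)

/-- Beyond `R` the tails vanish, and the choice `coefQ = i λ coefP` on leads combines the two
fundamental solutions into the outgoing exponential. -/
lemma outSol_lead (q : Par M) (z : End K M → ℂ) (k : Fin K) {x : ℝ} (hx : R ≤ x) :
    outSol q z g R (Sum.inl k) x =
      z (Sum.inl (Sum.inl k)) * Complex.exp (Complex.I * q.1 * x) := by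
  rw [exp_eq_cos_add_snc]
  simp [outSol, sol, hg.tail_of_le _ _ hx, coefP, coefQ, kap, scaleC]
  ring

lemma outDeriv_lead (q : Par M) (z : End K M → ℂ) (k : Fin K) {x : ℝ} (hx : R ≤ x) :
    outDeriv q z g R (Sum.inl k) x =
      Complex.I * q.1 * z (Sum.inl (Sum.inl k)) * Complex.exp (Complex.I * q.1 * x) := by
  rw [exp_eq_cos_add_snc]
  simp [outDeriv, solDeriv, hg.tail_of_le _ _ hx, coefP, coefQ, kap, scaleC]
  linear_combination (-q.1 ^ 2 * snc q.1 x * z (Sum.inl (Sum.inl k))) * Complex.I_sq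

omit hg in
-- A lead is split at `R`: the function is continuous on `[0, R]`, and beyond it its square is a
-- multiple of `e^{-2 Im λ x}`, which is integrable.
lemma memLp_ival_of_lead {f : Edge K M → ℝ → ℂ} {lam : ℂ} (hlam : 0 < lam.im)
    (hf : ∀ e, ContinuousOn (f e) (Ici 0))
    (h : ∀ k, ∃ c : ℂ, ∀ x, R ≤ x → f (Sum.inl k) x = c * Complex.exp (Complex.I * lam * x))
    (e : Edge K M) : MemLp (f e) 2 (volume.restrict (G.ival e)) := by
  cases e with
  | inr m =>
    have := memLp_of_continuousOn (G := G) (hf (Sum.inr m)) (Sum.inr m) (G.len m)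
    rwa [inter_eq_left.2] at this
    exact fun y (hy : y ∈ Icc 0 (G.len m)) => mem_Iic.2 hy.2
  | inl k =>
    have hm : AEStronglyMeasurable (f (Sum.inl k)) (volume.restrict (Ici 0)) :=
      (hf (Sum.inl k)).aestronglyMeasurable measurableSet_Ici
    change MemLp _ 2 (volume.restrict (Ici 0))
    rw [memLp_two_iff_integrable_sq_norm hm]
    have h1 : IntegrableOn (fun x => ‖f (Sum.inl k) x‖ ^ 2) (Icc 0 R) :=
      ContinuousOn.integrableOn_Icc (((hf _).mono Icc_subset_Ici_self).norm.pow 2)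
    obtain ⟨c, hc⟩ := h k
    have h2 : IntegrableOn (fun x => ‖f (Sum.inl k) x‖ ^ 2) (Ioi R) := by
      have h3 : IntegrableOn (fun x : ℝ => ‖c‖ ^ 2 * Real.exp (-(2 * lam.im) * x)) (Ioi R) :=
        (integrableOn_exp_mul_Ioi (by linarith) R).const_mul _
      refine h3.congr_fun (fun x (hx : R < x) => ?_) measurableSet_Ioi
      simp only []
      rw [hc x hx.le, norm_mul, mul_pow, Complex.norm_exp, ← Real.exp_nat_mul]
      congr 2
      simp
      ring
    refine (h1.union h2).mono_set fun x hx => ?_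
    rcases le_or_gt x R with h | h
    · exact Or.inl ⟨hx, h⟩
    · exact Or.inr h

/-- If the vertex equations hold and `Im lam > 0`, the outgoing solution is in the domain. -/
theorem exists_opRel {lam : ℂ} (hlam : 0 < lam.im) {α : Fin M → ℝ} {z : End K M → ℂ}
    (hz : (vertexMatrix G (par lam α)).mulVec z +
      G.vform (srcVal (par lam α) g R) (srcFlux (par lam α) g R) = 0) {f : G.L2}
    (hf : ∀ e, f e =ᵐ[volume.restrict (G.ival e)] g e) :
    ∃ u : G.L2, (∀ e, u e =ᵐ[volume.restrict (G.ival e)] outSol (par lam α) z g R e) ∧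
      OpRel G α u (f + lam ^ 2 • u) := by
  have hu : ∀ e, MemLp (outSol (par lam α) z g R e) 2 (volume.restrict (G.ival e)) :=
    memLp_ival_of_lead hlam (hg.continuousOn_outSol _ z)
      fun k => ⟨_, fun x hx => hg.outSol_lead (par lam α) z k hx⟩
  have hu' : ∀ e, MemLp (outDeriv (par lam α) z g R e) 2 (volume.restrict (G.ival e)) :=
    memLp_ival_of_lead hlam (hg.continuousOn_outDeriv _ z)
      fun k => ⟨_, fun x hx => hg.outDeriv_lead (par lam α) z k hx⟩
  refine ⟨WithLp.toLp 2 fun e => (hu e).toLp _, fun e => (hu e).coeFn_toLp, _, _, _,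
    hg.isH2loc (par lam α) z, hg.vertexCond hz, hu', fun e => (hu e).coeFn_toLp, fun e => ?_⟩
  filter_upwards [L2.coeFn_add_smul f (WithLp.toLp 2 fun e => (hu e).toLp _) (lam ^ 2) e,
    hf e, (hu e).coeFn_toLp] with x h1 h2 h3
  rw [h1, h2]
  change _ + _ * ((hu e).toLp _ : ℝ → ℂ) x = _
  rw [h3]
  linear_combination (-(g e x)) * exp_mul_mass lam α e -
    outSol (par lam α) z g R e x * exp_mul_kap_sq lam α e

end IsSource

/-! ### Invertibility of the vertex matrix and the resolvent in the upper half-plane -/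

lemma exists_Icc_subset_ival (e : Edge K M) : ∃ b : ℝ, 0 < b ∧ Icc 0 b ⊆ G.ival e := by
  cases e with
  | inl k => exact ⟨1, one_pos, fun x (hx : x ∈ Icc 0 1) => mem_Ici.2 hx.1⟩
  | inr m => exact ⟨G.len m, G.len_pos m, subset_rfl⟩

/-- By continuity the combination vanishes on the whole interval, so its value and its derivative
vanish at the midpoint. These are two linear equations for the coefficients, with the Wronskian `1`
as determinant. -/
lemma coef_eq_zero_of_comb {κ p r : ℂ} {b : ℝ} (hb : 0 < b)
    (h : ∀ᵐ x : ℝ ∂(volume.restrict (Icc 0 b)), p * Complex.cos (κ * x) + r * snc κ x = 0) :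
    p = 0 ∧ r = 0 := by
  have h0 : EqOn (fun x : ℝ => p * Complex.cos (κ * x) + r * snc κ x) (fun _ => 0) (Icc 0 b) :=
    Measure.eqOn_Icc_of_ae_eq volume hb.ne h (by fun_prop) (by fun_prop)
  have hx : b / 2 ∈ Ioo 0 b := ⟨by linarith, by linarith⟩
  have hev : (fun x : ℝ => p * Complex.cos (κ * x) + r * snc κ x) =ᶠ[𝓝 (b / 2)] fun _ => 0 := by
    filter_upwards [Icc_mem_nhds hx.1 hx.2] with x hx using h0 hx
  have hd : HasDerivAt (fun x : ℝ => p * Complex.cos (κ * x) + r * snc κ x)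
      (p * (-κ ^ 2 * snc κ (b / 2)) + r * Complex.cos (κ * (b / 2 : ℝ))) (b / 2) :=
    ((hasDerivAt_cos_mul _ _).const_mul _).add ((hasDerivAt_snc _ _).const_mul _)
  have e1 := hd.unique ((hasDerivAt_const _ _).congr_of_eventuallyEq hev)
  have e0 : p * Complex.cos (κ * (b / 2 : ℝ)) + r * snc κ (b / 2) = 0 :=
    h0 (Ioo_subset_Icc_self hx)
  have e2 := cos_sq_add_snc_sq κ (b / 2)
  constructor
  · linear_combination -p * e2 + Complex.cos (κ * (b / 2 : ℝ)) * e0 - snc κ (b / 2) * e1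
  · linear_combination -r * e2 + κ ^ 2 * snc κ (b / 2) * e0 + Complex.cos (κ * (b / 2 : ℝ)) * e1

lemma eq_zero_of_homSol_ae_zero {q : Par M} {z : End K M → ℂ}
    (h : ∀ e, ∃ b > 0, ∀ᵐ x ∂(volume.restrict (Icc 0 b)), homSol q z e x = 0) : z = 0 := by
  have key : ∀ e, coefP z e = 0 ∧ coefQ q.1 z e = 0 := fun e => by
    obtain ⟨b, hb, hb'⟩ := h e
    exact coef_eq_zero_of_comb hb hb'
  ext i
  rcases i with e | m
  · exact (key e).1
  · exact (key (Sum.inr m)).2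

lemma outSol_zero (q : Par M) (z : End K M → ℂ) (R : ℝ) :
    outSol q z (0 : Edge K M → ℝ → ℂ) R = homSol q z := by
  ext e x; simp [outSol, homSol, sol, tail]

lemma outDeriv_zero (q : Par M) (z : End K M → ℂ) (R : ℝ) :
    outDeriv q z (0 : Edge K M → ℝ → ℂ) R = homDeriv q z := by
  ext e x; simp [outDeriv, homDeriv, solDeriv, tail]

/-- A radius that is larger than all the lengths. -/
def MetricGraph.radius (G : MetricGraph J K M) : ℝ := ∑ m, G.len m

lemma radius_nonneg : 0 ≤ G.radius := Finset.sum_nonneg fun m _ => (G.len_pos m).le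

lemma len_le_radius (m : Fin M) : G.len m ≤ G.radius :=
  Finset.single_le_sum (f := G.len) (fun m _ => (G.len_pos m).le) (Finset.mem_univ m)

lemma isSource_zero {R : ℝ} (hR : G.radius ≤ R) : IsSource G R (0 : Edge K M → ℝ → ℂ) where
  nonneg := radius_nonneg.trans hR
  len_le m := (len_le_radius m).trans hR
  memLp _ := MemLp.zero
  eq_zero _ _ _ := rfl

lemma vform_zero : G.vform 0 0 = 0 := by ext i; simp [MetricGraph.vform]

lemma srcVal_zero (q : Par M) (R : ℝ) : srcVal q (0 : Edge K M → ℝ → ℂ) R = 0 := by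
  ext i; rcases i with e | m <;> simp [srcVal, tail]

lemma srcFlux_zero (q : Par M) (R : ℝ) : srcFlux q (0 : Edge K M → ℝ → ℂ) R = 0 := by
  ext i; rcases i with e | m <;> simp [srcFlux, tail]

/-- The vertex matrix is invertible for `Im lam > 0`. -/
theorem det_vertexMatrix_ne_zero {lam : ℂ} (hlam : 0 < lam.im) (α : Fin M → ℝ) :
    (vertexMatrix G (par lam α)).det ≠ 0 := by
  intro h
  obtain ⟨z, hz0, hz⟩ := Matrix.exists_mulVec_eq_zero_iff.2 h
  have hs := isSource_zero (G := G) le_rfl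
  -- A kernel vector yields an outgoing solution without source. For `Im λ > 0` it lies in `L²`,
  -- where the energy estimate forces it to vanish.
  obtain ⟨u, hu, hop⟩ := hs.exists_opRel hlam (α := α) (z := z) (f := 0) (by
    rw [hz, srcVal_zero, srcFlux_zero, vform_zero, zero_add]) (fun e => Lp.coeFn_zero _ _ _)
  rw [zero_add] at hop
  have h0 := hop.eq_zero hlam
  refine hz0 (eq_zero_of_homSol_ae_zero (q := par lam α) fun e => ?_)
  obtain ⟨b, hb, hsub⟩ := exists_Icc_subset_ival (G := G) e
  refine ⟨b, hb, ae_restrict_of_ae_restrict_of_subset hsub ?_⟩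
  filter_upwards [hu e, Lp.coeFn_zero ℂ 2 (volume.restrict (G.ival e))] with x h1 h2
  rw [outSol_zero] at h1
  rw [← h1, h0]
  exact h2

/-- The part of `f` at `x ≤ R`, as a function on the line. -/
def extend (R : ℝ) (f : G.L2) (e : Edge K M) : ℝ → ℂ := (G.ival e ∩ Iic R).indicator (f e)

lemma measurableSet_ival_inter (e : Edge K M) (R : ℝ) : MeasurableSet (G.ival e ∩ Iic R) :=
  (measurableSet_ival G e).inter measurableSet_Iic

lemma isSource_extend {R : ℝ} (hR : G.radius ≤ R) (f : G.L2) : IsSource G R (extend R f) where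
  nonneg := radius_nonneg.trans hR
  len_le m := (len_le_radius m).trans hR
  memLp e := (memLp_indicator_iff_restrict (measurableSet_ival_inter e R)).2
    (memLp_ival_inter R (Lp.memLp (f e)))
  eq_zero _ _ hy := indicator_of_notMem hy _

lemma ae_eq_extend {R : ℝ} {f : G.L2}
    (hf : ∀ e, ∀ᵐ x ∂(volume.restrict (G.ival e)), R < x → f e x = 0) (e : Edge K M) :
    f e =ᵐ[volume.restrict (G.ival e)] extend R f e := by
  filter_upwards [hf e, ae_restrict_mem (measurableSet_ival G e)] with x h1 h2
  rcases le_or_gt x R with h | h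
  · exact (indicator_of_mem (show x ∈ G.ival e ∩ Iic R from ⟨h2, h⟩) _).symm
  · rw [h1 h]
    exact (indicator_of_notMem (fun hx => not_le.2 h hx.2) _).symm

/-- The coefficients of the outgoing solution for the source `g`. -/
def outCoef (G : MetricGraph J K M) (q : Par M) (g : Edge K M → ℝ → ℂ) (R : ℝ) : End K M → ℂ :=
  -(vertexMatrix G q)⁻¹.mulVec (G.vform (srcVal q g R) (srcFlux q g R))

lemma outCoef_spec {q : Par M} (h : (vertexMatrix G q).det ≠ 0) (g : Edge K M → ℝ → ℂ) (R : ℝ) :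
    (vertexMatrix G q).mulVec (outCoef G q g R) + G.vform (srcVal q g R) (srcFlux q g R) = 0 := by
  rw [outCoef, Matrix.mulVec_neg, Matrix.mulVec_mulVec,
    Matrix.mul_nonsing_inv _ (isUnit_iff_ne_zero.2 h), Matrix.one_mulVec, neg_add_cancel]

/-- The resolvent exists for `Im lam > 0`, and is given by the outgoing solution on functions with
bounded support. -/
theorem exists_isResolvent_outSol (α : Fin M → ℝ) {lam : ℂ} (hlam : 0 < lam.im) :
    ∃ T : G.L2 →L[ℂ] G.L2, IsResolvent G α lam T ∧ ∀ (R : ℝ), G.radius ≤ R → ∀ f : G.L2,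
      (∀ e, ∀ᵐ x ∂(volume.restrict (G.ival e)), R < x → f e x = 0) → ∀ e,
      T f e =ᵐ[volume.restrict (G.ival e)]
        outSol (par lam α) (outCoef G (par lam α) (extend R f) R) (extend R f) R e := by
  have key : ∀ (R : ℝ), G.radius ≤ R → ∀ f : G.L2,
      (∀ e, ∀ᵐ x ∂(volume.restrict (G.ival e)), R < x → f e x = 0) → ∃ u : G.L2, (∀ e,
      u e =ᵐ[volume.restrict (G.ival e)]
        outSol (par lam α) (outCoef G (par lam α) (extend R f) R) (extend R f) R e) ∧
      OpRel G α u (f + lam ^ 2 • u) := fun R hR f hf =>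
    (isSource_extend hR f).exists_opRel hlam
      (outCoef_spec (det_vertexMatrix_ne_zero hlam α) _ _) (ae_eq_extend hf)
  obtain ⟨T, hT⟩ := exists_isResolvent (G := G) (α := α) hlam fun f ⟨R, hR⟩ => by
    obtain ⟨u, -, hu⟩ := key (max R G.radius) (le_max_right _ _) f fun e => by
      filter_upwards [hR e] with x hx hx' using hx ((le_max_left _ _).trans_lt hx')
    exact ⟨u, hu⟩
  refine ⟨T, hT, fun R hR f hf e => ?_⟩
  obtain ⟨u, hu, hop⟩ := key R hR f hf
  rw [OpRel.unique hlam (hT.1 f) hop]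
  exact hu e

lemma IsResolvent.unique {α : Fin M → ℝ} {lam : ℂ} {T S : G.L2 →L[ℂ] G.L2}
    (hT : IsResolvent G α lam T) (hS : IsResolvent G α lam S) : T = S := by
  ext1 f
  have := hS.2 _ _ (hT.1 f)
  rw [add_sub_cancel_right] at this
  exact this.symm

/-! ### The functions `cos (κ x)` and `sin (κ x) / κ` as analytic families in a Banach algebra -/

/-- The point of `[0, R]` that is nearest to `x`. -/
def clip (R x : ℝ) : ℝ := max 0 (min x R)

@[fun_prop]
lemma continuous_clip (R : ℝ) : Continuous (clip R) := by unfold clip; fun_prop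

lemma clip_nonneg (R x : ℝ) : 0 ≤ clip R x := le_max_left _ _

lemma clip_le (R x : ℝ) : clip R x ≤ |R| :=
  max_le (abs_nonneg R) ((min_le_right _ _).trans (le_abs_self R))

lemma clip_of_mem {R x : ℝ} (h : x ∈ Icc 0 R) : clip R x = x := by
  rw [clip, min_eq_left h.2, max_eq_right h.1]

lemma abs_clip_le (R x : ℝ) : |clip R x| ≤ |R| := by
  rw [abs_of_nonneg (clip_nonneg R x)]; exact clip_le R x

/-- `clip R` as a bounded continuous function. -/
def clipB (R : ℝ) : ℝ →ᵇ ℂ :=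
  BoundedContinuousFunction.ofNormedAddCommGroup (fun x => (clip R x : ℂ)) (by fun_prop) |R|
    fun x => by rw [Complex.norm_real]; exact abs_clip_le R x

/-- Evaluation at a point, as a ring homomorphism. -/
def evalRing (x : ℝ) : (ℝ →ᵇ ℂ) →+* ℂ where
  toFun f := f x
  map_one' := rfl
  map_mul' _ _ := rfl
  map_zero' := rfl
  map_add' _ _ := rfl

/-- The function `exp (κ x)` on `[0, R]`. -/
def expB (R : ℝ) (κ : ℂ) : ℝ →ᵇ ℂ := NormedSpace.exp (κ • clipB R)

/-- Evaluation at `x` is a continuous ring homomorphism, so it commutes with the exponential series.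
-/
lemma expB_apply (R : ℝ) (κ : ℂ) (x : ℝ) : expB R κ x = Complex.exp (κ * clip R x) := by
  have := NormedSpace.map_exp_of_mem_ball (𝕂 := ℂ) (evalRing x)
    (BoundedContinuousFunction.evalCLM ℂ x).continuous (κ • clipB R)
    ((NormedSpace.expSeries_radius_eq_top ℂ (ℝ →ᵇ ℂ)).symm ▸ edist_lt_top _ _)
  rw [Complex.exp_eq_exp_ℂ]
  exact this

/-- The exponential of a Banach algebra is entire, which gives analyticity in `κ` uniformly in `x`,
as needed for operator norms. The clipping to `[0, R]` keeps `exp (κ x)` bounded for every complex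
`κ`. -/
lemma contDiff_expB (R : ℝ) : ContDiff ℂ ω (expB R) := by
  have : ContDiff ℂ ω (NormedSpace.exp : (ℝ →ᵇ ℂ) → ℝ →ᵇ ℂ) :=
    contDiff_omega_iff_analyticOnNhd.2 fun x _ => NormedSpace.exp_analytic x
  exact this.comp (contDiff_id.smul contDiff_const)

/-- The function `cos (κ x)` on `[0, R]`. -/
def cosB (R : ℝ) (κ : ℂ) : ℝ →ᵇ ℂ :=
  (2 : ℂ)⁻¹ • (expB R (Complex.I * κ) + expB R (-(Complex.I * κ)))

lemma cosB_apply (R : ℝ) (κ : ℂ) (x : ℝ) : cosB R κ x = Complex.cos (κ * clip R x) := by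
  change (2 : ℂ)⁻¹ * (expB R _ x + expB R _ x) = _
  rw [expB_apply, expB_apply, Complex.cos,
    show Complex.I * κ * (clip R x : ℂ) = κ * clip R x * Complex.I by ring,
    show -(Complex.I * κ) * (clip R x : ℂ) = -(κ * clip R x) * Complex.I by ring]
  ring

lemma contDiff_cosB (R : ℝ) : ContDiff ℂ ω (cosB R) := by
  have h := contDiff_expB R
  have h1 : ContDiff ℂ ω fun κ : ℂ => expB R (Complex.I * κ) := h.comp (by fun_prop)
  have h2 : ContDiff ℂ ω fun κ : ℂ => expB R (-(Complex.I * κ)) := h.comp (by fun_prop)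
  exact (h1.add h2).const_smul (2 : ℂ)⁻¹

lemma norm_integral_clip_le (R : ℝ) (φ : ℝ →ᵇ ℂ) (x : ℝ) :
    ‖∫ y in (0 : ℝ)..clip R x, φ y‖ ≤ ‖φ‖ * |R| := by
  refine (intervalIntegral.norm_integral_le_of_norm_le_const
    fun y _ => φ.norm_coe_le_norm y).trans ?_
  rw [sub_zero]
  exact mul_le_mul_of_nonneg_left (abs_clip_le R x) (norm_nonneg _)

/-- The primitive on `[0, R]` that vanishes at `0`. -/
def primB (R : ℝ) : (ℝ →ᵇ ℂ) →L[ℂ] (ℝ →ᵇ ℂ) :=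
  LinearMap.mkContinuous
    { toFun := fun φ => BoundedContinuousFunction.ofNormedAddCommGroup
        (fun x => ∫ y in (0 : ℝ)..clip R x, φ y)
        ((intervalIntegral.continuous_primitive
          (fun a b => φ.continuous.intervalIntegrable a b) 0).comp (continuous_clip R))
        (‖φ‖ * |R|) (norm_integral_clip_le R φ)
      map_add' := fun φ ψ => by
        ext x
        exact intervalIntegral.integral_add (φ.continuous.intervalIntegrable _ _)
          (ψ.continuous.intervalIntegrable _ _)
      map_smul' := fun c φ => by
        ext x
        exact intervalIntegral.integral_const_mul _ _ } |R| fun φ => by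
    rw [mul_comm]
    exact BoundedContinuousFunction.norm_ofNormedAddCommGroup_le _ (by positivity)
      (norm_integral_clip_le R φ)

/-- The function `sin (κ x) / κ` on `[0, R]`. -/
def sinB (R : ℝ) (κ : ℂ) : ℝ →ᵇ ℂ := primB R (cosB R κ)

lemma sinB_apply {R : ℝ} (hR : 0 ≤ R) (κ : ℂ) (x : ℝ) : sinB R κ x = snc κ (clip R x) := by
  change ∫ y in (0 : ℝ)..clip R x, cosB R κ y = _
  refine intervalIntegral.integral_congr fun y hy => ?_
  rw [uIcc_of_le (clip_nonneg R x)] at hy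
  rw [cosB_apply, clip_of_mem ⟨hy.1, hy.2.trans ((clip_le R x).trans (abs_of_nonneg hR).le)⟩]

lemma contDiff_sinB (R : ℝ) : ContDiff ℂ ω (sinB R) :=
  (primB R).contDiff.comp (contDiff_cosB R)

lemma contDiff_snc {x : ℝ} (hx : 0 ≤ x) : ContDiff ℂ ω fun κ : ℂ => snc κ x := by
  have h := (BoundedContinuousFunction.evalCLM ℂ x).contDiff.comp (contDiff_sinB x)
  have e : (fun κ : ℂ => snc κ x) = (BoundedContinuousFunction.evalCLM ℂ x) ∘ sinB x := by
    ext κ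
    change _ = sinB x κ x
    rw [sinB_apply hx, clip_of_mem ⟨hx, le_rfl⟩]
  rwa [e]

/-! ### Multiplication of bounded functions by a square integrable weight -/

lemma memLp_weight {μ : Measure ℝ} {w : ℝ → ℂ} (hw : MemLp w 2 μ) (φ : ℝ →ᵇ ℂ) :
    MemLp (fun x => w x * φ x) 2 μ := by
  refine MemLp.of_le_mul (c := ‖φ‖) hw (hw.1.mul φ.continuous.aestronglyMeasurable)
    (Eventually.of_forall fun x => ?_)
  rw [norm_mul, mul_comm]
  exact mul_le_mul_of_nonneg_right (φ.norm_coe_le_norm x) (norm_nonneg _)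

/-- Multiplication by a square integrable weight, from bounded continuous functions to `L²`. -/
def weightB {μ : Measure ℝ} {w : ℝ → ℂ} (hw : MemLp w 2 μ) : (ℝ →ᵇ ℂ) →L[ℂ] Lp ℂ 2 μ :=
  LinearMap.mkContinuous
    { toFun := fun φ => (memLp_weight hw φ).toLp _
      map_add' := fun φ ψ => by
        rw [← MemLp.toLp_add]
        exact MemLp.toLp_congr _ _ (Eventually.of_forall fun x => mul_add _ _ _)
      map_smul' := fun c φ => by
        rw [RingHom.id_apply, ← MemLp.toLp_const_smul]
        exact MemLp.toLp_congr _ _ (Eventually.of_forall fun x => mul_left_comm _ _ _) }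
    ‖hw.toLp w‖ fun φ => by
      rw [mul_comm]
      refine Lp.norm_le_mul_norm_of_ae_le_mul ?_
      change ∀ᵐ x ∂μ, ‖((memLp_weight hw φ).toLp _ : ℝ → ℂ) x‖ ≤ _
      filter_upwards [(memLp_weight hw φ).coeFn_toLp, hw.coeFn_toLp] with x h1 h2
      rw [h1, h2, norm_mul, mul_comm]
      exact mul_le_mul_of_nonneg_right (φ.norm_coe_le_norm x) (norm_nonneg _)

lemma weightB_apply {μ : Measure ℝ} {w : ℝ → ℂ} (hw : MemLp w 2 μ) (φ : ℝ →ᵇ ℂ) :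
    weightB hw φ =ᵐ[μ] fun x => w x * φ x := (memLp_weight hw φ).coeFn_toLp

/-! ### The Volterra operators -/

lemma extend_add_smul (R : ℝ) (f g : G.L2) (c : ℂ) (e : Edge K M) :
    extend R (f + c • g) e =ᵐ[volume] fun y => extend R f e y + c * extend R g e y := by
  have h := (ae_restrict_iff' (measurableSet_ival G e)).1 (L2.coeFn_add_smul f g c e)
  filter_upwards [h] with x hx
  by_cases hx' : x ∈ G.ival e ∩ Iic R
  · simp only [extend, indicator_of_mem hx']; exact hx hx'.1
  · simp [extend, indicator_of_notMem hx']

/-- A bound for the `L¹` norm on `x ≤ R` by the `L²` norm. -/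
def l1Bound (G : MetricGraph J K M) (R : ℝ) (e : Edge K M) : ℝ :=
  (volume (G.ival e ∩ Iic R) ^ (1 / 2 : ℝ)).toReal

lemma volume_ival_inter_lt_top (e : Edge K M) (R : ℝ) : volume (G.ival e ∩ Iic R) < ⊤ :=
  (measure_mono fun _ (hy : _ ∈ G.ival e ∩ Iic R) => mem_Icc.2 ⟨nonneg_of_mem_ival G hy.1, hy.2⟩).trans_lt
    (measure_Icc_lt_top (a := (0 : ℝ)) (b := R))

lemma integral_norm_extend_le (R : ℝ) (f : G.L2) (e : Edge K M) :
    ∫ y, ‖extend R f e y‖ ≤ l1Bound G R e * ‖f‖ := by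
  have hs := measurableSet_ival_inter (G := G) e R
  have hm : AEStronglyMeasurable (f e) (volume.restrict (G.ival e ∩ Iic R)) :=
    (memLp_ival_inter R (Lp.memLp (f e))).1
  have h1 : ∫ y, ‖extend R f e y‖ = (eLpNorm (f e) 1 (volume.restrict (G.ival e ∩ Iic R))).toReal := by
    change ∫ y, ‖(G.ival e ∩ Iic R).indicator (f e) y‖ = _
    rw [← eLpNorm_indicator_eq_eLpNorm_restrict hs, eLpNorm_one_eq_lintegral_enorm,
      integral_norm_eq_lintegral_enorm ((aestronglyMeasurable_indicator_iff hs).2 hm)]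
  have h2 : eLpNorm (f e) 1 (volume.restrict (G.ival e ∩ Iic R)) ≤
      eLpNorm (f e) 2 (volume.restrict (G.ival e)) * volume (G.ival e ∩ Iic R) ^ (1 / 2 : ℝ) := by
    refine (eLpNorm_le_eLpNorm_mul_rpow_measure_univ (p := 1) (q := 2) (by norm_num) hm).trans ?_
    refine mul_le_mul' (eLpNorm_mono_measure _
      (Measure.restrict_mono inter_subset_left le_rfl)) (le_of_eq ?_)
    simp; norm_num
  have hfin : volume (G.ival e ∩ Iic R) ^ (1 / 2 : ℝ) ≠ ⊤ :=
    ENNReal.rpow_ne_top_of_nonneg (by norm_num) (volume_ival_inter_lt_top e R).ne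
  rw [h1, mul_comm]
  refine (ENNReal.toReal_mono (ENNReal.mul_ne_top (Lp.memLp (f e)).2.ne hfin) h2).trans ?_
  rw [ENNReal.toReal_mul]
  exact mul_le_mul_of_nonneg_right (PiLp.norm_apply_le f e) ENNReal.toReal_nonneg

lemma integrable_extend (R : ℝ) (f : G.L2) (e : Edge K M) : Integrable (extend R f e) :=
  integrable_of_memLp_of_eq_zero (a := 0) (b := R)
    ((memLp_indicator_iff_restrict (measurableSet_ival_inter e R)).2
      (memLp_ival_inter R (Lp.memLp (f e)))) fun _ hy =>
    indicator_of_notMem (fun h => hy ⟨nonneg_of_mem_ival G h.1, h.2⟩) _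

lemma integrable_mul_extend (φ : ℝ →ᵇ ℂ) (R : ℝ) (f : G.L2) (e : Edge K M) :
    Integrable fun y => φ y * extend R f e y :=
  (integrable_extend R f e).bdd_mul φ.continuous.aestronglyMeasurable
    (Eventually.of_forall φ.norm_coe_le_norm)

lemma norm_integral_mul_extend_le (φ : ℝ →ᵇ ℂ) (R : ℝ) (f : G.L2) (e : Edge K M) (a b : ℝ) :
    ‖∫ y in a..b, φ y * extend R f e y‖ ≤ l1Bound G R e * ‖φ‖ * ‖f‖ := by
  refine intervalIntegral.norm_integral_le_integral_norm_uIoc.trans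
    ((setIntegral_le_integral (integrable_mul_extend φ R f e).norm
      (Eventually.of_forall fun _ => norm_nonneg _)).trans ?_)
  refine (integral_mono (integrable_mul_extend φ R f e).norm
    ((integrable_extend R f e).norm.const_mul ‖φ‖) fun y => ?_).trans ?_
  · simp only [norm_mul]
    exact mul_le_mul_of_nonneg_right (φ.norm_coe_le_norm y) (norm_nonneg _)
  · rw [integral_const_mul]
    have := mul_le_mul_of_nonneg_left (integral_norm_extend_le R f e) (norm_nonneg φ)
    linarith

/-- The operators `f ↦ ∫_x^R φ f` on an edge. -/
def tailOp (G : MetricGraph J K M) (R : ℝ) (e : Edge K M) :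
    (ℝ →ᵇ ℂ) →L[ℂ] G.L2 →L[ℂ] (ℝ →ᵇ ℂ) :=
  have hb : ∀ (φ : ℝ →ᵇ ℂ) (f : G.L2) (x : ℝ),
      ‖tail φ (extend R f e) R (clip R x)‖ ≤ l1Bound G R e * ‖φ‖ * ‖f‖ :=
    fun φ f x => norm_integral_mul_extend_le φ R f e _ _
  have hc : ∀ (φ : ℝ →ᵇ ℂ) (f : G.L2),
      Continuous fun x => tail φ (extend R f e) R (clip R x) := fun φ f => by
    have h : Continuous fun t => tail φ (extend R f e) R t := by
      have h0 : tail φ (extend R f e) R = fun t => -∫ y in R..t, φ y * extend R f e y := by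
        ext t; exact intervalIntegral.integral_symm _ _
      rw [h0]
      exact (intervalIntegral.continuous_primitive (fun a b =>
        (integrable_mul_extend φ R f e).intervalIntegrable) R).neg
    exact h.comp (continuous_clip R)
  -- A bounded bilinear map in the weight and the source: analytic dependence of the operator on the
  -- parameters then reduces to that of `φ`.
  LinearMap.mkContinuous₂ (LinearMap.mk₂ ℂ
    (fun φ f => BoundedContinuousFunction.ofNormedAddCommGroup
      (fun x => tail φ (extend R f e) R (clip R x)) (hc φ f) _ (hb φ f))
    (fun φ ψ f => by
      ext x
      change tail ⇑(φ + ψ) (extend R f e) R _ =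
        tail φ (extend R f e) R (clip R x) + tail ψ (extend R f e) R (clip R x)
      unfold tail
      rw [← intervalIntegral.integral_add (integrable_mul_extend φ R f e).intervalIntegrable
        (integrable_mul_extend ψ R f e).intervalIntegrable]
      exact intervalIntegral.integral_congr fun y _ => add_mul _ _ _)
    (fun c φ f => by
      ext x
      change tail ⇑(c • φ) (extend R f e) R _ = c * tail φ (extend R f e) R (clip R x)
      unfold tail
      rw [← intervalIntegral.integral_const_mul]
      exact intervalIntegral.integral_congr fun y _ => mul_assoc _ _ _)
    (fun φ f g => by
      ext x
      change tail φ (extend R (f + g) e) R _ =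
        tail φ (extend R f e) R (clip R x) + tail φ (extend R g e) R (clip R x)
      unfold tail
      rw [← intervalIntegral.integral_add (integrable_mul_extend φ R f e).intervalIntegrable
        (integrable_mul_extend φ R g e).intervalIntegrable]
      refine intervalIntegral.integral_congr_ae ?_
      have := extend_add_smul R f g 1 e
      rw [one_smul] at this
      filter_upwards [this] with y hy _
      rw [hy]; ring)
    (fun c φ f => by
      ext x
      change tail φ (extend R (c • f) e) R _ = c * tail φ (extend R f e) R (clip R x)
      unfold tail
      rw [← intervalIntegral.integral_const_mul]
      refine intervalIntegral.integral_congr_ae ?_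
      have h1 := extend_add_smul R (0 : G.L2) f c e
      have h2 := extend_add_smul R (0 : G.L2) (0 : G.L2) (-1) e
      rw [zero_add] at h1
      rw [smul_zero, zero_add] at h2
      filter_upwards [h1, h2] with y hy hy' _
      rw [hy, hy']; ring)) (l1Bound G R e) fun φ f =>
    BoundedContinuousFunction.norm_ofNormedAddCommGroup_le
      (f := fun x => tail φ (extend R f e) R (clip R x)) _
      (by unfold l1Bound; positivity) (hb φ f)

lemma tailOp_apply (R : ℝ) (e : Edge K M) (φ : ℝ →ᵇ ℂ) (f : G.L2) (x : ℝ) :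
    tailOp G R e φ f x = tail φ (extend R f e) R (clip R x) := rfl

lemma tail_congr {φ ψ g : ℝ → ℂ} {R : ℝ} (h : EqOn φ ψ (Icc 0 R)) {x : ℝ} (hx : x ∈ Icc 0 R) :
    tail φ g R x = tail ψ g R x := by
  refine intervalIntegral.integral_congr fun y hy => ?_
  rw [uIcc_of_le hx.2] at hy
  rw [h ⟨hx.1.trans hy.1, hy.2⟩]

lemma clip_mem {R : ℝ} (hR : 0 ≤ R) (x : ℝ) : clip R x ∈ Icc 0 R :=
  ⟨clip_nonneg R x, (clip_le R x).trans (abs_of_nonneg hR).le⟩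

lemma tailOp_sinB {R : ℝ} (hR : 0 ≤ R) (e : Edge K M) (κ : ℂ) (f : G.L2) (x : ℝ) :
    tailOp G R e (sinB R κ) f x = tail (snc κ) (extend R f e) R (clip R x) := by
  rw [tailOp_apply]
  refine tail_congr (fun y hy => ?_) (clip_mem hR x)
  rw [sinB_apply hR, clip_of_mem hy]

lemma tailOp_cosB {R : ℝ} (hR : 0 ≤ R) (e : Edge K M) (κ : ℂ) (f : G.L2) (x : ℝ) :
    tailOp G R e (cosB R κ) f x =
      tail (fun y => Complex.cos (κ * y)) (extend R f e) R (clip R x) := by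
  rw [tailOp_apply]
  refine tail_congr (fun y hy => ?_) (clip_mem hR x)
  rw [cosB_apply, clip_of_mem hy]

/-- The particular solution for a source, on an edge. -/
def kerOp (G : MetricGraph J K M) (R : ℝ) (q : Par M) (e : Edge K M) : G.L2 →L[ℂ] (ℝ →ᵇ ℂ) :=
  -mass q e • ((ContinuousLinearMap.mul ℂ (ℝ →ᵇ ℂ) (cosB R (kap q e))).comp
      (tailOp G R e (sinB R (kap q e))) -
    (ContinuousLinearMap.mul ℂ (ℝ →ᵇ ℂ) (sinB R (kap q e))).comp
      (tailOp G R e (cosB R (kap q e))))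

/-- The homogeneous solution, on an edge. -/
def homB (R : ℝ) (q : Par M) (z : End K M → ℂ) (e : Edge K M) : ℝ →ᵇ ℂ :=
  coefP z e • cosB R (kap q e) + coefQ q.1 z e • sinB R (kap q e)

lemma homB_apply {R : ℝ} (hR : 0 ≤ R) (q : Par M) (z : End K M → ℂ) (e : Edge K M) (x : ℝ) :
    homB R q z e x = homSol q z e (clip R x) := by
  change coefP z e * cosB R _ x + coefQ q.1 z e * sinB R _ x = _
  rw [cosB_apply, sinB_apply hR]; rfl

lemma kerOp_add_homB_apply {R : ℝ} (hR : 0 ≤ R) (q : Par M) (z : End K M → ℂ) (f : G.L2)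
    (e : Edge K M) (x : ℝ) :
    (kerOp G R q e f + homB R q z e) x = outSol q z (extend R f) R e (clip R x) := by
  change -mass q e * (cosB R _ x * tailOp G R e _ f x - sinB R _ x * tailOp G R e _ f x) +
    homB R q z e x = _
  rw [tailOp_sinB hR, tailOp_cosB hR, homB_apply hR, cosB_apply, sinB_apply hR]
  simp only [outSol, sol, homSol]; ring

/-! ### The explicit formula for the cut-off resolvent -/

lemma Cutoff.memLp_two (χ : Cutoff K M) (e : Edge K M) (s : Set ℝ) :
    MemLp (χ.toFun e) 2 (volume.restrict s) :=
  ((χ.smooth e).continuous.memLp_of_hasCompactSupport (χ.compact e)).restrict s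

/-- The functions on the edges as an element of `L²`, cut off by `χ`. -/
def cutB (G : MetricGraph J K M) (χ : Cutoff K M) :
    (Edge K M → ℝ →ᵇ ℂ) →L[ℂ] G.L2 :=
  (PiLp.continuousLinearEquiv 2 ℂ
    (fun e : Edge K M => Lp ℂ 2 (volume.restrict (G.ival e)))).symm.toContinuousLinearMap ∘L
    ContinuousLinearMap.piMap fun e => weightB (χ.memLp_two e (G.ival e))

lemma cutB_apply (χ : Cutoff K M) (φ : Edge K M → ℝ →ᵇ ℂ) (e : Edge K M) :
    cutB G χ φ e =ᵐ[volume.restrict (G.ival e)] fun x => χ.toFun e x * φ e x :=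
  weightB_apply (χ.memLp_two e (G.ival e)) (φ e)

/-- Values at the ends of the particular solution, as functionals of the source. -/
def srcValOp (G : MetricGraph J K M) (R : ℝ) (q : Par M) : End K M → G.L2 →L[ℂ] ℂ :=
  Sum.elim (fun e => -(Complex.exp (scaleC q.2 e / 2) * mass q e) •
    (BoundedContinuousFunction.evalCLM ℂ (0 : ℝ)).comp (tailOp G R e (sinB R (kap q e))))
    (fun _ => 0)

/-- Fluxes at the ends of the particular solution, as functionals of the source. -/
def srcFluxOp (G : MetricGraph J K M) (R : ℝ) (q : Par M) : End K M → G.L2 →L[ℂ] ℂ :=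
  Sum.elim (fun e => -(Complex.exp (3 * scaleC q.2 e / 2) * mass q e) •
    (BoundedContinuousFunction.evalCLM ℂ (0 : ℝ)).comp (tailOp G R e (cosB R (kap q e))))
    (fun _ => 0)

/-- The vertex conditions of the particular solution, as functionals of the source. -/
def srcOp (G : MetricGraph J K M) (R : ℝ) (q : Par M) (i : End K M) : G.L2 →L[ℂ] ℂ :=
  srcValOp G R q i - ((G.nbrs i).card : ℂ)⁻¹ • ∑ j ∈ G.nbrs i, srcValOp G R q j +
    ∑ j ∈ G.nbrs i, srcFluxOp G R q j

lemma srcValOp_apply {R : ℝ} (hR : 0 ≤ R) (q : Par M) (f : G.L2) (i : End K M) :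
    srcValOp G R q i f = srcVal q (extend R f) R i := by
  rcases i with e | m
  · change -(_ * _) * tailOp G R e _ f 0 = -(_ * _ * _)
    rw [tailOp_sinB hR, clip_of_mem ⟨le_rfl, hR⟩]; ring
  · rfl

lemma srcFluxOp_apply {R : ℝ} (hR : 0 ≤ R) (q : Par M) (f : G.L2) (i : End K M) :
    srcFluxOp G R q i f = srcFlux q (extend R f) R i := by
  rcases i with e | m
  · change -(_ * _) * tailOp G R e _ f 0 = -(_ * _ * _)
    rw [tailOp_cosB hR, clip_of_mem ⟨le_rfl, hR⟩]; ring
  · rfl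

lemma srcOp_apply {R : ℝ} (hR : 0 ≤ R) (q : Par M) (f : G.L2) (i : End K M) :
    srcOp G R q i f = G.vform (srcVal q (extend R f) R) (srcFlux q (extend R f) R) i := by
  simp only [srcOp, add_apply, sub_apply,
    smul_apply, sum_apply, srcValOp_apply hR,
    srcFluxOp_apply hR, MetricGraph.vform, smul_eq_mul]
  ring

/-- The cut-off particular solution. -/
def cutKer (G : MetricGraph J K M) (χ₁ χ₂ : Cutoff K M) (R : ℝ) (q : Par M) : G.L2 →L[ℂ] G.L2 :=
  cutB G χ₁ ∘L ContinuousLinearMap.pi (fun e => kerOp G R q e) ∘L χ₂.mul G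

/-- The cut-off homogeneous solution with coefficients `z`. -/
def cutHom (G : MetricGraph J K M) (χ₁ : Cutoff K M) (R : ℝ) (q : Par M) (z : End K M → ℂ) :
    G.L2 := cutB G χ₁ (homB R q z)

/-- Formula for the cut-off resolvent. -/
def resFormula (G : MetricGraph J K M) (χ₁ χ₂ : Cutoff K M) (R : ℝ) (q : Par M) :
    G.L2 →L[ℂ] G.L2 :=
  cutKer G χ₁ χ₂ R q - ∑ j, ∑ i, (vertexMatrix G q)⁻¹ j i •
    ((srcOp G R q i) ∘L χ₂.mul G).smulRight (cutHom G χ₁ R q (Pi.single j 1))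

lemma homB_sum (R : ℝ) (q : Par M) (z : End K M → ℂ) (e : Edge K M) :
    homB R q z e = ∑ j, z j • homB R q (Pi.single j 1) e := by
  have h1 : coefP z e = ∑ j, z j * coefP (Pi.single j 1) e := by
    simp [coefP, Pi.single_apply]
  have h2 : coefQ q.1 z e = ∑ j, z j * coefQ q.1 (Pi.single j 1) e := by
    cases e <;> simp [coefQ, Pi.single_apply, mul_comm]
  simp only [homB, h1, h2, Finset.sum_smul, smul_add, Finset.sum_add_distrib, smul_smul]

lemma cutHom_sum (χ₁ : Cutoff K M) (R : ℝ) (q : Par M) (z : End K M → ℂ) :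
    cutHom G χ₁ R q z = ∑ j, z j • cutHom G χ₁ R q (Pi.single j 1) := by
  have : homB R q z = ∑ j, z j • homB R q (Pi.single j 1) := by
    ext1 e; rw [homB_sum]; simp
  rw [cutHom, this, map_sum]
  simp [cutHom]

/-- Expanding the coefficients `-D⁻¹ τ(f)` in the standard basis turns the homogeneous part into a
finite sum of rank one operators. This form isolates the entries of `D⁻¹`, the only factors that can
be singular. -/
theorem resFormula_apply (χ₁ χ₂ : Cutoff K M) {R : ℝ} (hR : 0 ≤ R) (q : Par M) (f : G.L2) :
    resFormula G χ₁ χ₂ R q f = cutB G χ₁ fun e => kerOp G R q e (χ₂.mul G f) +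
      homB R q (outCoef G q (extend R (χ₂.mul G f)) R) e := by
  have h1 : (cutB G χ₁ fun e => kerOp G R q e (χ₂.mul G f) +
      homB R q (outCoef G q (extend R (χ₂.mul G f)) R) e) = cutKer G χ₁ χ₂ R q f +
      cutHom G χ₁ R q (outCoef G q (extend R (χ₂.mul G f)) R) := by
    rw [cutHom, cutKer, ContinuousLinearMap.comp_apply, ← map_add]; rfl
  rw [h1, cutHom_sum, resFormula, sub_eq_add_neg, add_apply]
  congr 1
  simp only [neg_apply, sum_apply,
    smul_apply, ContinuousLinearMap.smulRight_apply,
    ContinuousLinearMap.comp_apply, srcOp_apply hR, outCoef, Pi.neg_apply, Matrix.mulVec,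
    dotProduct, ← Finset.sum_neg_distrib, Finset.sum_smul, smul_smul, neg_smul]

lemma Cutoff.exists_radius (χ : Cutoff K M) : ∃ R, ∀ e x, R < x → χ.toFun e x = 0 := by
  have h : ∀ e, ∃ R, ∀ x, R < x → χ.toFun e x = 0 := fun e => by
    obtain ⟨R, hR⟩ := (χ.compact e).isCompact.bddAbove
    exact ⟨R, fun x hx => by_contra fun h0 => not_le.2 hx (hR (subset_tsupport _ h0))⟩
  choose R hR using h
  refine ⟨∑ e, |R e|, fun e x hx => hR e x (lt_of_le_of_lt ?_ hx)⟩
  exact (le_abs_self _).trans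
    (Finset.single_le_sum (f := fun e => |R e|) (fun e _ => abs_nonneg _) (Finset.mem_univ e))

/-- For `Im lam > 0` the cut-off resolvent is given by `resFormula`. -/
theorem exists_isResolvent_resFormula (χ₁ χ₂ : Cutoff K M) {R : ℝ} (hR : G.radius ≤ R)
    (h₁ : ∀ e x, R < x → χ₁.toFun e x = 0) (h₂ : ∀ e x, R < x → χ₂.toFun e x = 0)
    (α : Fin M → ℝ) {lam : ℂ} (hlam : 0 < lam.im) :
    ∃ T : G.L2 →L[ℂ] G.L2, IsResolvent G α lam T ∧
      resFormula G χ₁ χ₂ R (par lam α) = χ₁.mul G ∘L T ∘L χ₂.mul G := by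
  have hR0 := radius_nonneg.trans hR
  obtain ⟨T, hT, hT'⟩ := exists_isResolvent_outSol (G := G) α hlam
  refine ⟨T, hT, ?_⟩
  ext1 f
  rw [resFormula_apply χ₁ χ₂ hR0]
  have hv : ∀ e, ∀ᵐ x ∂(volume.restrict (G.ival e)), R < x → χ₂.mul G f e x = 0 := fun e => by
    filter_upwards [χ₂.mul_apply G f e] with x hx hx'
    rw [hx, h₂ e x hx', zero_mul]
  ext1 e
  refine Lp.ext ?_
  change _ =ᵐ[volume.restrict (G.ival e)] (χ₁.mul G (T (χ₂.mul G f)) e : ℝ → ℂ)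
  filter_upwards [cutB_apply (G := G) χ₁ (fun e => kerOp G R (par lam α) e (χ₂.mul G f) +
      homB R (par lam α) (outCoef G (par lam α) (extend R (χ₂.mul G f)) R) e) e,
    χ₁.mul_apply G (T (χ₂.mul G f)) e, hT' R hR _ hv e,
    ae_restrict_mem (measurableSet_ival G e)] with x a1 a2 a3 a4
  rw [a1, a2, a3]
  -- The clipping is invisible: it is the identity on `[0, R]`, and `χ₁` vanishes beyond `R`.
  rcases le_or_gt x R with hx | hx
  · rw [kerOp_add_homB_apply hR0, clip_of_mem ⟨nonneg_of_mem_ival G a4, hx⟩]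
  · rw [h₁ e x hx, zero_mul, zero_mul]

/-! ### Analytic dependence on the parameters -/

@[fun_prop]
lemma contDiff_scaleC (e : Edge K M) : ContDiff ℂ ω fun q : Par M => scaleC q.2 e := by
  cases e with
  | inl k => exact contDiff_const
  | inr m =>
    change ContDiff ℂ ω fun q : Par M => q.2 m
    fun_prop

@[fun_prop]
lemma contDiff_kap (e : Edge K M) : ContDiff ℂ ω fun q : Par M => kap q e := by
  unfold kap; fun_prop

@[fun_prop]
lemma contDiff_mass (e : Edge K M) : ContDiff ℂ ω fun q : Par M => mass q e := by
  unfold mass; fun_prop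

@[fun_prop]
lemma contDiff_cosB_kap (R : ℝ) (e : Edge K M) : ContDiff ℂ ω fun q : Par M => cosB R (kap q e) :=
  (contDiff_cosB R).comp (contDiff_kap e)

@[fun_prop]
lemma contDiff_sinB_kap (R : ℝ) (e : Edge K M) : ContDiff ℂ ω fun q : Par M => sinB R (kap q e) :=
  (contDiff_sinB R).comp (contDiff_kap e)

lemma contDiff_kerOp (R : ℝ) (e : Edge K M) : ContDiff ℂ ω fun q : Par M => kerOp G R q e := by
  unfold kerOp; fun_prop

@[fun_prop]
lemma contDiff_coefQ (z : End K M → ℂ) (e : Edge K M) :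
    ContDiff ℂ ω fun q : Par M => coefQ q.1 z e := by
  cases e with
  | inl k =>
    change ContDiff ℂ ω fun q : Par M => Complex.I * q.1 * z (Sum.inl (Sum.inl k))
    fun_prop
  | inr m => exact contDiff_const

lemma contDiff_homB (R : ℝ) (z : End K M → ℂ) (e : Edge K M) :
    ContDiff ℂ ω fun q : Par M => homB R q z e := by
  unfold homB; fun_prop

lemma contDiff_srcOp (R : ℝ) (i : End K M) : ContDiff ℂ ω fun q : Par M => srcOp G R q i := by
  have h1 : ∀ j, ContDiff ℂ ω fun q : Par M => srcValOp G R q j := by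
    rintro (e | m)
    · simp only [srcValOp, Sum.elim_inl]; fun_prop
    · exact contDiff_const
  have h2 : ∀ j, ContDiff ℂ ω fun q : Par M => srcFluxOp G R q j := by
    rintro (e | m)
    · simp only [srcFluxOp, Sum.elim_inl]; fun_prop
    · exact contDiff_const
  unfold srcOp; fun_prop

lemma contDiff_cutKer (χ₁ χ₂ : Cutoff K M) (R : ℝ) :
    ContDiff ℂ ω fun q : Par M => cutKer G χ₁ χ₂ R q := by
  have h : ContDiff ℂ ω fun q : Par M => ContinuousLinearMap.pi fun e => kerOp G R q e := by
    -- The tuple is a finite sum of coordinate embeddings composed with its entries, so analyticity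
    -- is checked entry by entry.
    have : (fun q : Par M => ContinuousLinearMap.pi fun e => kerOp G R q e) =
        fun q => ∑ e, (ContinuousLinearMap.single ℂ (fun _ : Edge K M => ℝ →ᵇ ℂ) e).comp
          (kerOp G R q e) := by
      ext1 q; ext1 f; ext1 e
      simp [Pi.single_apply, -Fintype.sum_sum_type]
    rw [this]
    exact ContDiff.sum fun e _ => contDiff_const.clm_comp (contDiff_kerOp R e)
  unfold cutKer
  exact contDiff_const.clm_comp (h.clm_comp contDiff_const)

lemma contDiff_cutHom (χ₁ : Cutoff K M) (R : ℝ) (z : End K M → ℂ) :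
    ContDiff ℂ ω fun q : Par M => cutHom G χ₁ R q z :=
  (cutB G χ₁).contDiff.comp (contDiff_pi.2 fun e => contDiff_homB R z e)

lemma pos_nonneg (i : End K M) : 0 ≤ G.pos i := nonneg_of_mem_ival G (pos_mem_ival i)

lemma vertexMatrix_apply (q : Par M) (i j : End K M) : vertexMatrix G q i j =
    G.vform (endValC G q (homSol q (Pi.single j 1))) (endFluxC G q (homDeriv q (Pi.single j 1))) i :=
  LinearMap.toMatrix'_apply _ _ _

lemma contDiff_snc_kap (e : Edge K M) {x : ℝ} (hx : 0 ≤ x) :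
    ContDiff ℂ ω fun q : Par M => snc (kap q e) x := (contDiff_snc hx).comp (contDiff_kap e)

lemma contDiff_vertexMatrix (i j : End K M) :
    ContDiff ℂ ω fun q : Par M => vertexMatrix G q i j := by
  have h1 : ∀ l, ContDiff ℂ ω fun q : Par M => endValC G q (homSol q (Pi.single j 1)) l := by
    intro l
    have := contDiff_snc_kap (edgeOf l) (pos_nonneg (G := G) l)
    unfold endValC homSol; fun_prop
  have h2 : ∀ l, ContDiff ℂ ω fun q : Par M => endFluxC G q (homDeriv q (Pi.single j 1)) l := by
    intro l
    have := contDiff_snc_kap (edgeOf l) (pos_nonneg (G := G) l)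
    unfold endFluxC homDeriv; fun_prop
  simp only [vertexMatrix_apply, MetricGraph.vform]
  fun_prop

lemma contDiff_det {E ι : Type*} [NormedAddCommGroup E] [NormedSpace ℂ E] [Fintype ι]
    [DecidableEq ι] {A : E → Matrix ι ι ℂ} (h : ∀ i j, ContDiff ℂ ω fun q => A q i j) :
    ContDiff ℂ ω fun q => (A q).det := by
  simp only [Matrix.det_apply]
  exact ContDiff.sum fun σ _ => (contDiff_prod fun i _ => h _ _).const_smul _

lemma contDiff_adjugate {E ι : Type*} [NormedAddCommGroup E] [NormedSpace ℂ E] [Fintype ι]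
    [DecidableEq ι] {A : E → Matrix ι ι ℂ} (h : ∀ i j, ContDiff ℂ ω fun q => A q i j) (i j : ι) :
    ContDiff ℂ ω fun q => (A q).adjugate i j := by
  simp only [Matrix.adjugate_apply]
  refine contDiff_det fun k l => ?_
  by_cases hk : k = j
  · subst hk; simp only [Matrix.updateRow_self]; exact contDiff_const
  · simp only [Matrix.updateRow_ne hk]; exact h k l

lemma inv_apply_eq {ι : Type*} [Fintype ι] [DecidableEq ι] (A : Matrix ι ι ℂ) (i j : ι) :
    A⁻¹ i j = A.det⁻¹ * A.adjugate i j := by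
  rw [Matrix.inv_def, Ring.inverse_eq_inv']; rfl

/-- The determinant of the vertex conditions. -/
def vertexDet (G : MetricGraph J K M) (q : Par M) : ℂ := (vertexMatrix G q).det

lemma contDiff_vertexDet : ContDiff ℂ ω (vertexDet G) := contDiff_det contDiff_vertexMatrix

/-- By Cramer's rule the entries of `D⁻¹` are entire functions divided by `vertexDet`, and every
other factor is entire. -/
lemma contDiffAt_resFormula (χ₁ χ₂ : Cutoff K M) (R : ℝ) {q : Par M} (h : vertexDet G q ≠ 0) :
    ContDiffAt ℂ ω (resFormula G χ₁ χ₂ R) q := by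
  have h1 : ∀ j i, ContDiffAt ℂ ω (fun q : Par M => (vertexMatrix G q)⁻¹ j i) q := by
    intro j i
    simp only [inv_apply_eq]
    exact (contDiff_vertexDet.contDiffAt.inv h).mul
      (contDiff_adjugate contDiff_vertexMatrix j i).contDiffAt
  unfold resFormula
  exact (contDiff_cutKer χ₁ χ₂ R).contDiffAt.sub (ContDiffAt.sum fun j _ => ContDiffAt.sum fun i _ =>
    (h1 j i).smul (((contDiff_srcOp R i).clm_comp contDiff_const).smulRight
      (contDiff_cutHom χ₁ R _)).contDiffAt)

lemma contDiff_par (α : Fin M → ℝ) : ContDiff ℂ ω fun lam => par lam α :=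
  contDiff_id.prodMk contDiff_const

lemma analyticAt_of_contDiff {E F : Type*} [NormedAddCommGroup E] [NormedSpace ℂ E]
    [NormedAddCommGroup F] [NormedSpace ℂ F] {f : E → F} (h : ContDiff ℂ ω f) (x : E) :
    AnalyticAt ℂ f x := contDiff_omega_iff_analyticOnNhd.1 h x trivial

lemma meromorphicAt_resFormula (χ₁ χ₂ : Cutoff K M) (R : ℝ) (α : Fin M → ℝ) (lam : ℂ) :
    MeromorphicAt (fun lam => resFormula G χ₁ χ₂ R (par lam α)) lam := by
  have h1 : ∀ j i, MeromorphicAt (fun lam => (vertexMatrix G (par lam α))⁻¹ j i) lam := by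
    intro j i
    simp only [inv_apply_eq]
    exact (analyticAt_of_contDiff ((contDiff_vertexDet (G := G)).comp
        (contDiff_par α)) lam).meromorphicAt.inv.mul
      (analyticAt_of_contDiff ((contDiff_adjugate contDiff_vertexMatrix j i).comp
        (contDiff_par α)) lam).meromorphicAt
  unfold resFormula
  refine (analyticAt_of_contDiff ((contDiff_cutKer χ₁ χ₂ R).comp (contDiff_par α))
    lam).meromorphicAt.sub ?_
  refine MeromorphicAt.fun_sum fun j _ => MeromorphicAt.fun_sum fun i _ => ?_
  exact (h1 j i).smul (analyticAt_of_contDiff ((((contDiff_srcOp R i).clm_comp contDiff_const).smulRight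
      (contDiff_cutHom χ₁ R _)).comp (contDiff_par α)) lam).meromorphicAt

lemma analyticAt_resFormula (χ₁ χ₂ : Cutoff K M) (R : ℝ) {α : Fin M → ℝ} {lam : ℂ}
    (h : vertexDet G (par lam α) ≠ 0) :
    AnalyticAt ℂ (fun lam => resFormula G χ₁ χ₂ R (par lam α)) lam :=
  ContDiffAt.analyticAt
    (ContDiffAt.comp (g := resFormula G χ₁ χ₂ R) lam (contDiffAt_resFormula χ₁ χ₂ R h)
      (contDiff_par α).contDiffAt)

/-! ### Meromorphic continuation of the cut-off resolvent -/

lemma Cutoff.exists_radius₂ (G : MetricGraph J K M) (χ₁ χ₂ : Cutoff K M) :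
    ∃ R, G.radius ≤ R ∧ (∀ e x, R < x → χ₁.toFun e x = 0) ∧ ∀ e x, R < x → χ₂.toFun e x = 0 := by
  obtain ⟨R₁, h₁⟩ := χ₁.exists_radius
  obtain ⟨R₂, h₂⟩ := χ₂.exists_radius
  exact ⟨max G.radius (max R₁ R₂), le_max_left _ _,
    fun e x hx => h₁ e x (((le_max_left _ _).trans (le_max_right _ _)).trans_lt hx),
    fun e x hx => h₂ e x (((le_max_right _ _).trans (le_max_right _ _)).trans_lt hx)⟩

/-- The cut-off resolvents continue meromorphically. -/
theorem isContinuedResolvent_cutoffResolvent (α : Fin M → ℝ) (χ₁ χ₂ : Cutoff K M) :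
    IsContinuedResolvent G α χ₁ χ₂ (cutoffResolvent G α χ₁ χ₂) := by
  have hex : ∃ F, IsContinuedResolvent G α χ₁ χ₂ F := by
    obtain ⟨R, hR, h₁, h₂⟩ := Cutoff.exists_radius₂ G χ₁ χ₂
    have hm : MeromorphicOn (fun lam => resFormula G χ₁ χ₂ R (par lam α)) univ :=
      fun lam _ => meromorphicAt_resFormula χ₁ χ₂ R α lam
    refine ⟨toMeromorphicNFOn (fun lam => resFormula G χ₁ χ₂ R (par lam α)) univ,
      meromorphicNFOn_toMeromorphicNFOn _ _, fun lam hlam => ?_⟩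
    obtain ⟨T, hT, hT'⟩ := exists_isResolvent_resFormula χ₁ χ₂ hR h₁ h₂ α hlam
    refine ⟨T, hT, ?_⟩
    -- Passing to the normal form changes no value where the formula is analytic, in particular none
    -- in the upper half-plane.
    rw [toMeromorphicNFOn_eq_toMeromorphicNFAt hm (mem_univ lam), toMeromorphicNFAt_eq_self.2
      (analyticAt_resFormula χ₁ χ₂ R (det_vertexMatrix_ne_zero hlam α)).meromorphicNFAt]
    exact hT'
  rw [cutoffResolvent, dif_pos hex]
  exact hex.choose_spec

/-- The continued cut-off resolvent is given by `resFormula`. -/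
theorem cutoffResolvent_eq {α : Fin M → ℝ} {χ₁ χ₂ : Cutoff K M} {R : ℝ} (hR : G.radius ≤ R)
    (h₁ : ∀ e x, R < x → χ₁.toFun e x = 0) (h₂ : ∀ e x, R < x → χ₂.toFun e x = 0) {lam : ℂ}
    (h : vertexDet G (par lam α) ≠ 0) :
    cutoffResolvent G α χ₁ χ₂ lam = resFormula G χ₁ χ₂ R (par lam α) := by
  obtain ⟨hN, hF⟩ := isContinuedResolvent_cutoffResolvent (G := G) α χ₁ χ₂
  set F := cutoffResolvent G α χ₁ χ₂
  set F₀ := fun lam => resFormula G χ₁ χ₂ R (par lam α)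
  have heq : ∀ lam : ℂ, 0 < lam.im → F lam = F₀ lam := by
    intro lam hlam
    obtain ⟨T, hT, hT'⟩ := exists_isResolvent_resFormula χ₁ χ₂ hR h₁ h₂ α hlam
    obtain ⟨S, hS, hS'⟩ := hF lam hlam
    rw [hS', hS.unique hT]; exact hT'.symm
  have hmer : MeromorphicOn (F - F₀) univ := fun x _ =>
    (hN (mem_univ x)).meromorphicAt.sub (meromorphicAt_resFormula χ₁ χ₂ R α x)
  -- Identity theorem in terms of orders: the difference vanishes near `i`, so it has infinite order
  -- there, and by connectedness of the plane everywhere.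
  have htop : meromorphicOrderAt (F - F₀) Complex.I = ⊤ := by
    rw [meromorphicOrderAt_eq_top_iff]
    have : {z : ℂ | 0 < z.im} ∈ 𝓝 Complex.I :=
      (isOpen_lt continuous_const Complex.continuous_im).mem_nhds (by simp)
    filter_upwards [mem_nhdsWithin_of_mem_nhds this] with z hz
    rw [Pi.sub_apply, heq z hz, sub_self]
  have htop' : meromorphicOrderAt (F - F₀) lam = ⊤ := by
    by_contra hne
    exact hmer.meromorphicOrderAt_ne_top_of_isPreconnected (U := univ) isPreconnected_univ
      (mem_univ lam) (mem_univ Complex.I) hne htop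
  rw [meromorphicOrderAt_eq_top_iff] at htop'
  have hev : F =ᶠ[𝓝[≠] lam] F₀ := by
    filter_upwards [htop'] with z hz using sub_eq_zero.1 hz
  -- Agreement on a punctured neighbourhood extends to the point itself because both functions are
  -- in normal form there; the formula is even analytic.
  exact (((hN (mem_univ lam)).eventuallyEq_nhdsNE_iff_eventuallyEq_nhds
    (analyticAt_resFormula χ₁ χ₂ R h).meromorphicNFAt).1 hev).self_of_nhds

/-! ### Simple poles of matrix inverses -/

section Pole
variable {ι H : Type*} [Fintype ι] [DecidableEq ι] [NormedAddCommGroup H] [NormedSpace ℂ H]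

lemma tendsto_matrix_inv {l : Filter ℂ} {Q : ℂ → Matrix ι ι ℂ} (h : Tendsto Q l (𝓝 1)) :
    Tendsto (fun z => (Q z)⁻¹) l (𝓝 1) ∧ ∀ᶠ z in l, (Q z).det ≠ 0 := by
  have hc : Continuous fun A : Matrix ι ι ℂ => A.det := continuous_id.matrix_det
  have hd : Tendsto (fun z => (Q z).det) l (𝓝 1) := by
    have := (hc.tendsto 1).comp h
    rwa [Matrix.det_one] at this
  have ha : Tendsto (fun z => (Q z).adjugate) l (𝓝 1) := by
    have hca : Continuous fun A : Matrix ι ι ℂ => A.adjugate := continuous_id.matrix_adjugate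
    have := hca.tendsto 1
    rw [Matrix.adjugate_one] at this
    exact this.comp h
  refine ⟨?_, hd.eventually_ne one_ne_zero⟩
  have := (hd.inv₀ one_ne_zero).smul ha
  rw [inv_one, one_smul] at this
  refine this.congr fun z => ?_
  rw [Matrix.inv_def, Ring.inverse_eq_inv']

lemma tendsto_clm_apply {α E F : Type*} [NormedAddCommGroup E] [NormedSpace ℂ E]
    [NormedAddCommGroup F] [NormedSpace ℂ F] {l : Filter α} {T : α → E →L[ℂ] F} {S : E →L[ℂ] F}
    (h : Tendsto T l (𝓝 S)) (f : E) : Tendsto (fun z => T z f) l (𝓝 (S f)) :=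
  ((ContinuousLinearMap.apply ℂ F f).continuous.tendsto S).comp h

omit [DecidableEq ι] in
lemma tendsto_mulVec {l : Filter ℂ} {Q : ℂ → Matrix ι ι ℂ} {A : Matrix ι ι ℂ} {v : ℂ → ι → ℂ}
    {w : ι → ℂ} (h : Tendsto Q l (𝓝 A)) (hv : Tendsto v l (𝓝 w)) :
    Tendsto (fun z => (Q z).mulVec (v z)) l (𝓝 (A.mulVec w)) := by
  refine tendsto_pi_nhds.2 fun i => tendsto_finsetSum _ fun j _ => ?_
  exact (tendsto_pi_nhds.1 (tendsto_pi_nhds.1 h i) j).mul (tendsto_pi_nhds.1 hv j)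

/-- If `K - H D⁻¹ τ` has a pole of order at most one, with residue `A`, and `H` is injective and
`(τ, D)` is onto, then `D⁻¹` has a pole of order at most one, and the range of the residue of `D⁻¹`
is controlled by the range of `A`. -/
theorem exists_residue_inv {D : ℂ → Matrix ι ι ℂ} {k F : ℂ → H →L[ℂ] H} {τ : ℂ → ι → H →L[ℂ] ℂ}
    {h : ℂ → ι → H} {z₀ : ℂ} {A : H →L[ℂ] H} (hD : ContinuousAt D z₀) (hk : ContinuousAt k z₀)
    (hτ : ∀ i, ContinuousAt (fun z => τ z i) z₀) (hh : ∀ j, ContinuousAt (fun z => h z j) z₀)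
    (hdet : ∀ᶠ z in 𝓝[≠] z₀, (D z).det ≠ 0)
    (hF : ∀ᶠ z in 𝓝[≠] z₀, F z = k z - ∑ j, ∑ i, (D z)⁻¹ j i • (τ z i).smulRight (h z j))
    (hA : Tendsto (fun z => (z - z₀) • F z) (𝓝[≠] z₀) (𝓝 A))
    (hinj : ∀ v : ι → ℂ, ∑ j, v j • h z₀ j = 0 → v = 0)
    (hsurj : ∀ g : ι → ℂ, ∃ (f : H) (y : ι → ℂ), (fun i => τ z₀ i f) + (D z₀).mulVec y = g) :
    ∃ (N : Matrix ι ι ℂ) (Ψ : H →L[ℂ] (ι → ℂ)),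
      Tendsto (fun z => (z - z₀) • (D z)⁻¹) (𝓝[≠] z₀) (𝓝 N) ∧
      ∀ v, ∃ f, N.mulVec v = Ψ (A f) := by
  have hle : 𝓝[≠] z₀ ≤ 𝓝 z₀ := nhdsWithin_le_nhds
  have hz : Tendsto (fun z => z - z₀) (𝓝[≠] z₀) (𝓝 0) := by
    have : Tendsto (fun z => z - z₀) (𝓝 z₀) (𝓝 (z₀ - z₀)) := tendsto_id.sub_const z₀
    rw [sub_self] at this
    exact this.mono_left hle
  set L : (ι → ℂ) →L[ℂ] H := LinearMap.toContinuousLinearMap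
    (∑ j, (LinearMap.proj j : (ι → ℂ) →ₗ[ℂ] ℂ).smulRight (h z₀ j))
  have hL : ∀ v, L v = ∑ j, v j • h z₀ j := fun v => by simp [L]
  have hLinj : Function.Injective L := by
    rw [injective_iff_map_eq_zero]
    intro v hv
    exact hinj v (by rw [← hL, hv])
  -- The range of `L` is finite-dimensional, hence closed and complemented, so the injective map `L`
  -- has a continuous left inverse.
  obtain ⟨Ψ, hΨ⟩ : ∃ Ψ : H →L[ℂ] (ι → ℂ), ∀ v, Ψ (L v) = v := by
    let eL := LinearEquiv.ofInjective (L : (ι → ℂ) →ₗ[ℂ] H) hLinj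
    obtain ⟨π, hπ⟩ := Submodule.ClosedComplemented.of_finiteDimensional (𝕜 := ℂ)
      (LinearMap.range (L : (ι → ℂ) →ₗ[ℂ] H))
    refine ⟨(LinearMap.toContinuousLinearMap (eL.symm : _ →ₗ[ℂ] (ι → ℂ))).comp π, fun v => ?_⟩
    have h1 : π (L v) = eL v := hπ (eL v)
    change eL.symm (π (L v)) = v
    rw [h1, eL.symm_apply_apply]
  -- `Ψ` inverts the family of the `h z j` only at `z₀`. For nearby `z` the product `P z` is close
  -- to `1`, and its inverse corrects the difference.
  set P : ℂ → Matrix ι ι ℂ := fun z => Matrix.of fun i j => Ψ (h z j) i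
  have hP : Tendsto P (𝓝[≠] z₀) (𝓝 1) := by
    have h1 : P z₀ = 1 := by
      ext i j
      change Ψ (h z₀ j) i = _
      have : h z₀ j = L (Pi.single j 1) := by rw [hL]; simp [Pi.single_apply]
      rw [this, hΨ, Pi.single_apply, Matrix.one_apply]
    rw [← h1]
    refine tendsto_pi_nhds.2 fun i => tendsto_pi_nhds.2 fun j => ?_
    exact ((continuous_apply i).tendsto _).comp ((Ψ.continuous.tendsto _).comp
      ((hh j).tendsto.mono_left hle))
  have hPmul : ∀ z (v : ι → ℂ), (P z).mulVec v = Ψ (∑ j, v j • h z j) := by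
    intro z v
    ext i
    simp [P, Matrix.mulVec, dotProduct, mul_comm]
  obtain ⟨hP1, hP2⟩ := tendsto_matrix_inv hP
  -- With `h` stripped off on the left, `(z - z₀) D⁻¹ τ f` is seen to converge. The regular part `k`
  -- disappears because of the factor `z - z₀`.
  have hy : ∀ f : H, Tendsto (fun z => (z - z₀) • (D z)⁻¹.mulVec fun i => τ z i f) (𝓝[≠] z₀)
      (𝓝 (-Ψ (A f))) := by
    intro f
    have h1 : Tendsto (fun z => Ψ ((z - z₀) • k z f - ((z - z₀) • F z) f)) (𝓝[≠] z₀)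
        (𝓝 (-Ψ (A f))) := by
      have hkf : Tendsto (fun z => k z f) (𝓝[≠] z₀) (𝓝 (k z₀ f)) :=
        tendsto_clm_apply (hk.tendsto.mono_left hle) f
      have hAf : Tendsto (fun z => ((z - z₀) • F z) f) (𝓝[≠] z₀) (𝓝 (A f)) :=
        tendsto_clm_apply hA f
      have := (Ψ.continuous.tendsto _).comp ((hz.smul hkf).sub hAf)
      rwa [zero_smul, zero_sub, map_neg] at this
    have h2 := tendsto_mulVec hP1 h1
    rw [Matrix.one_mulVec] at h2
    refine h2.congr' ?_
    filter_upwards [hF, hP2] with z hz1 hz2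
    have h3 : (z - z₀) • k z f - ((z - z₀) • F z) f =
        ∑ j, ((z - z₀) • (D z)⁻¹.mulVec fun i => τ z i f) j • h z j := by
      rw [smul_apply, hz1, sub_apply, smul_sub, sub_sub_cancel, sum_apply, Finset.smul_sum]
      refine Finset.sum_congr rfl fun j _ => ?_
      simp only [sum_apply, smul_apply, ContinuousLinearMap.smulRight_apply, Pi.smul_apply,
        Matrix.mulVec, dotProduct, smul_eq_mul, ← Finset.sum_smul, smul_smul]
    rw [h3, ← hPmul, Matrix.mulVec_mulVec, Matrix.nonsing_inv_mul _ (isUnit_iff_ne_zero.2 hz2),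
      Matrix.one_mulVec]
  choose f y hfy using hsurj
  -- Each basis vector is `τ f + D y` at `z₀`. For nearby `z` these combinations still form an
  -- invertible matrix `Q`, and `D⁻¹` acts well on its columns: `D⁻¹ τ f` is under control, and `D⁻¹
  -- D y = y` is killed by the factor `z - z₀`. So `τ` is stripped off on the right.
  set Q : ℂ → Matrix ι ι ℂ := fun z => Matrix.of fun i j =>
    τ z i (f (Pi.single j 1)) + (D z).mulVec (y (Pi.single j 1)) i
  have hQcol : ∀ z j, (Q z).mulVec (Pi.single j 1) =
      (fun i => τ z i (f (Pi.single j 1))) + (D z).mulVec (y (Pi.single j 1)) := by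
    intro z j; ext i; simp [Q]
  have hQ : Tendsto Q (𝓝[≠] z₀) (𝓝 1) := by
    have h1 : Q z₀ = 1 := by
      ext i j
      have := congrFun (hfy (Pi.single j 1)) i
      rw [Pi.single_apply] at this
      rw [Matrix.one_apply]
      exact this
    rw [← h1]
    refine tendsto_pi_nhds.2 fun i => tendsto_pi_nhds.2 fun j => ?_
    exact (tendsto_clm_apply ((hτ i).tendsto.mono_left hle) _).add
      (((continuous_apply i).tendsto _).comp
        (tendsto_mulVec (hD.tendsto.mono_left hle) tendsto_const_nhds))
  obtain ⟨hQ1, hQ2⟩ := tendsto_matrix_inv hQ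
  set N : Matrix ι ι ℂ := Matrix.of fun i j => (-Ψ (A (f (Pi.single j 1)))) i
  have hXQ : Tendsto (fun z => ((z - z₀) • (D z)⁻¹) * Q z) (𝓝[≠] z₀) (𝓝 N) := by
    refine tendsto_pi_nhds.2 fun i => tendsto_pi_nhds.2 fun j => ?_
    have h1 := (hy (f (Pi.single j 1))).add (hz.smul_const (y (Pi.single j 1)))
    rw [zero_smul, add_zero] at h1
    refine (((continuous_apply i).tendsto _).comp h1).congr' ?_
    filter_upwards [hdet] with z hz1
    have h2 : (((z - z₀) • (D z)⁻¹) * Q z).mulVec (Pi.single j 1) =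
        ((z - z₀) • (D z)⁻¹.mulVec fun i => τ z i (f (Pi.single j 1))) +
        (z - z₀) • y (Pi.single j 1) := by
      rw [← Matrix.mulVec_mulVec, hQcol, Matrix.mulVec_add, Matrix.smul_mulVec,
        Matrix.smul_mulVec, Matrix.mulVec_mulVec,
        Matrix.nonsing_inv_mul _ (isUnit_iff_ne_zero.2 hz1), Matrix.one_mulVec]
    have h3 := congrFun h2 i
    simp only [Matrix.mulVec_single_one] at h3
    exact h3.symm
  refine ⟨N, Ψ, ?_, fun v => ⟨-∑ j, v j • f (Pi.single j 1), ?_⟩⟩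
  · have := hXQ.mul hQ1
    rw [mul_one] at this
    refine this.congr' ?_
    filter_upwards [hQ2] with z hz1
    rw [Matrix.mul_assoc, Matrix.mul_nonsing_inv _ (isUnit_iff_ne_zero.2 hz1), mul_one]
  · ext i
    simp [N, Matrix.mulVec, dotProduct, mul_comm]

/-- The residue of `D⁻¹` annihilates the range of `D`, and inverts `D'` on the kernel of `D`. -/
lemma residue_mulVec {D : ℂ → Matrix ι ι ℂ} {D' N : Matrix ι ι ℂ} {z₀ : ℂ}
    (hD : ∀ i j, HasDerivAt (fun z => D z i j) (D' i j) z₀)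
    (hdet : ∀ᶠ z in 𝓝[≠] z₀, (D z).det ≠ 0)
    (hN : Tendsto (fun z => (z - z₀) • (D z)⁻¹) (𝓝[≠] z₀) (𝓝 N)) :
    (∀ v, N.mulVec ((D z₀).mulVec v) = 0) ∧
      ∀ v, (D z₀).mulVec v = 0 → N.mulVec (D'.mulVec v) = v := by
  have hle : 𝓝[≠] z₀ ≤ 𝓝 z₀ := nhdsWithin_le_nhds
  have hDv : ∀ v, HasDerivAt (fun z => (D z).mulVec v) (D'.mulVec v) z₀ := fun v =>
    hasDerivAt_pi.2 fun i => by
      simp only [Matrix.mulVec, dotProduct]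
      exact HasDerivAt.fun_sum fun j _ => (hD i j).mul_const _
  refine ⟨fun v => ?_, fun v hv => ?_⟩
  · have h1 := tendsto_mulVec hN ((hDv v).continuousAt.tendsto.mono_left hle)
    have h2 : Tendsto (fun z => (z - z₀) • v) (𝓝[≠] z₀) (𝓝 0) := by
      have : Tendsto (fun z => (z - z₀) • v) (𝓝 z₀) (𝓝 ((z₀ - z₀) • v)) :=
        (tendsto_id.sub_const z₀).smul_const v
      rw [sub_self, zero_smul] at this
      exact this.mono_left hle
    refine tendsto_nhds_unique (h1.congr' ?_) h2
    filter_upwards [hdet] with z hz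
    rw [Matrix.smul_mulVec, Matrix.mulVec_mulVec,
      Matrix.nonsing_inv_mul _ (isUnit_iff_ne_zero.2 hz), Matrix.one_mulVec]
  · have h1 := tendsto_mulVec hN (hDv v).tendsto_slope
    refine tendsto_nhds_unique (h1.congr' ?_) tendsto_const_nhds
    filter_upwards [hdet, self_mem_nhdsWithin] with z hz hz'
    have hz0 : z - z₀ ≠ 0 := sub_ne_zero.2 hz'
    rw [slope_def_module, hv, sub_zero, Matrix.smul_mulVec, Matrix.mulVec_smul, smul_smul,
      mul_inv_cancel₀ hz0, one_smul, Matrix.mulVec_mulVec,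
      Matrix.nonsing_inv_mul _ (isUnit_iff_ne_zero.2 hz), Matrix.one_mulVec]

end Pole

/-! ### Resonances are the zeros of the determinant of the vertex conditions -/

lemma exists_cutoff_eq_one (G : MetricGraph J K M) :
    ∃ χ : Cutoff K M, ∀ e, ∀ x ∈ Icc 0 (G.radius + 1), χ.toFun e x = 1 := by
  have hR := radius_nonneg (G := G)
  let b : ContDiffBump (0 : ℝ) := ⟨G.radius + 1, G.radius + 2, by linarith, by linarith⟩
  refine ⟨⟨fun _ x => (b x : ℂ), fun _ => Complex.ofRealCLM.contDiff.comp b.contDiff, fun _ =>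
    b.hasCompactSupport.comp_left (g := fun x : ℝ => (x : ℂ)) Complex.ofReal_zero⟩, fun e x hx => ?_⟩
  have : b x = 1 := b.one_of_mem_closedBall (by
    rw [mem_closedBall_zero_iff, Real.norm_eq_abs, abs_of_nonneg hx.1]; exact hx.2)
  change (b x : ℂ) = 1
  rw [this, Complex.ofReal_one]

lemma exists_Icc_subset_ival_le (G : MetricGraph J K M) (e : Edge K M) :
    ∃ b : ℝ, 0 < b ∧ b ≤ G.radius + 1 ∧ Icc 0 b ⊆ G.ival e := by
  have hR := radius_nonneg (G := G)
  obtain ⟨b, hb, hsub⟩ := exists_Icc_subset_ival (G := G) e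
  exact ⟨min b (G.radius + 1), lt_min hb (by linarith), min_le_right _ _,
    (Icc_subset_Icc_right (min_le_left _ _)).trans hsub⟩

lemma eq_zero_of_cutHom_eq_zero {χ : Cutoff K M}
    (hχ : ∀ e, ∀ x ∈ Icc 0 (G.radius + 1), χ.toFun e x = 1) {R : ℝ} (hR : G.radius + 1 ≤ R)
    {q : Par M} {z : End K M → ℂ} (h : cutHom G χ R q z = 0) : z = 0 := by
  have hR0 : 0 ≤ R := (by linarith [radius_nonneg (G := G)])
  refine eq_zero_of_homSol_ae_zero (q := q) fun e => ?_
  obtain ⟨b, hb, hb1, hsub⟩ := exists_Icc_subset_ival_le G e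
  refine ⟨b, hb, ?_⟩
  have h1 := cutB_apply (G := G) χ (homB R q z) e
  rw [show cutB G χ (homB R q z) = 0 from h] at h1
  have h2 := ae_restrict_of_ae_restrict_of_subset hsub h1
  have h3 := ae_restrict_of_ae_restrict_of_subset hsub
    (Lp.coeFn_zero ℂ 2 (volume.restrict (G.ival e)))
  filter_upwards [h2, h3, ae_restrict_mem measurableSet_Icc] with x a1 a2 a3
  rw [homB_apply hR0, hχ e x ⟨a3.1, a3.2.trans hb1⟩, one_mul,
    clip_of_mem ⟨a3.1, a3.2.trans (hb1.trans hR)⟩] at a1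
  rw [← a1]; exact a2

/-- Duality: if the moments against `snc` and `cos` did not fill the space, a nonzero functional
would vanish on all of them. Its coefficients on an edge define a combination `g` of the two
functions; testing with the source `conj g` on a short initial piece, where `χ = 1`, gives `∑ ∫ ‖g‖²
= 0`. So `g` vanishes there, and with it the functional. -/
lemma exists_source {χ : Cutoff K M}
    (hχ : ∀ e, ∀ x ∈ Icc 0 (G.radius + 1), χ.toFun e x = 1) {R : ℝ} (hR : G.radius + 1 ≤ R)
    (κ : Edge K M → ℂ) (S C : Edge K M → ℂ) :
    ∃ f : G.L2, ∀ e, tailOp G R e (sinB R (κ e)) (χ.mul G f) 0 = S e ∧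
      tailOp G R e (cosB R (κ e)) (χ.mul G f) 0 = C e := by
  have hR0 : 0 ≤ R := (by linarith [radius_nonneg (G := G)])
  set Φ : G.L2 →ₗ[ℂ] (Edge K M → ℂ × ℂ) :=
    LinearMap.pi fun e => LinearMap.prod
      ((BoundedContinuousFunction.evalCLM ℂ (0 : ℝ)).comp
        ((tailOp G R e (sinB R (κ e))).comp (χ.mul G)) : G.L2 →ₗ[ℂ] ℂ)
      ((BoundedContinuousFunction.evalCLM ℂ (0 : ℝ)).comp
        ((tailOp G R e (cosB R (κ e))).comp (χ.mul G)) : G.L2 →ₗ[ℂ] ℂ) with hΦ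
  suffices hs : LinearMap.range Φ = ⊤ by
    obtain ⟨f, hf⟩ := LinearMap.range_eq_top.1 hs fun e => (S e, C e)
    exact ⟨f, fun e => Prod.ext_iff.1 (congrFun hf e)⟩
  by_contra hne
  obtain ⟨ψ, hψ0, hψ⟩ := Submodule.exists_le_ker_of_lt_top _ (lt_top_iff_ne_top.2 hne)
  set a : Edge K M → ℂ := fun e => ψ (Pi.single e (1, 0))
  set b : Edge K M → ℂ := fun e => ψ (Pi.single e (0, 1))
  have hψf : ∀ w : Edge K M → ℂ × ℂ, ψ w = ∑ e, (a e * (w e).1 + b e * (w e).2) := by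
    intro w
    have : w = ∑ e, ((w e).1 • Pi.single (M := fun _ : Edge K M => ℂ × ℂ) e ((1 : ℂ), (0 : ℂ)) +
        (w e).2 • Pi.single (M := fun _ : Edge K M => ℂ × ℂ) e ((0 : ℂ), (1 : ℂ))) := by
      ext1 e
      rw [Finset.sum_apply, Finset.sum_eq_single e]
      · simp
      · intro e' _ he'
        simp [Pi.single_eq_of_ne he'.symm]
      · simp
    conv_lhs => rw [this]
    simp [map_sum, a, b, mul_comm, -Fintype.sum_sum_type]
  choose r hr hr1 hsub using exists_Icc_subset_ival_le G
  set g : Edge K M → ℝ → ℂ := fun e x =>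
    b e * Complex.cos (κ e * x) + a e * snc (κ e) x with hg
  have hgc : ∀ e, Continuous (g e) := fun e => by simp only [hg]; fun_prop
  have hm : ∀ e, MemLp ((Icc 0 (r e)).indicator fun x => conj (g e x)) 2
      (volume.restrict (G.ival e)) := fun e => by
    refine (memLp_indicator_iff_restrict measurableSet_Icc).2 ?_
    rw [Measure.restrict_restrict measurableSet_Icc, inter_eq_left.2 (hsub e)]
    have hc : Continuous fun x => conj (g e x) := Complex.continuous_conj.comp (hgc e)
    obtain ⟨B, hB⟩ := isCompact_Icc.exists_bound_of_continuousOn (s := Icc 0 (r e)) hc.continuousOn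
    refine MemLp.of_bound hc.aestronglyMeasurable B ?_
    filter_upwards [ae_restrict_mem measurableSet_Icc] with x hx using hB x hx
  set f : G.L2 := WithLp.toLp 2 fun e => (hm e).toLp _ with hf
  have hext : ∀ e, extend R (χ.mul G f) e =ᵐ[volume]
      (Icc 0 (r e)).indicator fun x => conj (g e x) := fun e => by
    have h1 := (ae_restrict_iff' (measurableSet_ival G e)).1 (χ.mul_apply G f e)
    have h2 := (ae_restrict_iff' (measurableSet_ival G e)).1 (hm e).coeFn_toLp
    filter_upwards [h1, h2] with x a1 a2
    by_cases hx : x ∈ Icc 0 (r e)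
    · have hx1 := hsub e hx
      rw [extend, indicator_of_mem (show x ∈ G.ival e ∩ Iic R from
        ⟨hx1, hx.2.trans ((hr1 e).trans hR)⟩), a1 hx1, hχ e x ⟨hx.1, hx.2.trans (hr1 e)⟩, one_mul]
      exact a2 hx1
    · by_cases hx' : x ∈ G.ival e ∩ Iic R
      · rw [extend, indicator_of_mem hx', a1 hx'.1]
        have := a2 hx'.1
        rw [indicator_of_notMem hx] at this ⊢
        change χ.toFun e x * ((hm e).toLp _ : ℝ → ℂ) x = 0
        rw [this, mul_zero]
      · rw [extend, indicator_of_notMem hx', indicator_of_notMem hx]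
  have htail : ∀ (φ : ℝ → ℂ) (e : Edge K M), tail φ (extend R (χ.mul G f) e) R 0 =
      ∫ y in Icc 0 (r e), φ y * conj (g e y) := by
    intro φ e
    rw [tail, intervalIntegral.integral_of_le hR0, ← integral_Icc_eq_integral_Ioc,
      ← integral_indicator measurableSet_Icc, ← integral_indicator measurableSet_Icc]
    refine integral_congr_ae ?_
    filter_upwards [hext e] with x hx
    by_cases hx' : x ∈ Icc 0 (r e)
    · rw [indicator_of_mem hx', indicator_of_mem (show x ∈ Icc 0 R from
        ⟨hx'.1, hx'.2.trans ((hr1 e).trans hR)⟩), hx, indicator_of_mem hx']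
    · rw [indicator_of_notMem hx']
      rw [indicator_of_notMem hx'] at hx
      by_cases hx2 : x ∈ Icc 0 R
      · rw [indicator_of_mem hx2, hx, mul_zero]
      · rw [indicator_of_notMem hx2]
  have hint : ∀ (φ : ℝ → ℂ) (e : Edge K M), Continuous φ →
      IntegrableOn (fun y => φ y * conj (g e y)) (Icc 0 (r e)) := fun φ e hφ =>
    (hφ.mul (Complex.continuous_conj.comp (hgc e))).integrableOn_Icc
  have hz : ψ (Φ f) = 0 := hψ (LinearMap.mem_range_self Φ f)
  have hsum : ∑ e, ((∫ y in Icc 0 (r e), ‖g e y‖ ^ 2 : ℝ) : ℂ) = 0 := by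
    rw [← hz, hψf]
    refine Finset.sum_congr rfl fun e _ => ?_
    change _ = a e * tailOp G R e (sinB R (κ e)) (χ.mul G f) 0 +
      b e * tailOp G R e (cosB R (κ e)) (χ.mul G f) 0
    rw [tailOp_sinB hR0, tailOp_cosB hR0, clip_of_mem ⟨le_rfl, hR0⟩, htail, htail,
      ← integral_const_mul, ← integral_const_mul, ← integral_add
        ((hint _ e (continuous_snc _)).const_mul _) ((hint _ e (continuous_cos_mul _)).const_mul _),
      ← integral_complex_ofReal]
    refine integral_congr_ae (Eventually.of_forall fun y => ?_)
    change ((‖g e y‖ ^ 2 : ℝ) : ℂ) = _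
    rw [Complex.ofReal_pow, ← Complex.mul_conj']
    simp only [hg]; ring
  have hsum' : ∑ e, (∫ y in Icc 0 (r e), ‖g e y‖ ^ 2) = 0 := by exact_mod_cast hsum
  have hab : ∀ e, b e = 0 ∧ a e = 0 := by
    intro e
    have h0 := (Finset.sum_eq_zero_iff_of_nonneg fun e _ =>
      integral_nonneg fun y => by positivity).1 hsum' e (Finset.mem_univ e)
    have h1 := (integral_eq_zero_iff_of_nonneg (fun y => sq_nonneg ‖g e y‖)
      ((hgc e).norm.pow 2).integrableOn_Icc).1 h0
    refine coef_eq_zero_of_comb (hr e) (κ := κ e) ?_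
    filter_upwards [h1] with x hx
    have : ‖g e x‖ ^ 2 = 0 := hx
    exact norm_eq_zero.1 (pow_eq_zero_iff two_ne_zero |>.1 this)
  refine hψ0 (LinearMap.ext fun w => ?_)
  rw [hψf]
  simp [(hab _).1, (hab _).2, -Fintype.sum_sum_type]

/-- With `g` itself as values, the form loses the mean of `g` at each vertex. Equal fluxes at the
ends of that vertex, with sum this mean, restore it. -/
lemma vform_surjective (g : End K M → ℂ) : ∃ val flux, G.vform val flux = g := by
  set av : End K M → ℂ := fun i => (∑ j ∈ G.nbrs i, g j) / (G.nbrs i).card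
  refine ⟨g, fun i => av i / (G.nbrs i).card, ?_⟩
  ext i
  have : ∑ j ∈ G.nbrs i, av j / (G.nbrs j).card = av i := by
    have h1 : ∀ j ∈ G.nbrs i, av j / (G.nbrs j).card = av i / (G.nbrs i).card := fun j hj => by
      have : G.nbrs j = G.nbrs i := nbrs_congr (by simpa [MetricGraph.nbrs] using hj)
      simp only [av, this]
    rw [Finset.sum_congr rfl h1, Finset.sum_const, nsmul_eq_mul,
      mul_div_cancel₀ _ (card_nbrs_ne_zero i)]
  rw [MetricGraph.vform, this]
  simp only [av]; ring

/-- Any values and fluxes at all the ends can be realized. A homogeneous solution on the finite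
edges takes the prescribed data at `x = len m`, where the source has no influence; then the moments
of the source are adjusted to give the right data at the ends `x = 0`, including those of the leads.
-/
lemma srcOp_add_vertexMatrix_surjective {χ : Cutoff K M}
    (hχ : ∀ e, ∀ x ∈ Icc 0 (G.radius + 1), χ.toFun e x = 1) {R : ℝ} (hR : G.radius + 1 ≤ R)
    (q : Par M) (g : End K M → ℂ) : ∃ (f : G.L2) (y : End K M → ℂ),
      (fun i => (srcOp G R q i ∘L χ.mul G) f) + (vertexMatrix G q).mulVec y = g := by
  have hR0 : 0 ≤ R := (by linarith [radius_nonneg (G := G)])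
  obtain ⟨val, flux, rfl⟩ := vform_surjective (G := G) g
  set β : Edge K M → ℂ := fun e => scaleC q.2 e
  have hexp : ∀ c : ℂ, Complex.exp c ≠ 0 := Complex.exp_ne_zero
  set p : Fin M → ℂ := fun m => val (Sum.inr m) / Complex.exp (β (Sum.inr m) / 2)
  set s : Fin M → ℂ := fun m => flux (Sum.inr m) / Complex.exp (3 * β (Sum.inr m) / 2)
  set cc : Fin M → ℂ := fun m => Complex.cos (kap q (Sum.inr m : Edge K M) * G.len m)
  set ss : Fin M → ℂ := fun m => snc (kap q (Sum.inr m : Edge K M)) (G.len m)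
  set κ : Fin M → ℂ := fun m => kap q (Sum.inr m : Edge K M)
  -- The initial data come from the data `p`, `s` at `x = len m` by the inverse of the transfer
  -- matrix of the edge, whose determinant is the Wronskian `1`. On leads the homogeneous solution
  -- is zero.
  set y : End K M → ℂ := Sum.elim (Sum.elim (fun _ => 0) fun m => cc m * p m - ss m * s m)
    (fun m => κ m ^ 2 * ss m * p m + cc m * s m) with hy
  have hm : ∀ e : Edge K M, mass q e ≠ 0 := fun e => hexp _
  obtain ⟨f, hf⟩ := exists_source hχ hR (kap q)
    (fun e => -(val (Sum.inl e) - endValC G q (homSol q y) (Sum.inl e)) /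
      (Complex.exp (β e / 2) * mass q e))
    (fun e => -(flux (Sum.inl e) - endFluxC G q (homDeriv q y) (Sum.inl e)) /
      (Complex.exp (3 * β e / 2) * mass q e))
  have h1 : ∀ i, srcValOp G R q i (χ.mul G f) = val i - endValC G q (homSol q y) i := by
    rintro (e | m)
    · change -(Complex.exp (β e / 2) * mass q e) * tailOp G R e _ (χ.mul G f) 0 = _
      rw [(hf e).1]
      have := hexp (β e / 2)
      have := hm e
      field_simp
    · change 0 = _ - Complex.exp (β (Sum.inr m) / 2) *
        ((cc m * p m - ss m * s m) * cc m + (κ m ^ 2 * ss m * p m + cc m * s m) * ss m)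
      have h2 : cc m ^ 2 + κ m ^ 2 * ss m ^ 2 = 1 := cos_sq_add_snc_sq _ _
      have h3 : Complex.exp (β (Sum.inr m) / 2) * p m = val (Sum.inr m) :=
        mul_div_cancel₀ _ (hexp _)
      linear_combination Complex.exp (β (Sum.inr m) / 2) * p m * h2 + h3
  have h2 : ∀ i, srcFluxOp G R q i (χ.mul G f) = flux i - endFluxC G q (homDeriv q y) i := by
    rintro (e | m)
    · change -(Complex.exp (3 * β e / 2) * mass q e) * tailOp G R e _ (χ.mul G f) 0 = _
      rw [(hf e).2]
      have := hexp (3 * β e / 2)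
      have := hm e
      field_simp
    · change 0 = _ - 1 * Complex.exp (3 * β (Sum.inr m) / 2) *
        ((cc m * p m - ss m * s m) * (-κ m ^ 2 * ss m) +
          (κ m ^ 2 * ss m * p m + cc m * s m) * cc m)
      have h2 : cc m ^ 2 + κ m ^ 2 * ss m ^ 2 = 1 := cos_sq_add_snc_sq _ _
      have h3 : Complex.exp (3 * β (Sum.inr m) / 2) * s m = flux (Sum.inr m) :=
        mul_div_cancel₀ _ (hexp _)
      linear_combination Complex.exp (3 * β (Sum.inr m) / 2) * s m * h2 + h3
  refine ⟨f, y, ?_⟩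
  rw [vertexMatrix_mulVec]
  ext i
  have h3 : (srcOp G R q i ∘L χ.mul G) f = G.vform
      (fun i => val i + (-1) * endValC G q (homSol q y) i)
      (fun i => flux i + (-1) * endFluxC G q (homDeriv q y) i) i := by
    rw [ContinuousLinearMap.comp_apply, srcOp_apply hR0]
    congr 1
    · ext i; rw [← srcValOp_apply hR0, h1]; ring
    · ext i; rw [← srcFluxOp_apply hR0, h2]; ring
  rw [Pi.add_apply, h3, vform_add_smul]
  ring

/-- The determinant is entire in the spectral parameter and does not vanish at `i`, so its zeros are
isolated. -/
lemma eventually_vertexDet_ne_zero (α : Fin M → ℝ) (lam : ℂ) :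
    ∀ᶠ z in 𝓝[≠] lam, vertexDet G (par z α) ≠ 0 := by
  have han : AnalyticOnNhd ℂ (fun z => vertexDet G (par z α)) univ := fun z _ =>
    analyticAt_of_contDiff (contDiff_vertexDet.comp (contDiff_par α)) z
  rcases (han lam trivial).eventually_eq_zero_or_eventually_ne_zero with h | h
  · exact absurd (han.eqOn_zero_of_preconnected_of_eventuallyEq_zero isPreconnected_univ
      (mem_univ lam) h (mem_univ Complex.I)) (det_vertexMatrix_ne_zero (by simp) α)
  · exact h

lemma vertexDet_eq_zero_of_isResonance {α : Fin M → ℝ} {lam : ℂ} (h : IsResonance G α lam) :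
    vertexDet G (par lam α) = 0 := by
  by_contra hne
  obtain ⟨χ₁, χ₂, hlt⟩ := h
  obtain ⟨R, hR, h₁, h₂⟩ := Cutoff.exists_radius₂ G χ₁ χ₂
  have hev : cutoffResolvent G α χ₁ χ₂ =ᶠ[𝓝[≠] lam] fun z => resFormula G χ₁ χ₂ R (par z α) := by
    filter_upwards [eventually_vertexDet_ne_zero (G := G) α lam] with z hz
      using cutoffResolvent_eq hR h₁ h₂ hz
  rw [meromorphicOrderAt_congr hev] at hlt
  exact not_le.2 hlt (analyticAt_resFormula χ₁ χ₂ R hne).meromorphicOrderAt_nonneg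

/-- The residue of the inverse of the vertex matrix, from that of the cut-off resolvent. -/
lemma exists_residue_vertexMatrix {α : Fin M → ℝ} {lam : ℂ} {χ : Cutoff K M}
    (hχ : ∀ e, ∀ x ∈ Icc 0 (G.radius + 1), χ.toFun e x = 1) {A : G.L2 →L[ℂ] G.L2}
    (hA : Tendsto (fun z => (z - lam) • cutoffResolvent G α χ χ z) (𝓝[≠] lam) (𝓝 A)) :
    ∃ (N : Matrix (End K M) (End K M) ℂ) (Ψ : G.L2 →L[ℂ] (End K M → ℂ)),
      Tendsto (fun z => (z - lam) • (vertexMatrix G (par z α))⁻¹) (𝓝[≠] lam) (𝓝 N) ∧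
      ∀ v, ∃ f, N.mulVec v = Ψ (A f) := by
  obtain ⟨R₀, hR₀⟩ := χ.exists_radius
  set R := max R₀ (G.radius + 1)
  have hR : G.radius + 1 ≤ R := le_max_right _ _
  have h₁ : ∀ e x, R < x → χ.toFun e x = 0 := fun e x hx =>
    hR₀ e x ((le_max_left _ _).trans_lt hx)
  have hp := contDiff_par α
  refine exists_residue_inv (k := fun z => cutKer G χ χ R (par z α))
    (F := cutoffResolvent G α χ χ) (τ := fun z i => srcOp G R (par z α) i ∘L χ.mul G)
    (h := fun z j => cutHom G χ R (par z α) (Pi.single j 1)) ?_ ?_ (fun i => ?_) (fun j => ?_)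
    (eventually_vertexDet_ne_zero α lam) ?_ hA (fun v hv => ?_)
    (srcOp_add_vertexMatrix_surjective hχ hR _)
  · refine Continuous.continuousAt (continuous_pi fun i => continuous_pi fun j => ?_)
    exact ((contDiff_vertexMatrix i j).comp hp).continuous
  · exact ((contDiff_cutKer χ χ R).comp hp).continuous.continuousAt
  · exact (((contDiff_srcOp R i).clm_comp contDiff_const).comp hp).continuous.continuousAt
  · exact ((contDiff_cutHom χ R _).comp hp).continuous.continuousAt
  · filter_upwards [eventually_vertexDet_ne_zero (G := G) α lam] with z hz
      using cutoffResolvent_eq (by linarith) h₁ h₁ hz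
  · rw [← cutHom_sum] at hv
    exact eq_zero_of_cutHom_eq_zero hχ hR hv

/-- The derivative of the vertex matrix in the spectral parameter. -/
def vertexMatrixDeriv (G : MetricGraph J K M) (q : Par M) : Matrix (End K M) (End K M) ℂ :=
  Matrix.of fun i j => fderiv ℂ (fun q : Par M => vertexMatrix G q i j) q (1, 0)

lemma hasDerivAt_vertexMatrix (α : Fin M → ℝ) (lam : ℂ) (i j : End K M) :
    HasDerivAt (fun z => vertexMatrix G (par z α) i j)
      (vertexMatrixDeriv G (par lam α) i j) lam := by
  have h1 : HasFDerivAt (fun q : Par M => vertexMatrix G q i j) _ (par lam α) :=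
    ((contDiff_vertexMatrix i j).differentiable (by simp)).differentiableAt.hasFDerivAt
  have h2 : HasDerivAt (fun z => par z α) ((1 : ℂ), (0 : Fin M → ℂ)) lam :=
    (hasDerivAt_id lam).prodMk (hasDerivAt_const _ _)
  exact h1.comp_hasDerivAt lam h2

/-- Without a pole the cut-off resolvent has residue zero, hence so does `D⁻¹`. But the residue of
`D⁻¹` maps `D' v` to `v` for every kernel vector `v`, which is a contradiction if `v ≠ 0`. -/
theorem isResonance_of_vertexDet_eq_zero {α : Fin M → ℝ} {lam : ℂ}
    (h : vertexDet G (par lam α) = 0) : IsResonance G α lam := by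
  by_contra hres
  obtain ⟨χ, hχ⟩ := exists_cutoff_eq_one G
  have hord : 0 ≤ meromorphicOrderAt (cutoffResolvent G α χ χ) lam :=
    not_lt.1 fun hlt => hres ⟨χ, χ, hlt⟩
  have hmer := ((isContinuedResolvent_cutoffResolvent (G := G) α χ χ).1 (mem_univ lam)).meromorphicAt
  obtain ⟨c, hc⟩ := tendsto_nhds_of_meromorphicOrderAt_nonneg hmer hord
  have hz : Tendsto (fun z => z - lam) (𝓝[≠] lam) (𝓝 0) := by
    have : Tendsto (fun z => z - lam) (𝓝 lam) (𝓝 (lam - lam)) := tendsto_id.sub_const lam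
    rw [sub_self] at this
    exact this.mono_left nhdsWithin_le_nhds
  have hA : Tendsto (fun z => (z - lam) • cutoffResolvent G α χ χ z) (𝓝[≠] lam)
      (𝓝 (0 : G.L2 →L[ℂ] G.L2)) := by
    have := hz.smul hc
    rwa [show (0 : ℂ) • c = 0 from zero_smul ℂ c] at this
  obtain ⟨N, Ψ, hN, hN'⟩ := exists_residue_vertexMatrix hχ hA
  obtain ⟨v, hv0, hv⟩ := Matrix.exists_mulVec_eq_zero_iff.2 h
  have := (residue_mulVec (hasDerivAt_vertexMatrix α lam)
    (eventually_vertexDet_ne_zero α lam) hN).2 v hv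
  obtain ⟨f, hf⟩ := hN' ((vertexMatrixDeriv G (par lam α)).mulVec v)
  rw [this, zero_apply, map_zero] at hf
  exact hv0 hf

/-! ### Deformation of a simple resonance -/

/-- At a simple resonance, the kernel of the vertex matrix is a line, and the inverse of the vertex
matrix has a simple pole. -/
lemma exists_kernel_of_isSimpleResonance {α : Fin M → ℝ} {lam : ℂ}
    (h : IsSimpleResonance G α lam) :
    ∃ (v₀ : End K M → ℂ) (N : Matrix (End K M) (End K M) ℂ), v₀ ≠ 0 ∧
      (vertexMatrix G (par lam α)).mulVec v₀ = 0 ∧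
      (∀ v, (vertexMatrix G (par lam α)).mulVec v = 0 → ∃ c : ℂ, v = c • v₀) ∧
      (∀ v, N.mulVec ((vertexMatrix G (par lam α)).mulVec v) = 0) ∧
      N.mulVec ((vertexMatrixDeriv G (par lam α)).mulVec v₀) = v₀ := by
  obtain ⟨χ, hχ⟩ := exists_cutoff_eq_one G
  obtain ⟨A, hA, hrank⟩ := h.2 χ χ
  obtain ⟨a₀, ha₀⟩ := (rank_submodule_le_one_iff' _).1 hrank
  obtain ⟨N, Ψ, hN, hN'⟩ := exists_residue_vertexMatrix hχ hA
  obtain ⟨h1, h2⟩ := residue_mulVec (hasDerivAt_vertexMatrix α lam)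
    (eventually_vertexDet_ne_zero α lam) hN
  obtain ⟨v₀, hv0, hv⟩ := Matrix.exists_mulVec_eq_zero_iff.2 (vertexDet_eq_zero_of_isResonance h.1)
  -- A kernel vector satisfies `v = N D' v`, so it lies in the image under `Ψ` of the range of the
  -- residue `A`, which is at most a line.
  have hline : ∀ v, (vertexMatrix G (par lam α)).mulVec v = 0 → ∃ c : ℂ, v = c • Ψ a₀ := by
    intro v hv
    obtain ⟨f, hf⟩ := hN' ((vertexMatrixDeriv G (par lam α)).mulVec v)
    rw [h2 v hv] at hf
    obtain ⟨c, hc⟩ := Submodule.mem_span_singleton.1 (ha₀ (LinearMap.mem_range_self _ f))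
    refine ⟨c, ?_⟩
    rw [hf, ← map_smul, hc]
    rfl
  refine ⟨v₀, N, hv0, hv, fun v hv' => ?_, h1, h2 v₀ hv⟩
  obtain ⟨c₀, hc₀⟩ := hline v₀ hv
  obtain ⟨c, hc⟩ := hline v hv'
  have hne : c₀ ≠ 0 := by
    rintro rfl
    exact hv0 (by rw [hc₀, zero_smul])
  exact ⟨c / c₀, by rw [hc₀, smul_smul, div_mul_cancel₀ _ hne, hc]⟩

/-- The equations for a spectral parameter and an element of the kernel of the vertex matrix,
normalized to have the coordinate `c` at the end `i`. -/
def kernelEq (G : MetricGraph J K M) (i : End K M) (c : ℂ)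
    (p : (Fin M → ℂ) × (ℂ × (End K M → ℂ))) : (End K M → ℂ) × ℂ :=
  ((vertexMatrix G (p.2.1, p.1)).mulVec p.2.2, p.2.2 i - c)

lemma contDiff_kernelEq (i : End K M) (c : ℂ) : ContDiff ℂ ω (kernelEq G i c) := by
  have h : ∀ k j, ContDiff ℂ ω fun p : (Fin M → ℂ) × (ℂ × (End K M → ℂ)) =>
      vertexMatrix G (p.2.1, p.1) k j := fun k j =>
    (contDiff_vertexMatrix k j).comp (by fun_prop)
  refine ContDiff.prodMk (contDiff_pi.2 fun k => ?_) (by fun_prop)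
  have hv : ∀ j, ContDiff ℂ ω fun p : (Fin M → ℂ) × (ℂ × (End K M → ℂ)) => p.2.2 j := fun j => by
    fun_prop
  exact ContDiff.sum (s := Finset.univ) fun j _ => (h k j).mul (hv j)

/-- Differentiating along a complex line through the point reduces the partial derivative in the
unknowns to the known derivative of the matrix in `λ` and the product rule. -/
lemma fderiv_kernelEq (i : End K M) (c : ℂ) (lam : ℂ) (α : Fin M → ℝ) (v w : End K M → ℂ) (μ : ℂ) :
    fderiv ℂ (kernelEq G i c) ((par lam α).2, (lam, v)) (0, (μ, w)) =
      (μ • (vertexMatrixDeriv G (par lam α)).mulVec v + (vertexMatrix G (par lam α)).mulVec w,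
        w i) := by
  set u : (Fin M → ℂ) × (ℂ × (End K M → ℂ)) := ((par lam α).2, (lam, v))
  have hd := ((contDiff_kernelEq (G := G) i c).differentiable (by simp)).differentiableAt
    (x := u) |>.hasFDerivAt
  set γ : ℂ → (Fin M → ℂ) × (ℂ × (End K M → ℂ)) := fun τ =>
    ((par lam α).2, (lam + τ * μ, v + τ • w))
  have hγ0 : γ 0 = u := by simp [γ, u]
  have h1 : HasDerivAt (fun τ : ℂ => lam + τ * μ) μ 0 := by
    simpa using ((hasDerivAt_id (0 : ℂ)).mul_const μ).const_add lam
  have h2 : HasDerivAt (fun τ : ℂ => v + τ • w) w 0 := by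
    simpa using ((hasDerivAt_id (0 : ℂ)).smul_const w).const_add v
  have hγ : HasDerivAt γ (0, (μ, w)) 0 := (hasDerivAt_const _ _).prodMk (h1.prodMk h2)
  rw [← hγ0] at hd
  have h3 := hd.comp_hasDerivAt 0 hγ
  rw [hγ0] at h3
  refine h3.unique ?_
  have h4 : ∀ k j, HasDerivAt (fun τ => vertexMatrix G (par (lam + τ * μ) α) k j)
      (vertexMatrixDeriv G (par lam α) k j * μ) 0 := fun k j => by
    have := hasDerivAt_vertexMatrix (G := G) α (lam + 0 * μ) k j
    have := this.comp (0 : ℂ) h1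
    rwa [zero_mul, add_zero] at this
  have h5 : ∀ j, HasDerivAt (fun τ : ℂ => (v + τ • w) j) (w j) 0 := hasDerivAt_pi.1 h2
  refine HasDerivAt.prodMk (hasDerivAt_pi.2 fun k => ?_) ((h5 i).sub_const c)
  have h6 := HasDerivAt.fun_sum (u := Finset.univ) fun j _ => (h4 k j).mul (h5 j)
  refine h6.congr_deriv ?_
  simp only [Pi.add_apply, Pi.smul_apply, Matrix.mulVec, dotProduct, smul_eq_mul, Finset.mul_sum,
    ← Finset.sum_add_distrib, zero_mul, add_zero]
  refine Finset.sum_congr rfl fun j _ => ?_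
  ring

/-- A simple resonance and an element of the kernel of the vertex matrix extend to analytic
families. -/
theorem exists_deformation {α : Fin M → ℝ} {lam : ℂ} (h : IsSimpleResonance G α lam) :
    ∃ φ : (Fin M → ℂ) → ℂ × (End K M → ℂ),
      ContDiffAt ℂ ω φ (par lam α).2 ∧ (φ (par lam α).2).1 = lam ∧
      ∀ᶠ b in 𝓝 (par lam α).2, (φ b).2 ≠ 0 ∧
        (vertexMatrix G ((φ b).1, b)).mulVec (φ b).2 = 0 := by
  obtain ⟨v₀, N, hv0, hv, hline, hN, hN'⟩ := exists_kernel_of_isSimpleResonance h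
  -- Fixing a nonzero coordinate of the kernel vector removes the freedom of scaling; it also keeps
  -- the deformed vector nonzero.
  obtain ⟨i, hi⟩ := Function.ne_iff.1 hv0
  set u : (Fin M → ℂ) × (ℂ × (End K M → ℂ)) := ((par lam α).2, (lam, v₀)) with hu
  have cdf : ContDiffAt ℂ ω (kernelEq G i (v₀ i)) u := (contDiff_kernelEq i (v₀ i)).contDiffAt
  have hu0 : kernelEq G i (v₀ i) u = 0 := by
    change (_, _) = _
    rw [sub_self]
    exact Prod.ext hv rfl
  set f' := fderiv ℂ (kernelEq G i (v₀ i)) u ∘L .inr ℂ (Fin M → ℂ) (ℂ × (End K M → ℂ)) with hf'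
  have hinj : Function.Injective f' := by
    rw [injective_iff_map_eq_zero]
    rintro ⟨μ, w⟩ hw
    have hw' : fderiv ℂ (kernelEq G i (v₀ i)) u (0, (μ, w)) = 0 := hw
    rw [hu, fderiv_kernelEq, Prod.mk_eq_zero] at hw'
    obtain ⟨h1, h2⟩ := hw'
    -- The linearized equation is `μ D' v₀ + D w = 0`. Applying `N` kills `D w` and leaves `μ v₀ =
    -- 0`, so `w` is in the kernel line, and its vanishing `i`-th coordinate makes it zero.
    have h3 := congrArg N.mulVec h1
    rw [Matrix.mulVec_add, Matrix.mulVec_smul, hN, hN', add_zero, Matrix.mulVec_zero] at h3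
    have hμ : μ = 0 := (smul_eq_zero.1 h3).resolve_right hv0
    rw [hμ, zero_smul, zero_add] at h1
    obtain ⟨c, rfl⟩ := hline w h1
    have hc : c = 0 := (mul_eq_zero.1 h2).resolve_right hi
    rw [hμ, hc, zero_smul]
    rfl
  have hinv : f'.IsInvertible := by
    -- Injectivity suffices: both sides have dimension one more than the number of ends.
    refine ⟨(LinearEquiv.ofInjectiveOfFinrankEq (f' : _ →ₗ[ℂ] _) hinj ?_).toContinuousLinearEquiv, ?_⟩
    · simp [add_comm]
    · exact ContinuousLinearMap.ext fun x => rfl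
  have hn : (ω : WithTop ℕ∞) ≠ 0 := by simp
  refine ⟨cdf.implicitFunction hn hinv, cdf.contDiffAt_implicitFunction hn hinv, ?_, ?_⟩
  · have := cdf.implicitFunction_apply_self hn hinv
    exact congrArg Prod.fst this
  · filter_upwards [cdf.eventually_apply_implicitFunction hn hinv] with b hb
    rw [hu0] at hb
    obtain ⟨h1, h2⟩ := Prod.mk_eq_zero.1 hb
    refine ⟨fun h0 => hi ?_, h1⟩
    rw [h0, Pi.zero_apply, zero_sub, neg_eq_zero] at h2
    exact h2

/-- Kernel elements of the vertex matrix are resonant states. -/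
theorem isResonantState_homSol {lam : ℂ} {α : Fin M → ℝ} {z : End K M → ℂ} (hz0 : z ≠ 0)
    (hz : (vertexMatrix G (par lam α)).mulVec z = 0) :
    IsH2loc G (homSol (par lam α) z) (homDeriv (par lam α) z)
      (fun e x => -kap (par lam α) e ^ 2 * homSol (par lam α) z e x) ∧
    IsResonantState G α lam (homSol (par lam α) z) := by
  have hs := isSource_zero (G := G) le_rfl
  have hH := hs.isH2loc (par lam α) z
  have hV := hs.vertexCond (lam := lam) (α := α) (z := z) (by
    rw [hz, srcVal_zero, srcFlux_zero, vform_zero, zero_add])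
  simp only [outSol_zero, outDeriv_zero, Pi.zero_apply, mul_zero, sub_zero] at hH hV
  refine ⟨hH, ?_, ⟨_, _, hH, hV, fun e => Eventually.of_forall fun x => ?_⟩, fun k =>
    ⟨z (Sum.inl (Sum.inl k)), fun x _ => ?_⟩⟩
  · by_contra! h0
    refine hz0 (eq_zero_of_homSol_ae_zero (q := par lam α) fun e => ?_)
    obtain ⟨b, hb, hsub⟩ := exists_Icc_subset_ival (G := G) e
    refine ⟨b, hb, ?_⟩
    filter_upwards [ae_restrict_mem measurableSet_Icc] with x hx using h0 e x (hsub hx)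
  · linear_combination homSol (par lam α) z e x * exp_mul_kap_sq lam α e
  · rw [exp_eq_cos_add_snc]
    simp [homSol, coefP, coefQ, kap, scaleC, par]
    ring

/-- The family is smooth with values in bounded continuous functions on `[0, |R|]`, by analyticity
of `cosB` and `sinB`, and these embed continuously in `L²` of a bounded piece of an edge. -/
lemma smoothL2loc_comb {S : Set ℝ} {p r κ : ℝ → Edge K M → ℂ}
    (hp : ∀ e, ContDiffOn ℝ ∞ (fun t => p t e) S) (hr : ∀ e, ContDiffOn ℝ ∞ (fun t => r t e) S)
    (hκ : ∀ e, ContDiffOn ℝ ∞ (fun t => κ t e) S) :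
    SmoothL2loc G S fun t e x => p t e * Complex.cos (κ t e * x) + r t e * snc (κ t e) x := by
  intro e R
  have : IsFiniteMeasure (volume.restrict (G.ival e ∩ Iic R)) :=
    isFiniteMeasure_restrict.2 (volume_ival_inter_lt_top e R).ne
  have hw : MemLp (fun _ : ℝ => (1 : ℂ)) 2 (volume.restrict (G.ival e ∩ Iic R)) := memLp_const 1
  have hc : ContDiff ℝ ∞ (cosB |R|) := ((contDiff_cosB |R|).restrict_scalars ℝ).of_le le_top
  have hs : ContDiff ℝ ∞ (sinB |R|) := ((contDiff_sinB |R|).restrict_scalars ℝ).of_le le_top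
  refine ⟨fun t => weightB hw (p t e • cosB |R| (κ t e) + r t e • sinB |R| (κ t e)), ?_,
    fun t _ => ?_⟩
  · exact (((weightB hw).contDiff (n := ω)).restrict_scalars ℝ |>.of_le le_top).comp_contDiffOn
      (((hp e).smul (hc.comp_contDiffOn (hκ e))).add ((hr e).smul (hs.comp_contDiffOn (hκ e))))
  · filter_upwards [weightB_apply hw (p t e • cosB |R| (κ t e) + r t e • sinB |R| (κ t e)),
      ae_restrict_mem (measurableSet_ival_inter e R)] with x h1 h2
    rw [h1, one_mul]
    change p t e * cosB |R| (κ t e) x + r t e * sinB |R| (κ t e) x = _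
    rw [cosB_apply, sinB_apply (abs_nonneg R),
      clip_of_mem ⟨nonneg_of_mem_ival G h2.1, h2.2.trans (le_abs_self R)⟩]

/-- Smooth families of kernel elements give smooth families in `H²_loc`. -/
lemma smoothH2loc_homSol {S : Set ℝ} {lam : ℝ → ℂ} {α : ℝ → Fin M → ℝ} {z : ℝ → End K M → ℂ}
    (hlam : ContDiffOn ℝ ∞ lam S) (hα : ∀ m, ContDiffOn ℝ ∞ (fun t => α t m) S)
    (hz : ContDiffOn ℝ ∞ z S) (hz0 : ∀ t ∈ S, z t ≠ 0)
    (hzk : ∀ t ∈ S, (vertexMatrix G (par (lam t) (α t))).mulVec (z t) = 0) :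
    SmoothH2loc G S fun t => homSol (par (lam t) (α t)) (z t) := by
  have hz' : ∀ i, ContDiffOn ℝ ∞ (fun t => z t i) S := contDiffOn_pi.1 hz
  have hpar : ContDiffOn ℝ ∞ (fun t => par (lam t) (α t)) S :=
    hlam.prodMk (contDiffOn_pi.2 fun m => Complex.ofRealCLM.contDiff.comp_contDiffOn (hα m))
  have hκ : ∀ e : Edge K M, ContDiffOn ℝ ∞ (fun t => kap (par (lam t) (α t)) e) S := fun e =>
    (((contDiff_kap e).restrict_scalars ℝ).of_le le_top).comp_contDiffOn hpar
  have hP : ∀ e : Edge K M, ContDiffOn ℝ ∞ (fun t => coefP (z t) e) S := fun e => hz' _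
  have hQ : ∀ e : Edge K M, ContDiffOn ℝ ∞ (fun t => coefQ (lam t) (z t) e) S := by
    rintro (k | m)
    · exact (contDiffOn_const.mul hlam).mul (hz' _)
    · exact hz' _
  refine ⟨_, _, fun t ht => (isResonantState_homSol (hz0 t ht) (hzk t ht)).1,
    smoothL2loc_comb hP hQ hκ, ?_, ?_⟩
  · have := smoothL2loc_comb (G := G) hQ
      (fun e => (hP e).mul (((hκ e).pow 2).neg)) hκ
    convert this using 4 with t e x
    simp only [homDeriv, par]
    ring
  · have := smoothL2loc_comb (G := G) (fun e => (((hκ e).pow 2).neg).mul (hP e))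
      (fun e => (((hκ e).pow 2).neg).mul (hQ e)) hκ
    convert this using 4 with t e x
    simp only [homSol, par]
    ring

/-- Simple resonances and their resonant states depend smoothly on the deformation. -/
theorem exists_smooth_resonance {t₀ : ℝ} (ht₀ : 0 < t₀) {a : ℝ → Fin M → ℝ}
    (ha : ∀ m, ContDiffOn ℝ ∞ (fun t => a t m) (Ioo (-t₀) t₀)) {lam₀ : ℂ}
    (h : IsSimpleResonance G (a 0) lam₀) :
    ∃ ε : ℝ, 0 < ε ∧ ε ≤ t₀ ∧ ∃ (lam : ℝ → ℂ) (u : ℝ → Edge K M → ℝ → ℂ),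
      lam 0 = lam₀ ∧ ContDiffOn ℝ ∞ lam (Ioo (-ε) ε) ∧ SmoothH2loc G (Ioo (-ε) ε) u ∧
      ∀ t ∈ Ioo (-ε) ε, IsResonance G (a t) (lam t) ∧ IsResonantState G (a t) (lam t) (u t) := by
  obtain ⟨φ, hφ, hφ0, hev⟩ := exists_deformation h
  set b : ℝ → Fin M → ℂ := fun t m => (a t m : ℂ)
  have hb : ContDiffOn ℝ ∞ b (Ioo (-t₀) t₀) :=
    contDiffOn_pi.2 fun m => Complex.ofRealCLM.contDiff.comp_contDiffOn (ha m)
  have hb0 : ContinuousAt b 0 :=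
    hb.continuousOn.continuousAt (Ioo_mem_nhds (neg_lt_zero.2 ht₀) ht₀)
  -- The radius is chosen so that along `b t` the implicit function remains analytic and its kernel
  -- equation remains valid.
  obtain ⟨ε', hε', hball⟩ := Metric.eventually_nhds_iff.1
    (hb0.eventually ((hφ.eventually (by simp)).and hev))
  refine ⟨min ε' t₀, lt_min hε' ht₀, min_le_right _ _, fun t => (φ (b t)).1,
    fun t => homSol (par (φ (b t)).1 (a t)) (φ (b t)).2, hφ0, ?_⟩
  have hS : ∀ t ∈ Ioo (-min ε' t₀) (min ε' t₀), t ∈ Ioo (-t₀) t₀ ∧ dist t 0 < ε' := by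
    intro t ht
    have h1 := abs_lt.2 ht
    refine ⟨abs_lt.1 (h1.trans_le (min_le_right _ _)), ?_⟩
    rw [Real.dist_0_eq_abs]
    exact h1.trans_le (min_le_left _ _)
  have hsm : ContDiffOn ℝ ∞ (fun t => φ (b t)) (Ioo (-min ε' t₀) (min ε' t₀)) := by
    intro t ht
    obtain ⟨h1, h2⟩ := hS t ht
    have h3 : ContDiffAt ℝ ∞ φ (b t) := ((hball h2).1.restrict_scalars ℝ).of_le le_top
    exact h3.comp_contDiffWithinAt t ((hb t h1).mono fun s hs => (hS s hs).1)
  have hk : ∀ t ∈ Ioo (-min ε' t₀) (min ε' t₀), (φ (b t)).2 ≠ 0 ∧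
      (vertexMatrix G (par (φ (b t)).1 (a t))).mulVec (φ (b t)).2 = 0 := fun t ht =>
    (hball (hS t ht).2).2
  refine ⟨hsm.fst, smoothH2loc_homSol hsm.fst (fun m => (ha m).mono fun t ht => (hS t ht).1)
    hsm.snd (fun t ht => (hk t ht).1) fun t ht => (hk t ht).2, fun t ht => ⟨?_, ?_⟩⟩
  · exact isResonance_of_vertexDet_eq_zero
      (Matrix.exists_mulVec_eq_zero_iff.1 ⟨_, (hk t ht).1, (hk t ht).2⟩)
  · exact (isResonantState_homSol (hk t ht).1 (hk t ht).2).2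

/-! ### Smoothness of the contour integrals -/

section Parametric
variable {E : Type*} [NormedAddCommGroup E] [NormedSpace ℝ E]

lemma hasDerivAt_fst_of_contDiffOn {S : Set ℝ} (hS : IsOpen S) {F : ℝ × ℝ → E}
    (hF : ContDiffOn ℝ ∞ F (S ×ˢ univ)) {t : ℝ} (ht : t ∈ S) (s : ℝ) :
    HasDerivAt (fun t => F (t, s)) (fderiv ℝ F (t, s) (1, 0)) t := by
  have h1 : HasFDerivAt F (fderiv ℝ F (t, s)) (t, s) :=
    ((hF.contDiffAt ((hS.prod isOpen_univ).mem_nhds ⟨ht, trivial⟩)).differentiableAt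
      (by simp)).hasFDerivAt
  exact h1.comp_hasDerivAt t ((hasDerivAt_id t).prodMk (hasDerivAt_const t s))

/-- Differentiation under the integral sign; the dominating constant is a bound for the partial
derivative on the compact product of a closed ball around `t` and the interval of integration. -/
lemma hasDerivAt_integral_of_contDiffOn {S : Set ℝ} (hS : IsOpen S) {F : ℝ × ℝ → E}
    (hF : ContDiffOn ℝ ∞ F (S ×ˢ univ)) (a b : ℝ) {t : ℝ} (ht : t ∈ S) :
    HasDerivAt (fun t => ∫ s in a..b, F (t, s)) (∫ s in a..b, fderiv ℝ F (t, s) (1, 0)) t := by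
  have hcont : ∀ {H : ℝ × ℝ → E}, ContinuousOn H (S ×ˢ univ) → ∀ {t}, t ∈ S →
      Continuous fun s => H (t, s) := fun hH t ht =>
    hH.comp_continuous (by fun_prop) fun s => ⟨ht, trivial⟩
  have hD : ContinuousOn (fun p => fderiv ℝ F p (1, 0)) (S ×ˢ univ) :=
    ((hF.fderiv_of_isOpen (m := ∞) (hS.prod isOpen_univ) (by simp)).clm_apply
      contDiffOn_const).continuousOn
  obtain ⟨δ, hδ, hball⟩ := Metric.nhds_basis_closedBall.mem_iff.1 (hS.mem_nhds ht)
  obtain ⟨C, hC⟩ := ((isCompact_closedBall t δ).prod (isCompact_uIcc (a := a) (b := b))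
    ).exists_bound_of_continuousOn (hD.mono (prod_mono hball (subset_univ _)))
  refine (intervalIntegral.hasDerivAt_integral_of_dominated_loc_of_deriv_le
    (F := fun t s => F (t, s)) (F' := fun t s => fderiv ℝ F (t, s) (1, 0)) (bound := fun _ => C)
    (Metric.closedBall_mem_nhds t hδ) ?_ ((hcont hF.continuousOn ht).intervalIntegrable _ _)
    (hcont hD ht).aestronglyMeasurable (Eventually.of_forall fun s hs x hx =>
      hC (x, s) ⟨hx, uIoc_subset_uIcc hs⟩) intervalIntegrable_const
    (Eventually.of_forall fun s _ x hx => hasDerivAt_fst_of_contDiffOn hS hF (hball hx) s)).2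
  filter_upwards [hS.mem_nhds ht] with x hx using (hcont hF.continuousOn hx).aestronglyMeasurable

/-- Integrals of smooth functions depend smoothly on parameters. -/
theorem contDiffOn_integral {S : Set ℝ} (hS : IsOpen S) {F : ℝ × ℝ → E}
    (hF : ContDiffOn ℝ ∞ F (S ×ˢ univ)) (a b : ℝ) :
    ContDiffOn ℝ ∞ (fun t => ∫ s in a..b, F (t, s)) S := by
  refine contDiffOn_infty.2 fun n => ?_
  -- The derivative of the integral is again the integral of a smooth function, so the induction
  -- must allow `F` to vary.
  induction n generalizing F with
  | zero => exact contDiffOn_zero.2 fun t ht =>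
      (hasDerivAt_integral_of_contDiffOn hS hF a b ht).continuousAt.continuousWithinAt
  | succ n ih =>
    rw [Nat.cast_add, Nat.cast_one, contDiffOn_succ_iff_deriv_of_isOpen hS]
    refine ⟨fun t ht => (hasDerivAt_integral_of_contDiffOn hS hF a b
      ht).differentiableAt.differentiableWithinAt, by simp, ?_⟩
    refine (ih ((hF.fderiv_of_isOpen (m := ∞) (hS.prod isOpen_univ) (by simp)).clm_apply
      (contDiffOn_const (c := ((1 : ℝ), (0 : ℝ)))))).congr fun t ht => ?_
    exact (hasDerivAt_integral_of_contDiffOn hS hF a b ht).deriv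

end Parametric

/-- The integrals of the cut-off resolvents along a smooth curve without resonances. -/
theorem contDiffOn_contourIntegral {S : Set ℝ} (hS : IsOpen S) {a : ℝ → Fin M → ℝ}
    (ha : ∀ m, ContDiffOn ℝ ∞ (fun t => a t m) S) {γ : ℝ → ℂ} (hγ : ContDiff ℝ ∞ γ)
    (hres : ∀ t ∈ S, ∀ s, ¬ IsResonance G (a t) (γ s)) (χ₁ χ₂ : Cutoff K M) :
    (∀ t ∈ S, IntervalIntegrable
      (fun s => deriv γ s • cutoffResolvent G (a t) χ₁ χ₂ (γ s)) volume 0 1) ∧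
    ContDiffOn ℝ ∞
      (fun t => ∫ s in (0 : ℝ)..1, deriv γ s • cutoffResolvent G (a t) χ₁ χ₂ (γ s)) S := by
  obtain ⟨R, hR, h₁, h₂⟩ := Cutoff.exists_radius₂ G χ₁ χ₂
  -- The absence of resonances is turned into a nonvanishing determinant, so that on the curve the
  -- resolvent is given by a formula that is jointly smooth in `t` and `s`.
  have hdet : ∀ t ∈ S, ∀ s, vertexDet G (par (γ s) (a t)) ≠ 0 := fun t ht s h0 =>
    hres t ht s (isResonance_of_vertexDet_eq_zero h0)
  set F : ℝ × ℝ → G.L2 →L[ℂ] G.L2 := fun p =>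
    deriv γ p.2 • resFormula G χ₁ χ₂ R (par (γ p.2) (a p.1))
  have hF : ContDiffOn ℝ ∞ F (S ×ˢ univ) := by
    have hγ2 : ContDiffOn ℝ ∞ (fun p : ℝ × ℝ => γ p.2) (S ×ˢ univ) :=
      (hγ.comp contDiff_snd).contDiffOn
    have hpar : ContDiffOn ℝ ∞ (fun p : ℝ × ℝ => par (γ p.2) (a p.1)) (S ×ˢ univ) :=
      hγ2.prodMk (contDiffOn_pi.2 fun m => Complex.ofRealCLM.contDiff.comp_contDiffOn
        ((ha m).comp contDiff_fst.contDiffOn fun p hp => hp.1))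
    have hder : ContDiff ℝ ∞ (deriv γ) := (contDiff_infty_iff_deriv.1 hγ).2
    refine ((hder.comp contDiff_snd).contDiffOn).smul fun p hp => ?_
    have h3 : ContDiffAt ℝ ∞ (resFormula G χ₁ χ₂ R) (par (γ p.2) (a p.1)) :=
      ((contDiffAt_resFormula χ₁ χ₂ R (hdet p.1 hp.1 p.2)).restrict_scalars ℝ).of_le le_top
    exact h3.comp_contDiffWithinAt p (hpar p hp)
  have heq : ∀ t ∈ S, ∀ s, deriv γ s • cutoffResolvent G (a t) χ₁ χ₂ (γ s) = F (t, s) :=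
    fun t ht s => by rw [cutoffResolvent_eq hR h₁ h₂ (hdet t ht s)]
  refine ⟨fun t ht => ?_, (contDiffOn_integral hS hF 0 1).congr fun t ht => ?_⟩
  · simp only [heq t ht]
    exact (hF.continuousOn.comp_continuous (f := fun s : ℝ => (t, s)) (by fun_prop)
      fun s => ⟨ht, trivial⟩).intervalIntegrable _ _
  · simp only [heq t ht]

end QuantumGraph

end

open QuantumGraph in
theorem proposition5 {J K M : ℕ} (hK : 0 < K) (G : MetricGraph J K M)
    (t₀ : ℝ) (ht₀ : 0 < t₀) (a : ℝ → Fin M → ℝ)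
    (ha : ∀ m, ContDiffOn ℝ ∞ (fun t => a t m) (Set.Ioo (-t₀) t₀))
    (ha0 : ∀ m, a 0 m = 0) :
    -- the cut-off resolvents of `P(t)` continue meromorphically to `ℂ`
    (∀ t ∈ Set.Ioo (-t₀) t₀, ∀ χ₁ χ₂ : Cutoff K M,
      IsContinuedResolvent G (a t) χ₁ χ₂ (cutoffResolvent G (a t) χ₁ χ₂)) ∧
    -- smoothness of the contour integrals
    (∀ γ : ℝ → ℂ, IsSmoothJordanCurve γ →
      (∀ t ∈ Set.Ioo (-t₀) t₀, ∀ s : ℝ, ¬ IsResonance G (a t) (γ s)) →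
      ∀ χ₁ χ₂ : Cutoff K M,
        (∀ t ∈ Set.Ioo (-t₀) t₀, IntervalIntegrable
          (fun s => deriv γ s • cutoffResolvent G (a t) χ₁ χ₂ (γ s)) MeasureTheory.volume 0 1) ∧
        ContDiffOn ℝ ∞
          (fun t => ∫ s in (0 : ℝ)..1, deriv γ s • cutoffResolvent G (a t) χ₁ χ₂ (γ s))
          (Set.Ioo (-t₀) t₀)) ∧
    -- smooth deformation of a simple resonance and of its resonant state
    (∀ lam₀ : ℂ, IsSimpleResonance G (a 0) lam₀ →
      ∃ ε : ℝ, 0 < ε ∧ ε ≤ t₀ ∧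
      ∃ (lam : ℝ → ℂ) (u : ℝ → Edge K M → ℝ → ℂ),
        lam 0 = lam₀ ∧
        ContDiffOn ℝ ∞ lam (Set.Ioo (-ε) ε) ∧
        SmoothH2loc G (Set.Ioo (-ε) ε) u ∧
        ∀ t ∈ Set.Ioo (-ε) ε,
          IsResonance G (a t) (lam t) ∧ IsResonantState G (a t) (lam t) (u t)) := by
  refine ⟨fun t _ χ₁ χ₂ => isContinuedResolvent_cutoffResolvent (a t) χ₁ χ₂,
    fun γ hγ hres χ₁ χ₂ => contDiffOn_contourIntegral isOpen_Ioo ha hγ.smooth hres χ₁ χ₂,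
    fun lam₀ h => exists_smooth_resonance ht₀ ha h⟩
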